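/- **Setting.** Let $V$ be a finite-dimensional complex Hilbert space, $H_{\rm mix}$ and $H_{\rm cost}$ self-adjoint operators on $V$, and $(|i\rangle)_{i\in I}$ an orthonormal basis of cost eigenstates, $H_{\rm cost}|i\rangle=E_i|i\rangle$. For real $f,\Delta$ let $$U(f,\Delta)=e^{-i\Delta(1-f)H_{\rm mix}}\,e^{-i\Delta f H_{\rm cost}}.$$ Put $D_i=\langle i|H_{\rm mix}|i\rangle$. A *coupling path of length $k$* from $x$ to $y$ is a tuple $S=(s_0=x,s_1,\dots,s_{k-1})$ of basis states such that, with $s_k=y$, $$P(S)=\prod_{j=0}^{k-1}\langle s_j|H_{\rm mix}|s_{j+1}\rangle\neq0 .$$ The states $x,y$ are *$k$-coupled* if the shortest coupling path between them has length $k$. Define $Q^0=1$ and, for real $b_1,\dots,b_n$, $$Q^n(b_1,\dots,b_n)=\frac1{(n+1)!}-\sum_{m=1}^n\frac{1+ib_m}{2\cdot m!}\,Q^{n-m}(b_{m+1},\dots,b_n).$$ **Hypotheses.** Let $\Delta^*\neq0$ be real and let $x,y$ be basis states with $E_x\ne E_y$ and $e^{-i\Delta^*E_x}=e^{-i\Delta^*E_y}=:\lambda_0$,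 while $e^{-i\Delta^*E_z}\neq\lambda_0$ for every basis state $z\neq x,y$ (so $E_x,E_y$ are non-degenerate, and they are the only energies with phase $\lambda_0$ at $\Delta^*$). Suppose $x,y$ are $k$-coupled. Put $$\Gamma=\frac{D_x-D_y}{E_x-E_y},\qquad c_{\rm eff}^{x,y}=\sum_S P(S)\,Q^{k-1}(a_1^S,\dots,a_{k-1}^S),\qquad a_j^S=\cot\!\Big(\frac{\Delta^*}{2}(E_{s_j}-E_x)\Big),$$ where the sum is over all coupling paths of length $k$ from $x$ to $y$. **Conclusion.** For every sufficiently small $\rho>0$ the following hold. For $(f,\Delta)$ close to $(1,\Delta^*)$, exactly two eigenvalues $\lambda_1,\lambda_2$ of $U(f,\Delta)$, counted with multiplicity, lie in the disc $|\lambda-\lambda_0|<\rho$. For $\eta>0$ let $|g|=|g|(\delta)$ be the infimum of the distance $|\lambda_1-\lambda_2|$ over $f\in[1-\eta,1+\eta]$ at the fixed value $\Delta=\Delta^*+\delta$, that is, the gap of the avoided crossing near $f=1$. 1. If $k\ge2$ and $\Gamma\neq1$, then for every sufficiently small $\eta>0$, as $\delta\to0$ (with either sign), $$|g|=2\,|c_{\rm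 eff}^{x,y}|\,\Big|\frac{\delta}{\Gamma-1}\Big|^k+O(\delta^{k+1}).$$ 2. If $k=1$, then with $c=\langle x|H_{\rm mix}|y\rangle$, for every sufficiently small $\eta>0$, as $\delta\to0$, $$|g|=\frac{2|c|\,|\delta|}{\sqrt{(\Gamma-1)^2+\big(\frac{2|c|}{E_x-E_y}\big)^2}}+O(\delta^2).$$ 3. If $c_{\rm eff}^{x,y}\neq0$ (for any $k\ge 1$ and any $\Gamma$), then the degeneracy $\lambda_1=\lambda_2=\lambda_0$ at $(f,\Delta)=(1,\Delta^*)$ is isolated: some neighbourhood of $(1,\Delta^*)$ in the $(f,\Delta)$-plane contains no other point with $\lambda_1=\lambda_2$. -/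

import Mathlib

open Filter Topology Asymptotics

namespace QAOA

noncomputable section

variable {V : Type*} [NormedAddCommGroup V] [InnerProductSpace ℂ V]
variable {ι : Type*} [Fintype ι]

/-- The QAOA unitary `e^{-iΔ(1-f) H_mix} e^{-iΔ f H_cost}`. -/
def unitary (Hmix Hcost : V →L[ℂ] V) (f Δ : ℝ) : V →L[ℂ] V :=
  NormedSpace.exp ((-Complex.I * (Δ : ℂ) * (1 - (f : ℂ))) • Hmix) *
    NormedSpace.exp ((-Complex.I * (Δ : ℂ) * (f : ℂ)) • Hcost)

/-- The matrix element `⟨i|A|j⟩` in the orthonormal basis `b`. -/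
def matElem (b : OrthonormalBasis ι ℂ V) (A : V →L[ℂ] V) (i j : ι) : ℂ :=
  inner ℂ (b i) (A (b j))

/-- The diagonal element `D_i = ⟨i|A|i⟩` (a real number when `A` is self-adjoint). -/
def diagElem (b : OrthonormalBasis ι ℂ V) (A : V →L[ℂ] V) (i : ι) : ℝ :=
  (matElem b A i i).re

/-- `Γ = (D_x - D_y) / (E_x - E_y)`. -/
def Gam (b : OrthonormalBasis ι ℂ V) (Hmix : V →L[ℂ] V) (E : ι → ℝ) (x y : ι) : ℝ :=
  (diagElem b Hmix x - diagElem b Hmix y) / (E x - E y)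

/-- The product of mixer matrix elements along `s_0, s_1, …, s_n`:
`P(s) = ⟨s_0|H_mix|s_1⟩ ⟨s_1|H_mix|s_2⟩ ⋯ ⟨s_{n-1}|H_mix|s_n⟩`. -/
def pathWeight (b : OrthonormalBasis ι ℂ V) (Hmix : V →L[ℂ] V) {n : ℕ}
    (s : Fin (n + 1) → ι) : ℂ :=
  ∏ j : Fin n, matElem b Hmix (s j.castSucc) (s j.succ)

/-- A coupling path of length `n` from `x` to `y`. The endpoint `s_n = y` is recorded as the last
entry, so that the tuple `(s_0 = x, s_1, …, s_{n-1})` without it has `n` entries. -/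
def IsCouplingPath (b : OrthonormalBasis ι ℂ V) (Hmix : V →L[ℂ] V) (x y : ι) {n : ℕ}
    (s : Fin (n + 1) → ι) : Prop :=
  s 0 = x ∧ s (Fin.last n) = y ∧ pathWeight b Hmix s ≠ 0

/-- `x` and `y` are `k`-coupled: the shortest coupling path between them has length `k`. -/
def IsKCoupled (b : OrthonormalBasis ι ℂ V) (Hmix : V →L[ℂ] V) (x y : ι) (k : ℕ) : Prop :=
  IsLeast {n : ℕ | ∃ s : Fin (n + 1) → ι, IsCouplingPath b Hmix x y s} k

/-- The polynomials `Q^n(b_1, …, b_n)`, with `Q^0 = 1` and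
`Q^n(b_1, …, b_n) = 1/(n+1)! - ∑_{m=1}^n (1 + i b_m) / (2 · m!) · Q^{n-m}(b_{m+1}, …, b_n)`.
The variable `b_m` is `b ⟨m - 1, _⟩`, and the summation index below is `m - 1`. -/
def Q : (n : ℕ) → (Fin n → ℝ) → ℂ
  | n, b => 1 / (Nat.factorial (n + 1) : ℂ) -
      ∑ m : Fin n, (1 + Complex.I * (b m : ℂ)) / (2 * (Nat.factorial (m.val + 1) : ℂ)) *
        Q (n - (m.val + 1)) (fun j => b ⟨m.val + 1 + j.val, by omega⟩)
termination_by n => n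
decreasing_by omega

/-- `a_j = cot ((Δ*/2) (E_{s_j} - E_x))` for `j = 1, …, k - 1` (here `j - 1` is the index). -/
def cotSeq (E : ι → ℝ) (Δs : ℝ) (x : ι) {k : ℕ} (s : Fin (k + 1) → ι) : Fin (k - 1) → ℝ :=
  fun j => Real.cot (Δs / 2 * (E (s ⟨j.val + 1, by omega⟩) - E x))

open Classical in
/-- The effective coupling: the sum over all coupling paths of length `k` from `x` to `y` of
`P(s) Q^{k-1}(a_1, …, a_{k-1})`. -/
def cEff (b : OrthonormalBasis ι ℂ V) (Hmix : V →L[ℂ] V) (E : ι → ℝ) (Δs : ℝ) (x y : ι)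
    (k : ℕ) : ℂ :=
  ∑ s ∈ (Finset.univ : Finset (Fin (k + 1) → ι)).filter (fun s => IsCouplingPath b Hmix x y s),
    pathWeight b Hmix s * Q (k - 1) (cotSeq E Δs x s)

open Classical in
/-- The eigenvalues of `U` in the open disc of radius `ρ` about `z`, with multiplicity. -/
def eigenvaluesIn [FiniteDimensional ℂ V] (U : V →L[ℂ] V) (z : ℂ) (ρ : ℝ) : Multiset ℂ :=
  (LinearMap.charpoly (U : V →ₗ[ℂ] V)).roots.filter (fun w => w ∈ Metric.ball z ρ)

/-- The diameter of the set of eigenvalues of `U` in the disc of radius `ρ` about `z`. When the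
disc holds exactly two eigenvalues `λ₁, λ₂` (with multiplicity) this is `|λ₁ - λ₂|`. -/
def gapIn [FiniteDimensional ℂ V] (U : V →L[ℂ] V) (z : ℂ) (ρ : ℝ) : ℝ :=
  Metric.diam {w : ℂ | w ∈ eigenvaluesIn U z ρ}

theorem gapIn_eq [FiniteDimensional ℂ V] {U : V →L[ℂ] V} {z : ℂ} {ρ : ℝ} {l₁ l₂ : ℂ}
    (h : eigenvaluesIn U z ρ = {l₁, l₂}) : gapIn U z ρ = ‖l₁ - l₂‖ := by
  have : {w : ℂ | w ∈ eigenvaluesIn U z ρ} = {l₁, l₂} := by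
    ext w
    simp [h]
  rw [gapIn, this, Metric.diam_pair, dist_eq_norm]

/-- The gap of the avoided crossing along the path of fixed `Δ`: the smallest distance between the
two eigenvalues near `z` as `f` runs over the interval `[1 - η, 1 + η]` about `1`. -/
def avoidedGap [FiniteDimensional ℂ V] (Hmix Hcost : V →L[ℂ] V) (z : ℂ) (ρ η Δ : ℝ) : ℝ :=
  sInf ((fun f : ℝ => gapIn (unitary Hmix Hcost f Δ) z ρ) '' Set.Icc (1 - η) (1 + η))

/-- A gap function on the `(f, Δ)`-plane has an isolated degeneracy at `p`: it vanishes at `p` and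
at no other point of some neighbourhood of `p`. -/
def IsIsolatedDegeneracy (gap : ℝ × ℝ → ℝ) (p : ℝ × ℝ) : Prop :=
  gap p = 0 ∧ ∀ᶠ q in 𝓝[≠] p, gap q ≠ 0

end

end QAOA

/-! With `τ = Δ (1 - f)` and `δ = Δ - Δs` the unitary becomes `exp(-iτH) exp(-i(Δs + δ - τ)E)`. At
the origin it is diagonal, and the eigenspace of `l₀` is spanned by the states `x` and `y`.
Eliminating all other states at a spectral parameter `l` (Feshbach map) leaves a 2×2 matrix `F(l)`.
The restriction to `x, y` of an eigenvector with eigenvalue `l` is fixed up to the factor `l` by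
`F(l)` (`feshbach_mulVec_of_eigenvector`), and `F(l)` is unitary when `|l| = 1`
(`feshbach_unitary`). The eigenvalues of a unitary 2×2 matrix are at distance `√(α² + 4β²)`, where
`α` is the modulus of the diagonal difference and `β` that of an off-diagonal entry
(`norm_discrim_of_unitary`). Since `F(l)` is Lipschitz in `l` with constant `O(τ)`, the true gap `g`
differs from this root by at most `O(τ) g` (`EffBounds.gapBound`).

To first order `α = |eδ + Dτ|`, with `e = E x - E y` and `D = e (Γ - 1)`. For `β`, conjugation by
powers of `τ` graded by the distance to `y` turns `τH` into a family that stays regular at `τ = 0`,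
where only hops towards `y` survive. This exhibits the off-diagonal entry as `τ^k h` with `h`
differentiable at the base point (`exists_effMatrix_apply_eq`). The limiting hopping matrix is
nilpotent, so the base value of `h` is a finite sum over shortest paths; expanding the exponential
along them gives the recursion of `Q`, with the cotangents coming from the denominators of the
non-resonant states (`expTail_eq_walkSum`, `feshbach_apply_of_grading`). Its modulus is that of the
effective coupling (`norm_offCoeff`).

It remains to minimise over `τ`. If `k ≥ 2` and `D ≠ 0`, a small gap forces `τ = -eδ/D + O(δ²)`,
which determines `β` and gives the lower bound. The upper bound needs a `τ` where `α = O(τ^(k+1))`,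
far finer than the first-order expansion; an open mapping argument with an auxiliary spectral
parameter supplies it (`Resonant.eventually_exists_diag_eq`). If `k = 1`, both terms have the same
order and a linear model is minimised by completing the square. If the effective coupling is
nonzero, a vanishing gap forces `β = 0`, hence `τ = 0`, and then `α = 0` forces `δ = 0`. -/

namespace QAOA

open Matrix

/-! ### Diagonalization of unitary matrices. -/

section LinearAlgebra

variable {ι : Type*} [Fintype ι] [DecidableEq ι]

/-- Some point of the unit circle is not an eigenvalue of a given matrix. -/
theorem exists_norm_one_isUnit_smul_one_sub (u : Matrix ι ι ℂ) :
    ∃ μ : ℂ, ‖μ‖ = 1 ∧ IsUnit (μ • (1 : Matrix ι ι ℂ) - u) := by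
  have hinf : (Metric.sphere (0 : ℂ) 1).Infinite := by
    refine (isPreconnected_sphere (by simp [Complex.rank_real_complex]) 0 1).infinite_of_nontrivial
      ⟨1, by simp, -1, by simp, fun h => ?_⟩
    have := congrArg Complex.re h
    norm_num at this
  have hfin : (u.charpoly.roots.toFinset : Set ℂ).Finite := Finset.finite_toSet _
  obtain ⟨μ, hμ, hroot⟩ := (hinf.sdiff hfin).nonempty
  refine ⟨μ, by simpa using hμ, ?_⟩
  rw [Matrix.isUnit_iff_isUnit_det, isUnit_iff_ne_zero]
  intro h
  apply hroot
  simp only [Finset.mem_coe, Multiset.mem_toFinset]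
  rw [Polynomial.mem_roots u.charpoly_monic.ne_zero, Polynomial.IsRoot, Matrix.eval_charpoly]
  simpa [Matrix.smul_one_eq_diagonal] using h

/-- A unitary matrix is unitarily diagonalizable. -/
theorem exists_unitary_mul_eq_mul_diagonal {u : Matrix ι ι ℂ} (hu : uᴴ * u = 1) :
    ∃ (V : Matrix ι ι ℂ) (d : ι → ℂ), Vᴴ * V = 1 ∧ u * V = V * diagonal d := by
  obtain ⟨μ, hμ, hunit⟩ := exists_norm_one_isUnit_smul_one_sub u
  have hu' : u * uᴴ = 1 := mul_eq_one_comm.mp hu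
  have hμ' : starRingEnd ℂ μ * μ = 1 := by
    rw [mul_comm, Complex.mul_conj, Complex.normSq_eq_norm_sq, hμ]; simp
  set g : Matrix ι ι ℂ := μ • 1 - u with hg
  obtain ⟨G, hG⟩ := hunit
  set gi : Matrix ι ι ℂ := ((G⁻¹ : (Matrix ι ι ℂ)ˣ) : Matrix ι ι ℂ) with hgi
  have h1 : g * gi = 1 := by rw [← hG]; simp [hgi]
  have h2 : gi * g = 1 := by rw [← hG]; simp [hgi]
  -- Cayley transform with base point `μ` off the spectrum: `h` is Hermitian, and solving `i (μ + u)
  -- = κ (μ - u)` for `u` gives the eigenvalues `μ (κ - i) / (κ + i)` used below.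
  set h : Matrix ι ι ℂ := Complex.I • ((μ • 1 + u) * gi) with hh
  have hhg : h * g = Complex.I • (μ • 1 + u) := by
    rw [hh, smul_mul_assoc, mul_assoc, h2, mul_one]
  have hgH : gᴴ * giᴴ = 1 := by rw [← conjTranspose_mul, h2, conjTranspose_one]
  have hgH' : giᴴ * gᴴ = 1 := by rw [← conjTranspose_mul, h1, conjTranspose_one]
  have hherm : h.IsHermitian := by
    have e1 : gᴴ * h * g = gᴴ * hᴴ * g := by
      have : gᴴ * hᴴ * g = (h * g)ᴴ * g := by rw [conjTranspose_mul]
      rw [this, mul_assoc, hhg, hg]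
      simp only [conjTranspose_sub, conjTranspose_smul, conjTranspose_add, conjTranspose_one,
        Complex.star_def, Complex.conj_I]
      simp only [sub_mul, mul_sub, add_mul, mul_add, smul_mul_assoc, mul_smul_comm, one_mul,
        mul_one, smul_sub, smul_add, smul_smul, hu]
      have e : μ * starRingEnd ℂ μ = 1 := by rw [mul_comm, hμ']
      have e' : starRingEnd ℂ μ * μ = 1 := hμ'
      ext i j
      simp only [Matrix.sub_apply, Matrix.add_apply, Matrix.smul_apply, smul_eq_mul]
      linear_combination ((1 : Matrix ι ι ℂ) i j * Complex.I * 2) * hμ'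
    have e2 : gᴴ * (h * g) = gᴴ * (hᴴ * g) := by rw [← mul_assoc, e1, mul_assoc]
    have e3 : h * g = hᴴ * g := by
      have := congrArg (giᴴ * ·) e2
      simpa only [← mul_assoc, hgH', one_mul] using this
    have e4 : h = hᴴ := by
      have := congrArg (· * gi) e3
      simpa only [mul_assoc, h1, mul_one] using this
    exact e4.symm
  have hVV := hherm.eigenvectorUnitary.2
  rw [Matrix.mem_unitaryGroup_iff'] at hVV
  refine ⟨hherm.eigenvectorUnitary,
    fun i => μ * ((hherm.eigenvalues i : ℂ) - Complex.I) / ((hherm.eigenvalues i : ℂ) + Complex.I),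
    hVV, ?_⟩
  have hsp : h * (hherm.eigenvectorUnitary : Matrix ι ι ℂ) =
      (hherm.eigenvectorUnitary : Matrix ι ι ℂ) * diagonal (fun i => (hherm.eigenvalues i : ℂ)) := by
    ext i j
    have := congrFun (hherm.mulVec_eigenvectorBasis j) i
    rw [Matrix.mul_diagonal]
    simpa [Matrix.mulVec, dotProduct, Matrix.mul_apply, mul_comm] using this
  have hcomm : h * g = g * h := by
    have e : (μ • 1 + u) * g = g * (μ • 1 + u) := by
      rw [hg]; simp only [sub_mul, mul_sub, add_mul, mul_add, smul_mul_assoc, mul_smul_comm,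
        one_mul, mul_one, smul_add, smul_sub]; abel
    have e' : g * h = Complex.I • (g * (μ • 1 + u) * gi) := by
      rw [hh, mul_smul_comm, mul_assoc]
    rw [e', ← e, mul_assoc, h1, mul_one, hhg]
  set V : Matrix ι ι ℂ := ((hherm.eigenvectorUnitary : Matrix.unitaryGroup ι ℂ) : Matrix ι ι ℂ)
  set κ := hherm.eigenvalues with hκ
  have key : Complex.I • ((μ • 1 + u) * V) = g * V * diagonal (fun i => (κ i : ℂ)) := by
    rw [← smul_mul_assoc, ← hhg, hcomm, mul_assoc, hsp, mul_assoc]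
  ext i j
  have kij := congrFun (congrFun key i) j
  rw [Matrix.mul_diagonal, hg] at kij
  simp only [Matrix.smul_apply, add_mul, sub_mul, smul_mul_assoc, one_mul, Matrix.add_apply,
    Matrix.sub_apply, smul_eq_mul] at kij
  rw [Matrix.mul_diagonal]
  have hne : (κ j : ℂ) + Complex.I ≠ 0 := by
    intro h0
    have := congrArg Complex.im h0
    simp at this
  field_simp
  linear_combination kij

/-- The roots of the characteristic polynomial of a unitarily diagonalized matrix. -/
theorem roots_charpoly_of_mul_eq_mul_diagonal {u V : Matrix ι ι ℂ} {d : ι → ℂ}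
    (hV : Vᴴ * V = 1) (huV : u * V = V * diagonal d) :
    u.charpoly.roots = Finset.univ.val.map d := by
  have hV' : V * Vᴴ = 1 := mul_eq_one_comm.mp hV
  have hu : u = V * (diagonal d * Vᴴ) := by
    rw [← mul_assoc, ← huV, mul_assoc, hV', mul_one]
  rw [hu, Matrix.charpoly_mul_comm, mul_assoc, hV, mul_one, Matrix.charpoly_diagonal,
    Polynomial.roots_prod _ _ (Finset.prod_ne_zero_iff.mpr fun i _ => Polynomial.X_sub_C_ne_zero _)]
  simp

end LinearAlgebra

/-! ### Perturbation of a doubly degenerate eigenvalue. -/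

section Counting

variable {ι : Type*} [Fintype ι] [DecidableEq ι]

theorem sum_eq_add_add_sum_erase_erase {M : Type*} [AddCommMonoid M] {x y : ι} (hxy : x ≠ y)
    (f : ι → M) :
    ∑ z, f z = f x + (f y + ∑ z ∈ (Finset.univ.erase x).erase y, f z) := by
  rw [Finset.add_sum_erase _ _ (Finset.mem_erase.mpr ⟨hxy.symm, Finset.mem_univ y⟩),
    Finset.add_sum_erase _ _ (Finset.mem_univ x)]

theorem sum_norm_sq_col {V : Matrix ι ι ℂ} (hV : Vᴴ * V = 1) (i : ι) :
    ∑ z, ‖V z i‖ ^ 2 = 1 := by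
  have h := congrFun (congrFun hV i) i
  rw [Matrix.mul_apply, Matrix.one_apply_eq] at h
  have h' : ((∑ z, ‖V z i‖ ^ 2 : ℝ) : ℂ) = 1 := by
    rw [← h]
    push_cast
    refine Finset.sum_congr rfl fun z _ => ?_
    rw [conjTranspose_apply, Complex.star_def, Complex.conj_mul']
  exact_mod_cast h'

theorem sum_norm_sq_row {V : Matrix ι ι ℂ} (hV : Vᴴ * V = 1) (z : ι) :
    ∑ i, ‖V z i‖ ^ 2 = 1 := by
  have h := sum_norm_sq_col (V := Vᴴ) (by rw [conjTranspose_conjTranspose]; exact mul_eq_one_comm.mp hV) z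
  simpa [conjTranspose_apply] using h

/-- A unitary matrix close to a diagonal matrix whose entry `z₀` occurs exactly at `x` and `y` has
exactly two eigenvalues near `z₀`, and the corresponding eigenvectors are transversal in their
`x` and `y` components. -/
theorem exists_eigenpair_of_close {U : Matrix ι ι ℂ} (hU : Uᴴ * U = 1) {w : ι → ℂ} {x y : ι}
    (hxy : x ≠ y) {z₀ : ℂ} (hx : w x = z₀) (hy : w y = z₀) {ρ κ : ℝ} (hρ : 0 < ρ)
    (hw : ∀ z, z ≠ x → z ≠ y → 2 * ρ ≤ ‖w z - z₀‖)
    (hκ : ∀ (v : ι → ℂ), (∀ i, ‖v i‖ ≤ 1) → ∀ z, ‖((U - diagonal w) *ᵥ v) z‖ ≤ κ)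
    (hsmall : (Fintype.card ι : ℝ) ^ 2 * (κ / ρ) ^ 2 ≤ 1 / 8) :
    ∃ (d₁ d₂ : ℂ) (v₁ v₂ : ι → ℂ),
      U.charpoly.roots.filter (fun d => ‖d - z₀‖ < ρ) = {d₁, d₂} ∧
      U *ᵥ v₁ = d₁ • v₁ ∧ U *ᵥ v₂ = d₂ • v₂ ∧ ‖d₁ - z₀‖ < ρ ∧ ‖d₂ - z₀‖ < ρ ∧
      (∀ z, ‖v₁ z‖ ≤ 1) ∧ (∀ z, ‖v₂ z‖ ≤ 1) ∧ 1 / 2 ≤ ‖v₁ x * v₂ y - v₁ y * v₂ x‖ := by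
  classical
  obtain ⟨V, d, hV, hUV⟩ := exists_unitary_mul_eq_mul_diagonal hU
  have hle : ∀ z i, ‖V z i‖ ≤ 1 := by
    intro z i
    have h1 : ‖V z i‖ ^ 2 ≤ 1 := by
      rw [← sum_norm_sq_col hV i]
      exact Finset.single_le_sum (f := fun z => ‖V z i‖ ^ 2) (fun _ _ => by positivity)
        (Finset.mem_univ z)
    exact (sq_le_one_iff₀ (norm_nonneg _)).mp h1
  have heig : ∀ i, U *ᵥ (fun z => V z i) = d i • (fun z => V z i) := by
    intro i
    ext z
    have := congrFun (congrFun hUV z) i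
    rw [Matrix.mul_diagonal, Matrix.mul_apply] at this
    simp only [Matrix.mulVec, dotProduct, this, Pi.smul_apply, smul_eq_mul, mul_comm]
  have hbound : ∀ z i, ‖d i - w z‖ * ‖V z i‖ ≤ κ := by
    intro z i
    have h := hκ (fun z => V z i) (fun z => hle z i) z
    rw [Matrix.sub_mulVec, heig, Pi.sub_apply, Matrix.mulVec_diagonal, Pi.smul_apply, smul_eq_mul,
      ← sub_mul, norm_mul] at h
    exact h
  have hκ0 : 0 ≤ κ := le_trans (norm_nonneg _) (hκ 0 (by simp) x)
  set σ := κ / ρ with hσ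
  have hσ0 : 0 ≤ σ := by positivity
  -- An eigenvector has little weight on a state whose diagonal entry is at distance at least `ρ`
  -- from its eigenvalue.
  have hV_le : ∀ z i, ρ ≤ ‖d i - w z‖ → ‖V z i‖ ^ 2 ≤ σ ^ 2 := by
    intro z i h
    have : ‖V z i‖ ≤ σ := by
      rw [hσ, le_div_iff₀ hρ]
      calc ‖V z i‖ * ρ ≤ ‖V z i‖ * ‖d i - w z‖ := by gcongr
        _ = ‖d i - w z‖ * ‖V z i‖ := mul_comm _ _
        _ ≤ κ := hbound z i
    gcongr
  set n : ℝ := (Fintype.card ι : ℝ) with hn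
  have hn1 : 1 ≤ n := by
    have : 0 < Fintype.card ι := Fintype.card_pos_iff.mpr ⟨x⟩
    rw [hn]; exact_mod_cast this
  have hnσ : n * σ ^ 2 ≤ 1 / 8 := by nlinarith [mul_nonneg (by linarith : 0 ≤ n) (sq_nonneg σ)]
  set I : Finset ι := Finset.univ.filter (fun i => ‖d i - z₀‖ < ρ) with hI
  set R : Finset ι := (Finset.univ.erase x).erase y with hR
  have hcardle : ∀ s : Finset ι, (s.card : ℝ) ≤ n := fun s => by
    rw [hn]; exact_mod_cast Finset.card_le_univ s
  have hin : ∀ i ∈ I, ∑ z ∈ R, ‖V z i‖ ^ 2 ≤ n * σ ^ 2 := by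
    intro i hi
    calc ∑ z ∈ R, ‖V z i‖ ^ 2 ≤ ∑ z ∈ R, σ ^ 2 := by
          refine Finset.sum_le_sum fun z hz => hV_le z i ?_
          have hzy : z ≠ y := (Finset.mem_erase.mp hz).1
          have hzx : z ≠ x := (Finset.mem_erase.mp (Finset.mem_erase.mp hz).2).1
          have h1 := hw z hzx hzy
          have h2 : ‖d i - z₀‖ < ρ := (Finset.mem_filter.mp hi).2
          have h3 : ‖w z - z₀‖ ≤ ‖d i - w z‖ + ‖d i - z₀‖ := by
            rw [norm_sub_rev (d i) (w z)]
            exact norm_sub_le_norm_sub_add_norm_sub _ _ _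
          linarith
      _ = R.card * σ ^ 2 := by rw [Finset.sum_const, nsmul_eq_mul]
      _ ≤ n * σ ^ 2 := by gcongr; exact hcardle R
  have hout : ∀ z, w z = z₀ → |∑ i ∈ I, ‖V z i‖ ^ 2 - 1| ≤ n * σ ^ 2 := by
    intro z hz
    rw [← sum_norm_sq_row hV z, ← Finset.sum_add_sum_compl I]
    rw [sub_add_cancel_left, abs_neg, abs_of_nonneg (Finset.sum_nonneg fun _ _ => by positivity)]
    calc ∑ i ∈ Iᶜ, ‖V z i‖ ^ 2 ≤ ∑ i ∈ Iᶜ, σ ^ 2 := by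
          refine Finset.sum_le_sum fun i hi => hV_le z i ?_
          rw [hz]
          simpa [hI] using hi
      _ = (Iᶜ).card * σ ^ 2 := by rw [Finset.sum_const, nsmul_eq_mul]
      _ ≤ n * σ ^ 2 := by gcongr; exact hcardle _
  -- The number of eigenvalues in the disc is the total weight of the corresponding columns. Rows
  -- `x` and `y` contribute nearly 1 each and the remaining rows at most 1/8, so the integer lies
  -- strictly between 1 and 3.
  have hcard : I.card = 2 := by
    have e1 : (I.card : ℝ) = ∑ i ∈ I, ‖V x i‖ ^ 2 + (∑ i ∈ I, ‖V y i‖ ^ 2 +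
        ∑ i ∈ I, ∑ z ∈ R, ‖V z i‖ ^ 2) := by
      rw [← Finset.sum_add_distrib, ← Finset.sum_add_distrib]
      have : ∀ i ∈ I, ‖V x i‖ ^ 2 + (‖V y i‖ ^ 2 + ∑ z ∈ R, ‖V z i‖ ^ 2) = 1 := fun i _ => by
        rw [hR, ← sum_eq_add_add_sum_erase_erase hxy (fun z => ‖V z i‖ ^ 2), sum_norm_sq_col hV]
      rw [Finset.sum_congr rfl this]
      simp
    have e2 := abs_le.mp (hout x hx)
    have e3 := abs_le.mp (hout y hy)
    have e4 : ∑ i ∈ I, ∑ z ∈ R, ‖V z i‖ ^ 2 ≤ 1 / 8 := by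
      calc ∑ i ∈ I, ∑ z ∈ R, ‖V z i‖ ^ 2 ≤ ∑ i ∈ I, n * σ ^ 2 := Finset.sum_le_sum hin
        _ = I.card * (n * σ ^ 2) := by rw [Finset.sum_const, nsmul_eq_mul]
        _ ≤ n * (n * σ ^ 2) := by gcongr; exact hcardle I
        _ ≤ 1 / 8 := by linarith [hsmall]
    have e5 : 0 ≤ ∑ i ∈ I, ∑ z ∈ R, ‖V z i‖ ^ 2 :=
      Finset.sum_nonneg fun _ _ => Finset.sum_nonneg fun _ _ => by positivity
    have h1 : (1 : ℝ) < I.card := by linarith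
    have h2 : (I.card : ℝ) < 3 := by linarith
    have h1' : 1 < I.card := by exact_mod_cast h1
    have h2' : I.card < 3 := by exact_mod_cast h2
    omega
  obtain ⟨i₁, i₂, hne, hI2⟩ := Finset.card_eq_two.mp hcard
  have hi₁ : i₁ ∈ I := by rw [hI2]; simp
  have hi₂ : i₂ ∈ I := by rw [hI2]; simp
  refine ⟨d i₁, d i₂, fun z => V z i₁, fun z => V z i₂, ?_, heig i₁, heig i₂,
    (Finset.mem_filter.mp hi₁).2, (Finset.mem_filter.mp hi₂).2, fun z => hle z i₁,
    fun z => hle z i₂, ?_⟩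
  · rw [roots_charpoly_of_mul_eq_mul_diagonal hV hUV, Multiset.filter_map]
    have : Multiset.filter ((fun c => ‖c - z₀‖ < ρ) ∘ d) (Finset.univ : Finset ι).val = I.val := by
      rw [hI, Finset.filter_val]; rfl
    rw [this, hI2, Finset.insert_val_of_notMem (by simpa using hne)]
    simp
  · have n1 := sum_norm_sq_col hV i₁
    have n2 := sum_norm_sq_col hV i₂
    rw [sum_eq_add_add_sum_erase_erase hxy] at n1 n2
    have o := congrFun (congrFun hV i₁) i₂
    rw [Matrix.mul_apply, Matrix.one_apply_ne hne, sum_eq_add_add_sum_erase_erase hxy] at o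
    simp only [conjTranspose_apply, Complex.star_def] at o
    have o' : ‖starRingEnd ℂ (V x i₁) * V x i₂ + starRingEnd ℂ (V y i₁) * V y i₂‖ ≤ 1 / 8 := by
      have : starRingEnd ℂ (V x i₁) * V x i₂ + starRingEnd ℂ (V y i₁) * V y i₂ =
          -∑ z ∈ R, starRingEnd ℂ (V z i₁) * V z i₂ := by
        rw [eq_neg_iff_add_eq_zero, ← o, add_assoc]
      rw [this, norm_neg]
      refine (norm_sum_le _ _).trans ?_
      have hterm : ∀ z ∈ R, ‖starRingEnd ℂ (V z i₁) * V z i₂‖ ≤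
          (‖V z i₁‖ ^ 2 + ‖V z i₂‖ ^ 2) / 2 := by
        intro z _
        rw [norm_mul, RCLike.norm_conj]
        nlinarith [sq_nonneg (‖V z i₁‖ - ‖V z i₂‖)]
      refine (Finset.sum_le_sum hterm).trans ?_
      rw [← Finset.sum_div, Finset.sum_add_distrib]
      linarith [hin i₁ hi₁, hin i₂ hi₂]
    have p1 := hin i₁ hi₁
    have p2 := hin i₂ hi₂
    -- Lagrange's identity: the truncations of the two columns to `x, y` are nearly normalized and
    -- nearly orthogonal, so their determinant has squared modulus at least `49/64 - 1/64`, well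
    -- above `1/4`.
    have lag : ‖V x i₁ * V y i₂ - V y i₁ * V x i₂‖ ^ 2 +
        ‖starRingEnd ℂ (V x i₁) * V x i₂ + starRingEnd ℂ (V y i₁) * V y i₂‖ ^ 2 =
        (‖V x i₁‖ ^ 2 + ‖V y i₁‖ ^ 2) * (‖V x i₂‖ ^ 2 + ‖V y i₂‖ ^ 2) := by
      simp only [← Complex.normSq_eq_norm_sq, Complex.normSq_apply, Complex.sub_re, Complex.sub_im,
        Complex.add_re, Complex.add_im, Complex.mul_re, Complex.mul_im, Complex.conj_re,
        Complex.conj_im]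
      ring
    have f1 : 7 / 8 ≤ ‖V x i₁‖ ^ 2 + ‖V y i₁‖ ^ 2 := by linarith
    have f2 : 7 / 8 ≤ ‖V x i₂‖ ^ 2 + ‖V y i₂‖ ^ 2 := by linarith
    have f3 : ‖starRingEnd ℂ (V x i₁) * V x i₂ + starRingEnd ℂ (V y i₁) * V y i₂‖ ^ 2 ≤
        (1 / 8) ^ 2 := by gcongr
    have f4 : (7 / 8 : ℝ) * (7 / 8) ≤
        (‖V x i₁‖ ^ 2 + ‖V y i₁‖ ^ 2) * (‖V x i₂‖ ^ 2 + ‖V y i₂‖ ^ 2) := by gcongr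
    refine le_of_sq_le_sq ?_ (norm_nonneg _)
    linarith

end Counting

/-! ### Eigenvalues of 2×2 matrices. -/

section TwoByTwo

/-- `D` is the determinant: the inverse of the matrix is its adjoint and also its adjugate divided
by `D`. -/
theorem exists_norm_one_of_unitary {α β γ ζ : ℂ} (h1 : ‖α‖ ^ 2 + ‖γ‖ ^ 2 = 1)
    (h2 : ‖β‖ ^ 2 + ‖ζ‖ ^ 2 = 1) (h3 : starRingEnd ℂ α * β + starRingEnd ℂ γ * ζ = 0) :
    ∃ D : ℂ, ‖D‖ = 1 ∧ ζ = starRingEnd ℂ α * D ∧ γ = -(starRingEnd ℂ β * D) := by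
  have g1 : starRingEnd ℂ α * α + starRingEnd ℂ γ * γ = 1 := by
    rw [Complex.conj_mul', Complex.conj_mul']; exact_mod_cast h1
  have g2 : starRingEnd ℂ β * β + starRingEnd ℂ ζ * ζ = 1 := by
    rw [Complex.conj_mul', Complex.conj_mul']; exact_mod_cast h2
  have g3 : α * starRingEnd ℂ β + γ * starRingEnd ℂ ζ = 0 := by
    simpa using congrArg (starRingEnd ℂ) h3
  refine ⟨α * ζ - β * γ, ?_, by linear_combination (-ζ) * g1 + γ * h3,
    by linear_combination (-γ) * g2 + ζ * g3⟩
  have lag : ‖α * ζ - β * γ‖ ^ 2 + ‖starRingEnd ℂ α * β + starRingEnd ℂ γ * ζ‖ ^ 2 =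
      (‖α‖ ^ 2 + ‖γ‖ ^ 2) * (‖β‖ ^ 2 + ‖ζ‖ ^ 2) := by
    simp only [← Complex.normSq_eq_norm_sq, Complex.normSq_apply, Complex.sub_re, Complex.sub_im,
      Complex.add_re, Complex.add_im, Complex.mul_re, Complex.mul_im, Complex.conj_re,
      Complex.conj_im]
    ring
  rw [h1, h2, h3, norm_zero] at lag
  nlinarith [norm_nonneg (α * ζ - β * γ)]

/-- The discriminant of the characteristic polynomial of a unitary 2×2 matrix. -/
theorem norm_discrim_of_unitary {α β γ ζ : ℂ} (h1 : ‖α‖ ^ 2 + ‖γ‖ ^ 2 = 1)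
    (h2 : ‖β‖ ^ 2 + ‖ζ‖ ^ 2 = 1) (h3 : starRingEnd ℂ α * β + starRingEnd ℂ γ * ζ = 0) :
    ‖(α - ζ) ^ 2 + 4 * β * γ‖ = ‖α - ζ‖ ^ 2 + 4 * ‖β‖ ^ 2 := by
  obtain ⟨D, hDn, hζ, hγ⟩ := exists_norm_one_of_unitary h1 h2 h3
  have hDD : starRingEnd ℂ D * D = 1 := by rw [Complex.conj_mul', hDn]; simp
  -- Multiplication by the conjugate of the determinant rotates the discriminant onto the negative
  -- real axis, where its modulus can be read off.
  have key : starRingEnd ℂ D * ((α - ζ) ^ 2 + 4 * β * γ) =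
      -(((‖α - ζ‖ ^ 2 + 4 * ‖β‖ ^ 2 : ℝ)) : ℂ) := by
    push_cast
    rw [← Complex.conj_mul', ← Complex.conj_mul', map_sub, hζ, hγ, map_mul, Complex.conj_conj]
    linear_combination (-2 * α * starRingEnd ℂ α - 4 * β * starRingEnd ℂ β
      + D * starRingEnd ℂ α ^ 2 + α * starRingEnd ℂ α) * hDD
  have := congrArg norm key
  rw [norm_mul, RCLike.norm_conj, hDn, one_mul, norm_neg, Complex.norm_real, Real.norm_eq_abs,
    abs_of_nonneg (by positivity)] at this
  exact this

/-- Comparison of the eigenvalue gap of a unitary 2×2 matrix with an approximate eigenvalue pair. -/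
theorem abs_sqrt_discrim_sub_norm_le {α β γ ζ : ℂ} (h1 : ‖α‖ ^ 2 + ‖γ‖ ^ 2 = 1)
    (h2 : ‖β‖ ^ 2 + ‖ζ‖ ^ 2 = 1) (h3 : starRingEnd ℂ α * β + starRingEnd ℂ γ * ζ = 0)
    {l₁ l₂ p₁ p₂ r₁ r₂ e₁ e₂ : ℂ} {κ : ℝ}
    (ha : α * p₁ + β * p₂ = l₁ * p₁) (hb : γ * p₁ + ζ * p₂ = l₁ * p₂)
    (hc : α * r₁ + β * r₂ = l₂ * r₁ + e₁) (hd : γ * r₁ + ζ * r₂ = l₂ * r₂ + e₂)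
    (hp₁ : ‖p₁‖ ≤ 1) (hp₂ : ‖p₂‖ ≤ 1) (hw : 1 / 2 ≤ ‖p₁ * r₂ - p₂ * r₁‖)
    (he₁ : ‖e₁‖ ≤ κ) (he₂ : ‖e₂‖ ≤ κ) :
    |√(‖α - ζ‖ ^ 2 + 4 * ‖β‖ ^ 2) - ‖l₁ - l₂‖| ≤ 4 * κ := by
  have hne : p₁ ≠ 0 ∨ p₂ ≠ 0 := by
    by_contra! h
    rw [h.1, h.2] at hw
    norm_num at hw
  have hchar : l₁ ^ 2 - (α + ζ) * l₁ + (α * ζ - β * γ) = 0 := by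
    rcases hne with h | h
    · refine mul_right_cancel₀ h ?_
      linear_combination (ζ - l₁) * ha - β * hb
    · refine mul_right_cancel₀ h ?_
      linear_combination (α - l₁) * hb - γ * ha
  -- The second exact eigenvalue is `α + ζ - l₁`. Wedging the approximate equation for `(r₁, r₂)`
  -- with the exact eigenvector `(p₁, p₂)` leaves only the error terms; dividing by a wedge of size
  -- at least `1/2` gives the factor 4.
  have hwedge : (l₂ - (α + ζ - l₁)) * (p₁ * r₂ - p₂ * r₁) = -(p₁ * e₂ - p₂ * e₁) := by
    linear_combination (-r₂) * ha + r₁ * hb - p₁ * hd + p₂ * hc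
  have hX : √(‖α - ζ‖ ^ 2 + 4 * ‖β‖ ^ 2) = ‖l₁ - (α + ζ - l₁)‖ := by
    rw [← norm_discrim_of_unitary h1 h2 h3]
    have : (α - ζ) ^ 2 + 4 * β * γ = (l₁ - (α + ζ - l₁)) ^ 2 := by
      linear_combination (-4) * hchar
    rw [this, norm_pow, Real.sqrt_sq (norm_nonneg _)]
  have hle : ‖l₂ - (α + ζ - l₁)‖ ≤ 4 * κ := by
    have e := congrArg norm hwedge
    rw [norm_mul, norm_neg] at e
    have e2 : ‖p₁ * e₂ - p₂ * e₁‖ ≤ 2 * κ := by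
      refine (norm_sub_le _ _).trans ?_
      rw [norm_mul, norm_mul]
      have : ‖p₁‖ * ‖e₂‖ ≤ 1 * κ := by gcongr
      have : ‖p₂‖ * ‖e₁‖ ≤ 1 * κ := by gcongr
      linarith
    nlinarith [norm_nonneg (l₂ - (α + ζ - l₁))]
  rw [hX]
  refine (abs_norm_sub_norm_le _ _).trans ?_
  rw [show l₁ - (α + ζ - l₁) - (l₁ - l₂) = l₂ - (α + ζ - l₁) by ring]
  exact hle

/-- An approximate eigenvalue equation in dimension two bounds the eigenvalue. -/
theorem norm_le_of_two_by_two {d p₁ p₂ α β γ ζ : ℂ} {κ : ℝ} (hp : p₁ ≠ 0 ∨ p₂ ≠ 0)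
    (h₁ : d * p₁ = α * p₁ + β * p₂) (h₂ : d * p₂ = γ * p₁ + ζ * p₂)
    (hα : ‖α‖ ≤ κ) (hβ : ‖β‖ ≤ κ) (hγ : ‖γ‖ ≤ κ) (hζ : ‖ζ‖ ≤ κ) : ‖d‖ ≤ 2 * κ := by
  have hκ : 0 ≤ κ := (norm_nonneg _).trans hα
  -- The equation is used in the row of the larger component, so that the ratio of the components is
  -- at most 1.
  have aux : ∀ {p q a c : ℂ}, p ≠ 0 → ‖q‖ ≤ ‖p‖ → d * p = a * p + c * q → ‖a‖ ≤ κ → ‖c‖ ≤ κ →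
      ‖d‖ ≤ 2 * κ := by
    intro p q a c hp hq h ha hc
    have h' := congrArg norm h
    rw [norm_mul] at h'
    have h'' := norm_add_le (a * p) (c * q)
    rw [norm_mul, norm_mul] at h''
    have t1 : ‖a‖ * ‖p‖ ≤ κ * ‖p‖ := by gcongr
    have t2 : ‖c‖ * ‖q‖ ≤ κ * ‖p‖ := by gcongr
    exact le_of_mul_le_mul_right (by linarith : ‖d‖ * ‖p‖ ≤ 2 * κ * ‖p‖) (norm_pos_iff.mpr hp)
  rcases le_total ‖p₂‖ ‖p₁‖ with h | h
  · have : p₁ ≠ 0 := by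
      rintro rfl
      simp only [norm_zero, norm_le_zero_iff] at h
      tauto
    exact aux this h h₁ hα hβ
  · have : p₂ ≠ 0 := by
      rintro rfl
      simp only [norm_zero, norm_le_zero_iff] at h
      tauto
    exact aux this h (h₂.trans (add_comm _ _)) hζ hγ

end TwoByTwo

/-! ### The Feshbach reduction to the states `x` and `y`. -/

section Feshbach

variable {ι : Type*} [DecidableEq ι]

/-- The diagonal projection onto the basis states other than `x` and `y`. -/
def coProj (x y : ι) : Matrix ι ι ℂ := diagonal fun z => if z = x ∨ z = y then 0 else 1

theorem coProj_conjTranspose (x y : ι) : (coProj x y)ᴴ = coProj x y := by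
  rw [coProj, diagonal_conjTranspose]
  congr 1; ext z; simp only [Pi.star_apply]; split_ifs <;> simp

theorem one_sub_coProj (x y : ι) :
    1 - coProj x y = diagonal fun z => if z = x ∨ z = y then (1 : ℂ) else 0 := by
  rw [coProj, ← diagonal_one, diagonal_sub]
  congr 1; ext z; split_ifs <;> simp

variable [Fintype ι]

/-- The matrix `l - q U q` whose inverse is the reduced resolvent. -/
def reducedDenom (q U : Matrix ι ι ℂ) (l : ℂ) : Matrix ι ι ℂ := l • 1 - q * U * q

/-- The Feshbach matrix `U + U (l - q U q)⁻¹ q U`; its compression by `1 - q` is the effective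
operator at the spectral parameter `l`. -/
noncomputable def feshbach (q U : Matrix ι ι ℂ) (l : ℂ) : Matrix ι ι ℂ :=
  U + U * Ring.inverse (reducedDenom q U l) * q * U

theorem coProj_mul_self (x y : ι) : coProj x y * coProj x y = coProj x y := by
  rw [coProj, diagonal_mul_diagonal]
  congr 1; ext z; split_ifs <;> simp

theorem coProj_mulVec_apply (x y : ι) (v : ι → ℂ) (z : ι) :
    (coProj x y *ᵥ v) z = if z = x ∨ z = y then 0 else v z := by
  rw [coProj, mulVec_diagonal]; split_ifs <;> simp

variable {q U : Matrix ι ι ℂ} {l : ℂ}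

theorem commute_reducedDenom (hq : q * q = q) : Commute q (reducedDenom q U l) := by
  rw [Commute, SemiconjBy, reducedDenom, mul_sub, sub_mul, mul_smul_comm, smul_mul_assoc, mul_one,
    one_mul, mul_assoc, mul_assoc, mul_assoc, hq, ← mul_assoc q q, hq, ← mul_assoc]

theorem mul_inverse_reducedDenom (hq : q * q = q) (hN : IsUnit (reducedDenom q U l)) :
    q * Ring.inverse (reducedDenom q U l) = Ring.inverse (reducedDenom q U l) * q := by
  calc q * Ring.inverse (reducedDenom q U l)
      = Ring.inverse (reducedDenom q U l) * (reducedDenom q U l * q) *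
          Ring.inverse (reducedDenom q U l) := by
        rw [← mul_assoc, Ring.inverse_mul_cancel _ hN, one_mul]
    _ = _ := by
        rw [← (commute_reducedDenom hq).eq, mul_assoc, mul_assoc, Ring.mul_inverse_cancel _ hN,
          mul_one]

/-- The component of an eigenvector in the range of `1 - q` is an eigenvector of the effective
operator. -/
theorem feshbach_mulVec_of_eigenvector (hq : q * q = q) (hN : IsUnit (reducedDenom q U l))
    {v : ι → ℂ} (hv : U *ᵥ v = l • v) : feshbach q U l *ᵥ ((1 - q) *ᵥ v) = l • v := by
  -- The `q`-part of the eigenvalue equation, solved for `q v`; inserting it into the definition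
  -- turns the Feshbach matrix on `(1 - q) v` into `U v`.
  have h1 : (q * U) *ᵥ ((1 - q) *ᵥ v) = reducedDenom q U l *ᵥ (q *ᵥ v) := by
    rw [reducedDenom, mulVec_mulVec, mul_sub, mul_one, sub_mulVec, ← mulVec_mulVec, hv,
      mulVec_smul, sub_mulVec, smul_mulVec, one_mulVec, mulVec_mulVec, mul_assoc _ q q, hq]
  have h2 : Ring.inverse (reducedDenom q U l) *ᵥ ((q * U) *ᵥ ((1 - q) *ᵥ v)) = q *ᵥ v := by
    rw [h1, mulVec_mulVec, Ring.inverse_mul_cancel _ hN, one_mulVec]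
  rw [feshbach, add_mulVec, mul_assoc, mul_assoc, ← mulVec_mulVec _ U (Ring.inverse _ * (q * U)),
    ← mulVec_mulVec _ (Ring.inverse _), h2, ← mulVec_add, sub_mulVec, one_mulVec, sub_add_cancel,
    hv]

/-- The lift `1 + (l - q U q)⁻¹ q U` solves the eigenvalue equation on the range of `q`. -/
theorem mul_feshbach (hq : q * q = q) (hN : IsUnit (reducedDenom q U l)) :
    q * feshbach q U l = l • (Ring.inverse (reducedDenom q U l) * q * U) := by
  have hc := mul_inverse_reducedDenom hq hN
  have h := Ring.mul_inverse_cancel _ hN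
  generalize hR : Ring.inverse (reducedDenom q U l) = R at h hc
  rw [reducedDenom, sub_mul, smul_mul_assoc, one_mul, sub_eq_iff_eq_add] at h
  have h1 : q * U * R * q = l • (R * q) - q := by
    rw [← smul_mul_assoc, h, add_mul, one_mul, add_sub_cancel_left]
    simp only [mul_assoc]
    rw [← hc, ← mul_assoc q q, hq]
  have h2 : q * feshbach q U l = q * U + (q * U * R * q) * U := by
    rw [feshbach, mul_add, hR]; simp only [mul_assoc]
  rw [h2, h1, sub_mul, smul_mul_assoc]
  abel

/-- For a unitary matrix and a spectral parameter on the unit circle the effective operator is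
unitary. -/
theorem feshbach_unitary (hq : q * q = q) (hqH : qᴴ = q) (hU : Uᴴ * U = 1) (hl : ‖l‖ = 1)
    (hN : IsUnit (reducedDenom q U l)) :
    ((1 - q) * feshbach q U l * (1 - q))ᴴ * ((1 - q) * feshbach q U l * (1 - q)) = 1 - q := by
  set N := reducedDenom q U l with hNdef
  set p : Matrix ι ι ℂ := 1 - q with hp
  have hpp : p * p = p := by rw [hp]; simp [mul_sub, sub_mul, hq]
  have hpH : pᴴ = p := by rw [hp]; simp [hqH]
  have hpq : p * q = 0 := by rw [hp]; simp [sub_mul, hq]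
  have hqp : q * p = 0 := by rw [hp]; simp [mul_sub, hq]
  set F := feshbach q U l with hF
  set T := Ring.inverse N * q * U * p with hT
  have hc : q * Ring.inverse N = Ring.inverse N * q := mul_inverse_reducedDenom hq hN
  have hqT : q * T = T := by
    rw [hT]; simp only [← mul_assoc]
    rw [hc, mul_assoc _ q q, hq]
  have hpT : p * T = 0 := by rw [← hqT, ← mul_assoc, hpq, zero_mul]
  have hFp : F * p = U * (p + T) := by
    rw [hF, feshbach, hT]; simp only [mul_add, add_mul, mul_assoc, ← hNdef]
  have hqF : q * (F * p) = l • T := by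
    rw [← mul_assoc, mul_feshbach hq hN, smul_mul_assoc]
  have hdec : F * p = p * F * p + l • T := by
    rw [← hqF, mul_assoc, ← add_mul, hp, sub_add_cancel, one_mul]
  -- The Gram matrix of `F * p` is computed twice: from `F * p = U (p + T)` with `U` isometric, and
  -- from the orthogonal splitting `F * p = p F p + l T`. As `|l| = 1`, the terms `Tᴴ * T` cancel.
  have e1 : (F * p)ᴴ * (F * p) = p + Tᴴ * T := by
    rw [hFp, conjTranspose_mul, mul_assoc, ← mul_assoc Uᴴ, hU, one_mul, conjTranspose_add, hpH,
      add_mul, mul_add, mul_add, hpp, hpT]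
    have : Tᴴ * p = 0 := by
      have := congrArg conjTranspose hpT
      rwa [conjTranspose_mul, hpH, conjTranspose_zero] at this
    rw [this]; simp
  have e2 : (F * p)ᴴ * (F * p) = (p * F * p)ᴴ * (p * F * p) + Tᴴ * T := by
    rw [hdec]
    have c1 : (p * F * p)ᴴ * T = 0 := by
      simp only [conjTranspose_mul, hpH, mul_assoc, hpT, mul_zero]
    have c2 : Tᴴ * (p * F * p) = 0 := by
      have := congrArg conjTranspose c1
      rwa [conjTranspose_mul, conjTranspose_conjTranspose, conjTranspose_zero] at this
    have hl' : star l * l = 1 := by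
      rw [Complex.star_def, Complex.conj_mul', hl]; simp
    rw [conjTranspose_add, conjTranspose_smul, add_mul, mul_add, mul_add, mul_smul_comm, c1,
      smul_mul_assoc, c2, smul_mul_assoc, mul_smul_comm, smul_smul, hl']
    simp
  have := e1.symm.trans e2
  exact (add_right_cancel this).symm

/-- The Feshbach matrices of similar matrices are similar (without invertibility of the
intertwining matrix). -/
theorem mul_feshbach_of_intertwine {T U' : Matrix ι ι ℂ} (hT : T * U = U' * T)
    (hTq : T * q = q * T) (hN : IsUnit (reducedDenom q U l))
    (hN' : IsUnit (reducedDenom q U' l)) : T * feshbach q U l = feshbach q U' l * T := by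
  have h1 : T * reducedDenom q U l = reducedDenom q U' l * T := by
    simp only [reducedDenom, mul_sub, sub_mul, mul_smul_comm, smul_mul_assoc, mul_one, one_mul]
    congr 1
    rw [← mul_assoc, ← mul_assoc, hTq, mul_assoc q T, hT, mul_assoc, mul_assoc U' T, hTq]
    simp only [mul_assoc]
  have h2 : T * Ring.inverse (reducedDenom q U l) = Ring.inverse (reducedDenom q U' l) * T := by
    calc T * Ring.inverse (reducedDenom q U l)
        = Ring.inverse (reducedDenom q U' l) * (reducedDenom q U' l * T) *
            Ring.inverse (reducedDenom q U l) := by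
          rw [← mul_assoc, Ring.inverse_mul_cancel _ hN', one_mul]
      _ = _ := by rw [← h1, mul_assoc, mul_assoc, Ring.mul_inverse_cancel _ hN, mul_one]
  rw [feshbach, feshbach, mul_add, add_mul, hT]
  congr 1
  simp only [← mul_assoc]
  rw [hT, mul_assoc U' T, h2]
  simp only [mul_assoc]
  rw [← mul_assoc T q, hTq, mul_assoc q T, hT]

/-- The dependence of the Feshbach matrix on the spectral parameter. -/
theorem feshbach_sub_feshbach {l' : ℂ} (hN : IsUnit (reducedDenom q U l))
    (hN' : IsUnit (reducedDenom q U l')) :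
    feshbach q U l - feshbach q U l' = (l' - l) • (U * (Ring.inverse (reducedDenom q U l) *
      Ring.inverse (reducedDenom q U l')) * q * U) := by
  -- The resolvent identity.
  have h : Ring.inverse (reducedDenom q U l) - Ring.inverse (reducedDenom q U l') =
      (l' - l) • (Ring.inverse (reducedDenom q U l) * Ring.inverse (reducedDenom q U l')) := by
    have e : reducedDenom q U l' - reducedDenom q U l = (l' - l) • 1 := by
      simp only [reducedDenom, sub_smul]; abel
    calc Ring.inverse (reducedDenom q U l) - Ring.inverse (reducedDenom q U l')
        = Ring.inverse (reducedDenom q U l) * (reducedDenom q U l' - reducedDenom q U l) *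
          Ring.inverse (reducedDenom q U l') := by
          rw [mul_sub, sub_mul, Ring.inverse_mul_cancel _ hN, one_mul, mul_assoc,
            Ring.mul_inverse_cancel _ hN', mul_one]
      _ = _ := by rw [e, mul_smul_comm, mul_one, smul_mul_assoc]
  rw [feshbach, feshbach, add_sub_add_left_eq_sub, ← smul_mul_assoc, ← smul_mul_assoc,
    ← mul_smul_comm, ← h]
  simp only [mul_sub, sub_mul]

variable {x y : ι}

theorem mulVec_one_sub_coProj_mulVec (hxy : x ≠ y) (A : Matrix ι ι ℂ) (v : ι → ℂ) (z : ι) :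
    (A *ᵥ ((1 - coProj x y) *ᵥ v)) z = A z x * v x + A z y * v y := by
  rw [one_sub_coProj, mulVec, dotProduct, sum_eq_add_add_sum_erase_erase hxy, Finset.sum_eq_zero]
  · simp [mulVec_diagonal]
  · intro w hw
    simp only [Finset.mem_erase] at hw
    simp [mulVec_diagonal, hw.1, hw.2.1]

theorem one_sub_coProj_mul_mul_apply (A : Matrix ι ι ℂ) {a c : ι} (ha : a = x ∨ a = y)
    (hc : c = x ∨ c = y) : ((1 - coProj x y) * A * (1 - coProj x y)) a c = A a c := by
  rw [one_sub_coProj, mul_diagonal, diagonal_mul, if_pos ha, if_pos hc]; simp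

/-- The Gram relations between the columns of the effective 2×2 matrix. -/
theorem feshbach_gram (hxy : x ≠ y) (hU : Uᴴ * U = 1) (hl : ‖l‖ = 1)
    (hN : IsUnit (reducedDenom (coProj x y) U l)) {a c : ι} (ha : a = x ∨ a = y)
    (hc : c = x ∨ c = y) :
    starRingEnd ℂ (feshbach (coProj x y) U l x a) * feshbach (coProj x y) U l x c +
      starRingEnd ℂ (feshbach (coProj x y) U l y a) * feshbach (coProj x y) U l y c =
      (1 : Matrix ι ι ℂ) a c := by
  have h := congrFun (congrFun (feshbach_unitary (coProj_mul_self x y) (coProj_conjTranspose x y)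
    hU hl hN) a) c
  rw [Matrix.mul_apply, sum_eq_add_add_sum_erase_erase hxy, Finset.sum_eq_zero] at h
  · simp only [conjTranspose_apply, Complex.star_def] at h
    rw [one_sub_coProj_mul_mul_apply _ (Or.inl rfl) ha, one_sub_coProj_mul_mul_apply _ (Or.inl rfl) hc,
      one_sub_coProj_mul_mul_apply _ (Or.inr rfl) ha, one_sub_coProj_mul_mul_apply _ (Or.inr rfl) hc,
      add_zero] at h
    rw [h, one_sub_coProj, diagonal_apply, Matrix.one_apply, if_pos ha]
  · intro w hw
    simp only [Finset.mem_erase] at hw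
    have : ((1 - coProj x y) * feshbach (coProj x y) U l * (1 - coProj x y)) w c = 0 := by
      rw [one_sub_coProj, mul_diagonal, diagonal_mul, if_neg (by tauto)]; simp
    rw [this, mul_zero]

theorem feshbach_norm_sq_add (hxy : x ≠ y) (hU : Uᴴ * U = 1) (hl : ‖l‖ = 1)
    (hN : IsUnit (reducedDenom (coProj x y) U l)) {a : ι} (ha : a = x ∨ a = y) :
    ‖feshbach (coProj x y) U l x a‖ ^ 2 + ‖feshbach (coProj x y) U l y a‖ ^ 2 = 1 := by
  have h := feshbach_gram hxy hU hl hN ha ha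
  rw [Complex.conj_mul', Complex.conj_mul', Matrix.one_apply_eq] at h
  exact_mod_cast h

end Feshbach

/-! ### The recursion for the path polynomials. -/

section PathPolynomials

/-- The lengths produced by the recursion agree only propositionally, so arguments of `Q` are
compared through a cast. -/
theorem Q_congr {n n' : ℕ} (h : n = n') {b : Fin n → ℝ} {b' : Fin n' → ℝ}
    (hb : ∀ j : Fin n, b j = b' (Fin.cast h j)) : Q n b = Q n' b' := by
  subst h
  congr 1
  funext j
  exact hb j

/-- The polynomial `Q` with `p` extra steps in its first segment. -/
noncomputable def Qshift (p n : ℕ) (b : Fin n → ℝ) : ℂ :=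
  1 / (Nat.factorial (n + 1 + p) : ℂ) -
    ∑ m : Fin n, (1 + Complex.I * (b m : ℂ)) / (2 * (Nat.factorial (m.val + 1 + p) : ℂ)) *
      Q (n - (m.val + 1)) (fun j => b ⟨m.val + 1 + j.val, by omega⟩)

theorem Qshift_zero (n : ℕ) (b : Fin n → ℝ) : Qshift 0 n b = Q n b := by
  rw [Q, Qshift]

/-- The first interior vertex either prolongs the current exponential segment, raising `p` by one,
or closes it with its resonance factor and a new segment starts. In this form the recursion matches
a first-step decomposition of walks. -/
theorem Qshift_succ (p n : ℕ) (b : Fin (n + 1) → ℝ) :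
    Qshift p (n + 1) b = Qshift (p + 1) n (fun j => b j.succ) -
      (1 + Complex.I * (b 0 : ℂ)) / (2 * (Nat.factorial (p + 1) : ℂ)) *
        Qshift 0 n (fun j => b j.succ) := by
  rw [Qshift_zero, Qshift, Qshift, Fin.sum_univ_succ, show n + 1 + 1 + p = n + 1 + (p + 1) by ring]
  have h0 : Q (n + 1 - ((0 : Fin (n + 1)).val + 1))
      (fun j => b ⟨(0 : Fin (n + 1)).val + 1 + j.val, by have := j.2; simp at this ⊢; omega⟩) =
      Q n (fun j => b j.succ) :=
    Q_congr (by simp) fun j => congrArg b (Fin.ext (by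
      change 0 + 1 + j.val = j.val + 1; omega))
  have hs : ∀ m : Fin n, Q (n + 1 - (m.succ.val + 1))
      (fun j => b ⟨m.succ.val + 1 + j.val, by have := j.2; simp at this ⊢; omega⟩) =
      Q (n - (m.val + 1)) (fun j => b (Fin.succ ⟨m.val + 1 + j.val, by omega⟩)) := fun m =>
    Q_congr (by simp) fun j => congrArg b (Fin.ext (by
      change m.val + 1 + 1 + j.val = m.val + 1 + j.val + 1; omega))
  rw [h0]
  simp_rw [hs]
  have e1 : (((0 : Fin (n + 1)).val + 1 + p).factorial : ℂ) = ((p + 1).factorial : ℂ) := by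
    rw [show (0 : Fin (n + 1)).val + 1 + p = p + 1 by simp; omega]
  have e2 : ∀ m : Fin n, ((m.succ.val + 1 + p).factorial : ℂ) = ((m.val + 1 + (p + 1)).factorial : ℂ) :=
    fun m => by rw [show m.succ.val + 1 + p = m.val + 1 + (p + 1) by simp; omega]
  simp_rw [e1, e2]
  ring

end PathPolynomials

/-! ### Walk sums and the exponential of a graded nilpotent matrix. -/

section Walks

variable {ι : Type*} [Fintype ι] [DecidableEq ι]

/-- The sum of `f`, weighted by the products of the entries of `K`, over the walks of length `n`
from `z` to `y`. -/
def walkSum (K : Matrix ι ι ℂ) (n : ℕ) (z y : ι) (f : (Fin (n + 1) → ι) → ℂ) : ℂ :=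
  ∑ s : Fin (n + 1) → ι, if s 0 = z ∧ s (Fin.last n) = y then
    (∏ j : Fin n, K (s j.castSucc) (s j.succ)) * f s else 0

theorem walkSum_congr {K : Matrix ι ι ℂ} {n : ℕ} {z y : ι} {f g : (Fin (n + 1) → ι) → ℂ}
    (h : ∀ s, s 0 = z → f s = g s) : walkSum K n z y f = walkSum K n z y g := by
  refine Finset.sum_congr rfl fun s _ => ?_
  split_ifs with hs
  · rw [h s hs.1]
  · rfl

theorem walkSum_sub_const_mul (K : Matrix ι ι ℂ) (n : ℕ) (z y : ι) (c : ℂ)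
    (f g : (Fin (n + 1) → ι) → ℂ) :
    walkSum K n z y (fun s => f s - c * g s) = walkSum K n z y f - c * walkSum K n z y g := by
  rw [walkSum, walkSum, walkSum, Finset.mul_sum, ← Finset.sum_sub_distrib]
  refine Finset.sum_congr rfl fun s _ => ?_
  split_ifs <;> ring

theorem walkSum_zero (K : Matrix ι ι ℂ) (z y : ι) (f : (Fin 1 → ι) → ℂ) :
    walkSum K 0 z y f = if z = y then f (fun _ => z) else 0 := by
  rw [walkSum, Finset.sum_eq_single (fun _ => z)]
  · simp
  · intro s _ hs
    rw [if_neg]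
    rintro ⟨h, -⟩
    exact hs (funext fun i => by rw [Subsingleton.elim (α := Fin 1) i 0, h])
  · simp

theorem walkSum_succ (K : Matrix ι ι ℂ) (n : ℕ) (z y : ι) (f : (Fin (n + 2) → ι) → ℂ) :
    walkSum K (n + 1) z y f =
      ∑ z', K z z' * walkSum K n z' y (fun s => f (Fin.cons z s)) := by
  have h1 : walkSum K (n + 1) z y f = ∑ s : Fin (n + 1) → ι,
      if s (Fin.last n) = y then K z (s 0) * ((∏ j : Fin n, K (s j.castSucc) (s j.succ)) *
        f (Fin.cons z s)) else 0 := by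
    rw [walkSum, ← (Fin.consEquiv (fun _ : Fin (n + 2) => ι)).sum_comp, Fintype.sum_prod_type,
      Finset.sum_eq_single z]
    · refine Finset.sum_congr rfl fun s _ => ?_
      have hl : (Fin.consEquiv (fun _ : Fin (n + 2) => ι)) (z, s) (Fin.last (n + 1)) =
          s (Fin.last n) := by
        rw [← Fin.succ_last]; rfl
      have h0 : (Fin.consEquiv (fun _ : Fin (n + 2) => ι)) (z, s) 0 = z := rfl
      rw [hl, h0, Fin.prod_univ_succ]
      simp only [true_and]
      split_ifs
      · rw [mul_assoc]; rfl
      · rfl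
    · intro w _ hw
      refine Finset.sum_eq_zero fun s _ => ?_
      rw [if_neg]
      rintro ⟨h, -⟩
      exact hw h
    · simp
  rw [h1]
  simp_rw [walkSum, Finset.mul_sum]
  rw [Finset.sum_comm]
  refine Finset.sum_congr rfl fun s _ => ?_
  rw [Finset.sum_eq_single (s 0)]
  · by_cases h : s (Fin.last n) = y <;> simp [h]
  · intro w _ hw
    rw [if_neg (fun h => hw h.1.symm), mul_zero]
  · simp

/-- The tail of the exponential series of `-i K`, with `p` extra steps, applied to a vector. -/
noncomputable def expTail (K : Matrix ι ι ℂ) (M p : ℕ) (Φ : ι → ℂ) : ι → ℂ :=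
  ∑ m ∈ Finset.range M,
    ((-Complex.I) ^ (m + 1) / (Nat.factorial (m + 1 + p) : ℂ)) • (K ^ (m + 1) *ᵥ Φ)

/-- Peels off the leftmost factor `K`. Here `p` counts the steps already taken in the segment, and
nilpotency removes the boundary term when the index is shifted. -/
theorem expTail_eq {K : Matrix ι ι ℂ} {M : ℕ} (hK : K ^ (M + 1) = 0) (p : ℕ) (Φ : ι → ℂ) (z : ι) :
    expTail K M p Φ z = -Complex.I *
      ∑ z', K z z' * (Φ z' / (Nat.factorial (p + 1) : ℂ) + expTail K M (p + 1) Φ z') := by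
  have h : expTail K M p Φ = (-Complex.I) • (K *ᵥ ((1 / (Nat.factorial (p + 1) : ℂ)) • Φ +
      expTail K M (p + 1) Φ)) := by
    rw [mulVec_add, mulVec_smul, expTail, expTail, Matrix.mulVec_sum, smul_add, Finset.smul_sum]
    have e : ∀ m ∈ Finset.range M, (-Complex.I) • (K *ᵥ
        (((-Complex.I) ^ (m + 1) / (Nat.factorial (m + 1 + (p + 1)) : ℂ)) • (K ^ (m + 1) *ᵥ Φ))) =
        ((-Complex.I) ^ (m + 1 + 1) / (Nat.factorial (m + 1 + 1 + p) : ℂ)) •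
          (K ^ (m + 1 + 1) *ᵥ Φ) := by
      intro m _
      rw [mulVec_smul, mulVec_mulVec, ← pow_succ', smul_smul,
        show m + 1 + (p + 1) = m + 1 + 1 + p by ring]
      congr 1; ring
    rw [Finset.sum_congr rfl e]
    have f := Finset.sum_range_succ' (fun m => ((-Complex.I) ^ (m + 1) /
      (Nat.factorial (m + 1 + p) : ℂ)) • (K ^ (m + 1) *ᵥ Φ)) M
    rw [Finset.sum_range_succ, hK, zero_mulVec, smul_zero, add_zero] at f
    rw [f, add_comm, smul_smul]
    congr 2
    · rw [show 0 + 1 + p = p + 1 by ring]; ring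
    · rw [zero_add, pow_one]
  rw [h]
  simp only [Pi.smul_apply, smul_eq_mul, mulVec, dotProduct, Pi.add_apply]
  congr 1
  refine Finset.sum_congr rfl fun z' _ => ?_
  ring

theorem exp_neg_I_smul_mulVec {K : Matrix ι ι ℂ} {M : ℕ} (hK : K ^ (M + 1) = 0) (Φ : ι → ℂ) :
    NormedSpace.exp ((-Complex.I) • K) *ᵥ Φ = Φ + expTail K M 0 Φ := by
  have h : NormedSpace.exp ((-Complex.I) • K) = ∑ m ∈ Finset.range (M + 1),
      ((Nat.factorial m : ℂ)⁻¹) • ((-Complex.I) • K) ^ m := by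
    rw [NormedSpace.exp_eq_tsum ℂ]
    refine tsum_eq_sum fun m hm => ?_
    rw [Finset.mem_range, not_lt] at hm
    rw [smul_pow, ← Nat.sub_add_cancel hm, pow_add K, hK, mul_zero, smul_zero, smul_zero]
  rw [h, Finset.sum_range_succ', add_mulVec, Matrix.sum_mulVec, expTail, add_comm]
  congr 1
  · simp
  · refine Finset.sum_congr rfl fun m _ => ?_
    rw [smul_pow, smul_smul, smul_mulVec, add_zero, div_eq_inv_mul]

variable {K : Matrix ι ι ℂ} {e : ι → ℕ} {k : ℕ}

/-- Each nonzero entry of `K` lowers the grade by exactly one. -/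
theorem pow_apply_eq_zero (hK : ∀ z z', K z z' ≠ 0 → e z = e z' + 1) (m : ℕ) (z z' : ι)
    (h : e z ≠ e z' + m) : (K ^ m) z z' = 0 := by
  induction m generalizing z with
  | zero => exact Matrix.one_apply_ne (by rintro rfl; simp at h)
  | succ m ih =>
    rw [pow_succ', Matrix.mul_apply]
    refine Finset.sum_eq_zero fun w _ => ?_
    by_cases hw : K z w = 0
    · rw [hw, zero_mul]
    · rw [ih w (by have := hK _ _ hw; omega), mul_zero]

theorem pow_eq_zero_of_grading (hK : ∀ z z', K z z' ≠ 0 → e z = e z' + 1) (he : ∀ z, e z ≤ k) :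
    K ^ (k + 1) = 0 := by
  ext z z'
  exact pow_apply_eq_zero hK _ _ _ (by have := he z; omega)

/-- Every term of the tail takes at least one step and so reads `Φ` only at grades strictly below
that of `z`. -/
theorem expTail_eq_zero (hK : ∀ z z', K z z' ≠ 0 → e z = e z' + 1) (he : ∀ z, e z ≤ k)
    {Φ : ι → ℂ} (n : ℕ) (hΦ : ∀ z, e z < n → Φ z = 0) (z : ι) (hz : e z ≤ n) (p : ℕ) :
    expTail K k p Φ z = 0 := by
  obtain ⟨j, hj⟩ : ∃ j, e z = j := ⟨_, rfl⟩
  induction j generalizing z p with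
  | zero =>
    rw [expTail_eq (pow_eq_zero_of_grading hK he), Finset.sum_eq_zero, mul_zero]
    intro w _
    by_cases hw : K z w = 0
    · rw [hw, zero_mul]
    · have := hK _ _ hw; omega
  | succ j ih =>
    rw [expTail_eq (pow_eq_zero_of_grading hK he), Finset.sum_eq_zero, mul_zero]
    intro w _
    by_cases hw : K z w = 0
    · rw [hw, zero_mul]
    · have := hK _ _ hw
      rw [ih w (by omega) _ (by omega), hΦ w (by omega)]; simp

/-- The recursion along shortest paths: the exponential tail is the path sum of the polynomials
`Qshift`. -/
theorem expTail_eq_walkSum (hK : ∀ z z', K z z' ≠ 0 → e z = e z' + 1) (he : ∀ z, e z ≤ k) {y : ι}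
    (hy : ∀ z, e z = 0 ↔ z = y) {Φ : ι → ℂ} {a : ι → ℝ}
    (hΦ : ∀ z, 0 < e z → e z < k →
      Φ z = -(1 + Complex.I * (a z : ℂ)) / 2 * expTail K k 0 Φ z)
    (n : ℕ) (z : ι) (hz : e z = n + 1) (p : ℕ) :
    expTail K k p Φ z = Φ y * (-Complex.I) ^ (n + 1) *
      walkSum K (n + 1) z y (fun s => Qshift p n (fun j => a (s ⟨j.val + 1, by omega⟩))) := by
  induction n generalizing z p with
  | zero =>
    rw [expTail_eq (pow_eq_zero_of_grading hK he), walkSum_succ, Finset.mul_sum, Finset.mul_sum]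
    refine Finset.sum_congr rfl fun w _ => ?_
    by_cases hw : K z w = 0
    · rw [hw]; simp
    · have hwy : w = y := (hy w).mp (by have := hK _ _ hw; omega)
      have hy0 : e y = 0 := (hy y).mpr rfl
      rw [hwy, expTail_eq_zero hK he 0 (by simp) y hy0.le, walkSum_zero, if_pos rfl, Qshift]
      simp only [Finset.univ_eq_empty, Finset.sum_empty, add_comm 1 p, zero_add]
      ring
  | succ n ih =>
    rw [expTail_eq (pow_eq_zero_of_grading hK he), walkSum_succ, Finset.mul_sum, Finset.mul_sum]
    refine Finset.sum_congr rfl fun w _ => ?_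
    by_cases hw : K z w = 0
    · rw [hw]; simp
    · have hwe := hK _ _ hw
      have hzk := he z
      rw [hΦ w (by omega) (by omega), ih w (by omega) 0, ih w (by omega) (p + 1)]
      -- All walks here start at `w`, so the first cotangent is `a w` and the recursion
      -- `Qshift_succ` splits off a constant factor.
      have hc : walkSum K (n + 1) w y (fun s => Qshift p (n + 1) (fun j =>
          a ((Fin.cons z s : Fin (n + 1 + 2) → ι) ⟨j.val + 1, by omega⟩))) =
          walkSum K (n + 1) w y (fun s => Qshift (p + 1) n (fun j => a (s ⟨j.val + 1, by omega⟩)) -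
            (1 + Complex.I * (a w : ℂ)) / (2 * (Nat.factorial (p + 1) : ℂ)) *
              Qshift 0 n (fun j => a (s ⟨j.val + 1, by omega⟩))) := by
        refine walkSum_congr fun s hs => ?_
        rw [Qshift_succ]
        have e0 : (Fin.cons z s : Fin (n + 1 + 2) → ι) ⟨(0 : Fin (n + 1)).val + 1, by simp⟩ = w := by
          rw [← hs]; rfl
        rw [e0]
        rfl
      rw [hc, walkSum_sub_const_mul]
      have hf : (Nat.factorial (p + 1) : ℂ) ≠ 0 := by exact_mod_cast (Nat.factorial_pos _).ne'
      field_simp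
      ring

end Walks

/-! ### The Feshbach matrix at the base point. -/

section BasePoint

variable {ι : Type*} [Fintype ι] [DecidableEq ι] {K : Matrix ι ι ℂ} {e : ι → ℕ} {k : ℕ}
  {x y : ι} {w : ι → ℂ} {l : ℂ}

/-- Invertibility of the reduced denominator at the base point, for a graded hopping matrix. -/
theorem isUnit_reducedDenom_of_grading (hK : ∀ z z', K z z' ≠ 0 → e z = e z' + 1)
    (he : ∀ z, e z ≤ k) (hl : l ≠ 0) (hw : ∀ z, z ≠ x → z ≠ y → w z ≠ l) :
    IsUnit (reducedDenom (coProj x y) (NormedSpace.exp ((-Complex.I) • K) * diagonal w) l) := by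
  rw [← Matrix.mulVec_injective_iff_isUnit]
  refine (injective_iff_map_eq_zero (Matrix.mulVecLin (reducedDenom (coProj x y)
    (NormedSpace.exp ((-Complex.I) • K) * diagonal w) l))).mpr ?_
  intro ψ hψ
  replace hψ : reducedDenom (coProj x y) (NormedSpace.exp ((-Complex.I) • K) * diagonal w) l *ᵥ ψ
    = 0 := hψ
  have hz : ∀ z, l * ψ z = if z = x ∨ z = y then 0 else
      ((NormedSpace.exp ((-Complex.I) • K) * diagonal w) *ᵥ (coProj x y *ᵥ ψ)) z := by
    intro z
    have h := congrFun hψ z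
    rw [reducedDenom, sub_mulVec, smul_mulVec, one_mulVec, mul_assoc, ← mulVec_mulVec,
      Pi.sub_apply, coProj_mulVec_apply, ← mulVec_mulVec, Pi.zero_apply, sub_eq_zero] at h
    exact h
  have hP : ∀ z, z = x ∨ z = y → ψ z = 0 := by
    intro z h
    have := hz z
    rw [if_pos h] at this
    exact (mul_eq_zero.mp this).resolve_left hl
  have hqψ : coProj x y *ᵥ ψ = ψ := by
    ext z
    rw [coProj_mulVec_apply]
    split_ifs with h
    · exact (hP z h).symm
    · rfl
  rw [hqψ, ← mulVec_mulVec, exp_neg_I_smul_mulVec (pow_eq_zero_of_grading hK he)] at hz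
  -- The kernel equation is triangular for the grading: the tail involves only lower grades, where
  -- `ψ` already vanishes, and the diagonal factor `l - w z` is nonzero.
  have main : ∀ n z, e z < n → ψ z = 0 := by
    intro n
    induction n with
    | zero => intro z h; omega
    | succ n ih =>
      intro z h
      by_cases hxy : z = x ∨ z = y
      · exact hP z hxy
      · have h1 := hz z
        rw [if_neg hxy, Pi.add_apply, mulVec_diagonal, expTail_eq_zero hK he n
          (fun z' hz' => by rw [mulVec_diagonal, ih z' hz', mul_zero]) z (by omega), add_zero] at h1
        have h2 : (l - w z) * ψ z = 0 := by linear_combination h1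
        push Not at hxy
        exact (mul_eq_zero.mp h2).resolve_left (sub_ne_zero.mpr (hw z hxy.1 hxy.2).symm)
  ext z
  exact main (e z + 1) z (by omega)

/-- The off-diagonal effective matrix element at the base point is the weighted path sum. -/
theorem feshbach_apply_of_grading (hK : ∀ z z', K z z' ≠ 0 → e z = e z' + 1)
    (he : ∀ z, e z ≤ k) (hl : l ≠ 0) (hw : ∀ z, z ≠ x → z ≠ y → w z ≠ l) (hwy : w y = l)
    (hxy : x ≠ y) (hy : ∀ z, e z = 0 ↔ z = y) (hx : e x = k) (a : ι → ℝ)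
    (ha : ∀ z, z ≠ x → z ≠ y → (1 + Complex.I * (a z : ℂ)) * (l - w z) = -2 * w z) {n : ℕ}
    (hn : k = n + 1) :
    feshbach (coProj x y) (NormedSpace.exp ((-Complex.I) • K) * diagonal w) l x y =
      l * (-Complex.I) ^ (n + 1) *
        walkSum K (n + 1) x y (fun s => Q n (fun j => a (s ⟨j.val + 1, by omega⟩))) := by
  have hN := isUnit_reducedDenom_of_grading (K := K) hK he hl hw
  set U := NormedSpace.exp ((-Complex.I) • K) * diagonal w with hU
  set T := Ring.inverse (reducedDenom (coProj x y) U l) * coProj x y * U with hT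
  have hqT : coProj x y * T = T := by
    rw [hT]; simp only [← mul_assoc]
    rw [mul_inverse_reducedDenom (coProj_mul_self x y) hN, mul_assoc _ (coProj x y) (coProj x y),
      coProj_mul_self]
  have hqF := mul_feshbach (coProj_mul_self x y) hN
  rw [← hT] at hqF
  have hF : feshbach (coProj x y) U l = U * (1 + T) := by
    rw [feshbach, mul_add, mul_one, hT]; simp only [mul_assoc]
  set Ψ : ι → ℂ := (1 + T) *ᵥ Pi.single y 1 with hΨ
  set Φ : ι → ℂ := diagonal w *ᵥ Ψ with hΦ
  have hcol : ∀ z, feshbach (coProj x y) U l z y = Φ z + expTail K k 0 Φ z := by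
    intro z
    have h1 : feshbach (coProj x y) U l *ᵥ Pi.single y 1 = Φ + expTail K k 0 Φ := by
      rw [hF, ← mulVec_mulVec, ← hΨ, hU, ← mulVec_mulVec, ← hΦ,
        exp_neg_I_smul_mulVec (pow_eq_zero_of_grading hK he)]
    have := congrFun h1 z
    rwa [Matrix.mulVec_single_one] at this
  have hΨz : ∀ z, Ψ z = (1 : Matrix ι ι ℂ) z y + T z y := by
    intro z
    rw [hΨ, Matrix.mulVec_single_one]; rfl
  have hTP : ∀ z, z = x ∨ z = y → T z y = 0 := by
    intro z hz
    have := congrFun (congrFun hqT z) y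
    rw [coProj, diagonal_mul, if_pos hz, zero_mul] at this
    exact this.symm
  have hΦx : Φ x = 0 := by
    rw [hΦ, mulVec_diagonal, hΨz, hTP x (Or.inl rfl), Matrix.one_apply_ne hxy]; simp
  have hΦy : Φ y = l := by
    rw [hΦ, mulVec_diagonal, hΨz, hTP y (Or.inr rfl), Matrix.one_apply_eq, hwy]; simp
  -- At a non-resonant state the lift satisfies `Φ z + tail = l T z y` and `Φ z = w z T z y`.
  -- Eliminating `T z y` gives the ratio `w z / (l - w z)`, which is `-(1 + i a z) / 2`.
  have hrec : ∀ z, 0 < e z → e z < k →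
      Φ z = -(1 + Complex.I * (a z : ℂ)) / 2 * expTail K k 0 Φ z := by
    intro z h0 h1
    have hzx : z ≠ x := by rintro rfl; omega
    have hzy : z ≠ y := fun h => by have := (hy z).mpr h; omega
    have h2 := congrFun (congrFun hqF z) y
    rw [coProj, diagonal_mul, if_neg (by tauto), one_mul, ← coProj, hcol, Matrix.smul_apply,
      smul_eq_mul] at h2
    have h3 : Φ z = w z * T z y := by
      rw [hΦ, mulVec_diagonal, hΨz, Matrix.one_apply_ne hzy, zero_add]
    have h4 : expTail K k 0 Φ z = (l - w z) * T z y := by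
      rw [h3] at h2; linear_combination h2
    rw [h4, h3]
    linear_combination (1 / 2 : ℂ) * T z y * ha z hzx hzy
  rw [hcol, hΦx, zero_add, expTail_eq_walkSum hK he hy hrec n x (by omega), hΦy]
  simp_rw [Qshift_zero]

end BasePoint

/-! ### Grading by hopping distance and the gauge transformation. -/

section Grading

variable {ι : Type*}

/-- The hopping matrix `τ H` conjugated by powers of `τ` given by a grading `e`. -/
noncomputable def gaugedHop (H : Matrix ι ι ℂ) (e : ι → ℕ) (τ : ℝ) : Matrix ι ι ℂ :=
  Matrix.of fun z z' => (τ : ℂ) ^ (1 + e z' - e z) * H z z'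

/-- At `τ = 0` only exponent zero survives, because `0 ^ 0 = 1`. Truncated subtraction would also
give exponent zero for larger drops of the grade, but there `H` vanishes. -/
theorem gaugedHop_zero_apply {H : Matrix ι ι ℂ} {e : ι → ℕ}
    (he : ∀ z z', H z z' ≠ 0 → e z ≤ e z' + 1) (z z' : ι) :
    gaugedHop H e 0 z z' = if e z = e z' + 1 then H z z' else 0 := by
  rw [gaugedHop, Matrix.of_apply]
  by_cases h : H z z' = 0
  · simp [h]
  · have := he z z' h
    split_ifs with h1
    · rw [h1, show 1 + e z' - (e z' + 1) = 0 by omega]; simp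
    · rw [Complex.ofReal_zero, zero_pow (by omega), zero_mul]

theorem gaugedHop_zero_grading {H : Matrix ι ι ℂ} {e : ι → ℕ}
    (he : ∀ z z', H z z' ≠ 0 → e z ≤ e z' + 1) (z z' : ι) (h : gaugedHop H e 0 z z' ≠ 0) :
    e z = e z' + 1 := by
  rw [gaugedHop_zero_apply he] at h
  by_contra h'
  rw [if_neg h'] at h
  exact h rfl

/-- A hop lowers the grade by at most one, so the prefactor `τ` compensates any negative power
created by the conjugation. The gauged family is therefore polynomial in `τ`, although the
conjugating diagonal may be singular at `τ = 0`. -/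
theorem diagonal_mul_smul_eq_gaugedHop_mul [Fintype ι] [DecidableEq ι] {H : Matrix ι ι ℂ} {e : ι → ℕ} {k : ℕ}
    (he : ∀ z z', H z z' ≠ 0 → e z ≤ e z' + 1) (hk : ∀ z, e z ≤ k) (τ : ℝ) :
    diagonal (fun z => (τ : ℂ) ^ (k - e z)) * ((τ : ℂ) • H) =
      gaugedHop H e τ * diagonal (fun z => (τ : ℂ) ^ (k - e z)) := by
  ext z z'
  rw [diagonal_mul, mul_diagonal, gaugedHop, Matrix.of_apply, Matrix.smul_apply, smul_eq_mul]
  by_cases h : H z z' = 0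
  · simp [h]
  · have h1 := he z z' h
    have h2 := hk z
    have h3 := hk z'
    have : k - e z + 1 = (1 + e z' - e z) + (k - e z') := by omega
    calc (τ : ℂ) ^ (k - e z) * (τ * H z z') = (τ : ℂ) ^ (k - e z + 1) * H z z' := by ring
      _ = (τ : ℂ) ^ (1 + e z' - e z) * H z z' * (τ : ℂ) ^ (k - e z') := by rw [this]; ring

/-- Along a path of minimal length the grading drops by one at each step. -/
theorem grading_step_of_prod_ne_zero {A : Matrix ι ι ℂ} {e : ι → ℕ}
    (he : ∀ z z', A z z' ≠ 0 → e z ≤ e z' + 1) {n : ℕ} {s : Fin (n + 1) → ι}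
    (h0 : e (s 0) = n) (hl : e (s (Fin.last n)) = 0)
    (hs : ∏ j : Fin n, A (s j.castSucc) (s j.succ) ≠ 0) (j : Fin n) :
    e (s j.castSucc) = e (s j.succ) + 1 := by
  have hle : ∀ j : Fin n, (0 : ℤ) ≤ (e (s j.succ) : ℤ) + 1 - e (s j.castSucc) := fun j => by
    have := he _ _ (Finset.prod_ne_zero_iff.mp hs j (Finset.mem_univ j))
    omega
  -- The nonnegative slacks telescope to zero, so each of them is zero.
  have hsum : ∑ j : Fin n, ((e (s j.succ) : ℤ) + 1 - e (s j.castSucc)) = 0 := by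
    have h1 := Fin.sum_univ_succ (fun i => (e (s i) : ℤ))
    have h2 := Fin.sum_univ_castSucc (fun i => (e (s i) : ℤ))
    rw [Finset.sum_sub_distrib, Finset.sum_add_distrib]
    simp only [Finset.sum_const, Finset.card_univ, Fintype.card_fin, nsmul_eq_mul, mul_one]
    rw [h0] at h1
    rw [hl] at h2
    push_cast at h2
    linarith
  have := (Finset.sum_eq_zero_iff_of_nonneg (fun j _ => hle j)).mp hsum j (Finset.mem_univ j)
  omega

variable {V : Type*} [NormedAddCommGroup V] [InnerProductSpace ℂ V] [Fintype ι]

/-- The length of the shortest coupling path from `z` to `y`, capped at `k`. -/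
noncomputable def hopDist (b : OrthonormalBasis ι ℂ V) (H : V →L[ℂ] V) (y : ι) (k : ℕ) (z : ι) : ℕ :=
  sInf ({n : ℕ | ∃ s : Fin (n + 1) → ι, IsCouplingPath b H z y s} ∪ {k})

variable {b : OrthonormalBasis ι ℂ V} {H : V →L[ℂ] V} {x y : ι} {k : ℕ}

theorem hopDist_mem (z : ι) : hopDist b H y k z ∈
    {n : ℕ | ∃ s : Fin (n + 1) → ι, IsCouplingPath b H z y s} ∪ {k} :=
  Nat.sInf_mem ⟨k, Or.inr rfl⟩

theorem hopDist_le (z : ι) : hopDist b H y k z ≤ k := Nat.sInf_le (Or.inr rfl)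

theorem hopDist_of_isKCoupled (hk : IsKCoupled b H x y k) : hopDist b H y k x = k := by
  refine le_antisymm (hopDist_le x) ?_
  rcases hopDist_mem (b := b) (H := H) (y := y) (k := k) x with h | h
  · exact hk.2 h
  · exact (Set.mem_singleton_iff.mp h).ge

theorem hopDist_eq_zero_iff (hk : 0 < k) (z : ι) : hopDist b H y k z = 0 ↔ z = y := by
  constructor
  · intro h0
    rcases hopDist_mem (b := b) (H := H) (y := y) (k := k) z with h | h
    · rw [h0] at h
      obtain ⟨s, h1, h2, -⟩ := h
      rw [← h1, ← h2]; rfl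
    · rw [Set.mem_singleton_iff] at h; omega
  · rintro rfl
    refine Nat.le_zero.mp (Nat.sInf_le (Or.inl ⟨fun _ => z, rfl, rfl, ?_⟩))
    simp [pathWeight]

/-- Prepending the hop to a shortest path proves the bound; the cap at `k` is harmless. -/
theorem hopDist_le_add_one {z z' : ι} (h : matElem b H z z' ≠ 0) :
    hopDist b H y k z ≤ hopDist b H y k z' + 1 := by
  rcases hopDist_mem (b := b) (H := H) (y := y) (k := k) z' with h' | h'
  · obtain ⟨s, h1, h2, h3⟩ := h'
    refine Nat.sInf_le (Or.inl ⟨Fin.cons z s, rfl, ?_, ?_⟩)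
    · rw [← Fin.succ_last, Fin.cons_succ, h2]
    · rw [pathWeight, Fin.prod_univ_succ]
      refine mul_ne_zero ?_ h3
      change matElem b H z (s 0) ≠ 0
      rwa [h1]
  · rw [Set.mem_singleton_iff.mp h']
    exact (hopDist_le z).trans (Nat.le_succ k)

theorem isKCoupled_pos (hk : IsKCoupled b H x y k) (hxy : x ≠ y) : 0 < k := by
  rcases Nat.eq_zero_or_pos k with rfl | h
  · obtain ⟨s, h1, h2, -⟩ := hk.1
    exact absurd (h1.symm.trans h2) hxy
  · exact h

/-- On a path of minimal length every step lowers the grade by one, so the gauged hopping matrix at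
`τ = 0` retains exactly the coupling paths of length `k`, with their weights. -/
theorem cEff_eq_walkSum [DecidableEq ι] (hk : IsKCoupled b H x y k) (E : ι → ℝ)
    (Δs : ℝ) {n : ℕ} (hn : k = n + 1) :
    cEff b H E Δs x y k =
      walkSum (gaugedHop (Matrix.of (matElem b H)) (hopDist b H y k) 0) (n + 1) x y
        (fun s => Q n (fun j => Real.cot (Δs / 2 * (E (s ⟨j.val + 1, by omega⟩) - E x)))) := by
  subst hn
  have he : ∀ z z', Matrix.of (matElem b H) z z' ≠ 0 →
      hopDist b H y (n + 1) z ≤ hopDist b H y (n + 1) z' + 1 := fun z z' h => hopDist_le_add_one h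
  rw [cEff, walkSum, Finset.sum_filter]
  refine Finset.sum_congr rfl fun s _ => ?_
  by_cases h01 : s 0 = x ∧ s (Fin.last (n + 1)) = y
  · rw [if_pos h01]
    by_cases hw : pathWeight b H s = 0
    · rw [if_neg (fun h => h.2.2 hw)]
      rw [pathWeight, Finset.prod_eq_zero_iff] at hw
      obtain ⟨j, -, hj⟩ := hw
      rw [Finset.prod_eq_zero (Finset.mem_univ j), zero_mul]
      rw [gaugedHop, Matrix.of_apply, Matrix.of_apply, hj, mul_zero]
    · rw [if_pos ⟨h01.1, h01.2, hw⟩]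
      have hp : ∏ j : Fin (n + 1), gaugedHop (Matrix.of (matElem b H)) (hopDist b H y (n + 1)) 0
          (s j.castSucc) (s j.succ) = pathWeight b H s := by
        refine Finset.prod_congr rfl fun j _ => ?_
        rw [gaugedHop_zero_apply he, if_pos]
        · rfl
        · exact grading_step_of_prod_ne_zero he (by rw [h01.1]; exact hopDist_of_isKCoupled hk)
            (by rw [h01.2]; exact (hopDist_eq_zero_iff (Nat.succ_pos n) y).mpr rfl) hw j
      rw [hp]
      rfl
  · rw [if_neg h01, if_neg (fun h => h01 ⟨h.1, h.2.1⟩)]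

/-- For directly coupled states the effective coupling is the matrix element. -/
theorem cEff_one (hk : IsKCoupled b H x y 1) (E : ι → ℝ) (Δs : ℝ) :
    cEff b H E Δs x y 1 = matElem b H x y := by
  classical
  rw [cEff_eq_walkSum hk E Δs (n := 0) rfl, walkSum_succ, Finset.sum_eq_single y]
  · have he : ∀ z z', Matrix.of (matElem b H) z z' ≠ 0 →
      hopDist b H y 1 z ≤ hopDist b H y 1 z' + 1 := fun z z' h => hopDist_le_add_one h
    rw [walkSum_zero, if_pos rfl, gaugedHop_zero_apply he, if_pos, Q]
    · simp
    · rw [hopDist_of_isKCoupled hk, (hopDist_eq_zero_iff Nat.one_pos y).mpr rfl]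
  · intro z _ hz
    rw [walkSum_zero, if_neg hz, mul_zero]
  · simp

/-- The resonance factor of a non-resonant state is expressed by a cotangent. -/
theorem one_add_I_cot_mul (θ : ℝ) (c : ℂ) (hθ : Real.sin θ ≠ 0) :
    (1 + Complex.I * (Real.cot θ : ℂ)) * (c - Complex.exp (-2 * Complex.I * θ) * c) =
      -2 * (Complex.exp (-2 * Complex.I * θ) * c) := by
  have hs : Complex.sin θ ≠ 0 := by
    rw [← Complex.ofReal_sin]; exact_mod_cast hθ
  have h1 : Complex.exp (-2 * Complex.I * θ) =
      (Complex.cos θ - Complex.sin θ * Complex.I) ^ 2 := by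
    have : Complex.cos θ - Complex.sin θ * Complex.I = Complex.exp (-(θ : ℂ) * Complex.I) := by
      rw [Complex.exp_mul_I, Complex.cos_neg, Complex.sin_neg]; ring
    rw [this, ← Complex.exp_nat_mul]
    congr 1; push_cast; ring
  have h2 := Complex.sin_sq_add_cos_sq (θ : ℂ)
  have h3 : (1 + Complex.I * (Real.cot θ : ℂ)) * Complex.sin θ =
      Complex.I * (Complex.cos θ - Complex.sin θ * Complex.I) := by
    rw [Real.cot_eq_cos_div_sin]
    push_cast
    field_simp
    linear_combination Complex.sin θ * Complex.I_sq
  refine mul_right_cancel₀ hs ?_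
  rw [h1]
  generalize Complex.cos θ = C at *
  generalize Complex.sin θ = S at *
  have hI := Complex.I_sq
  generalize Complex.I = I at *
  linear_combination (c - (C - S * I) ^ 2 * c) * h3 - I * (C - S * I) * c * h2 +
    (2 * S * (C - S * I) * C * c + c * S ^ 2 * I * (I * S - C)) * hI

end Grading

open scoped Matrix.Norms.Operator

/-! ### Norm estimates and expansions of exponentials. -/

section MatrixNorm

theorem exists_norm_exp_phase_sub_le (Δs e : ℝ) : ∃ C > 0, ∃ ε > 0, ∀ s : ℝ, |s| < ε →
    ‖Complex.exp (-Complex.I * (Δs + s) * e) - Complex.exp (-Complex.I * Δs * e) *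
      (1 - Complex.I * s * e)‖ ≤ C * s ^ 2 := by
  refine ⟨(|e| + 1) ^ 2, by positivity, 1 / (|e| + 1), by positivity, fun s hs => ?_⟩
  have h1 : ‖-Complex.I * (s : ℂ) * (e : ℂ)‖ = |s| * |e| := by simp
  have hpos : 0 < |e| + 1 := by positivity
  rw [lt_div_iff₀ hpos] at hs
  have h2 : |s| * |e| ≤ |s| * (|e| + 1) := by gcongr; linarith
  have h3 := Complex.norm_exp_sub_one_sub_id_le (x := -Complex.I * (s : ℂ) * (e : ℂ))
    (by rw [h1]; linarith)
  have heq : Complex.exp (-Complex.I * (Δs + s) * e) - Complex.exp (-Complex.I * Δs * e) *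
      (1 - Complex.I * s * e) = Complex.exp (-Complex.I * Δs * e) *
      (Complex.exp (-Complex.I * (s : ℂ) * (e : ℂ)) - 1 - (-Complex.I * (s : ℂ) * (e : ℂ))) := by
    rw [show -Complex.I * ((Δs : ℂ) + s) * e = -Complex.I * Δs * e +
      -Complex.I * (s : ℂ) * (e : ℂ) by ring, Complex.exp_add]
    ring
  have hn : ‖Complex.exp (-Complex.I * Δs * e)‖ = 1 := by
    rw [show -Complex.I * (Δs : ℂ) * (e : ℂ) = ((-(Δs * e) : ℝ) : ℂ) * Complex.I by
      push_cast; ring]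
    exact Complex.norm_exp_ofReal_mul_I _
  rw [heq, norm_mul, hn, one_mul]
  refine h3.trans ?_
  rw [h1, mul_pow, sq_abs, mul_comm]
  gcongr
  linarith

variable {ι : Type*} [Fintype ι]

theorem contDiffAt_matrix_apply {E : Type*} [NormedAddCommGroup E] [NormedSpace ℝ E]
    {f : E → Matrix ι ι ℂ} {p : E} (h : ContDiffAt ℝ 1 f p) (i j : ι) :
    ContDiffAt ℝ 1 (fun p => f p i j) p :=
  (LinearMap.toContinuousLinearMap (Matrix.entryLinearMap ℝ ℂ i j)).contDiff.contDiffAt.comp p h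

variable [DecidableEq ι]

theorem norm_apply_le_norm (A : Matrix ι ι ℂ) (i j : ι) : ‖A i j‖ ≤ ‖A‖ := by
  rw [Matrix.linfty_opNorm_def]
  have h1 : ‖A i j‖₊ ≤ ∑ j, ‖A i j‖₊ :=
    Finset.single_le_sum (f := fun j => ‖A i j‖₊) (fun _ _ => zero_le) (Finset.mem_univ j)
  have h2 : ∑ j, ‖A i j‖₊ ≤ Finset.univ.sup fun i => ∑ j, ‖A i j‖₊ :=
    Finset.le_sup (f := fun i => ∑ j, ‖A i j‖₊) (Finset.mem_univ i)
  exact_mod_cast h1.trans h2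

theorem norm_mulVec_apply_le (A : Matrix ι ι ℂ) {v : ι → ℂ} (hv : ∀ i, ‖v i‖ ≤ 1) (z : ι) :
    ‖(A *ᵥ v) z‖ ≤ ‖A‖ := by
  have h := Matrix.linfty_opNorm_mulVec A v
  have h1 : ‖v‖ ≤ 1 := (pi_norm_le_iff_of_nonneg zero_le_one).mpr hv
  calc ‖(A *ᵥ v) z‖ ≤ ‖A *ᵥ v‖ := norm_le_pi_norm _ z
    _ ≤ ‖A‖ * ‖v‖ := h
    _ ≤ ‖A‖ * 1 := by gcongr
    _ = ‖A‖ := mul_one _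

theorem contDiff_matrix {E : Type*} [NormedAddCommGroup E] [NormedSpace ℝ E]
    {f : E → Matrix ι ι ℂ} (h : ∀ i j, ContDiff ℝ 1 fun p => f p i j) : ContDiff ℝ 1 f := by
  have : f = fun p => ∑ i, ∑ j, f p i j • Matrix.single i j (1 : ℂ) := by
    funext p
    conv_lhs => rw [Matrix.matrix_eq_sum_single (f p)]
    simp [Matrix.smul_single]
  rw [this]
  exact ContDiff.sum fun i _ => ContDiff.sum fun j _ => (h i j).smul contDiff_const

/-- Second-order expansion of the exponential along a line. -/
theorem exists_norm_exp_smul_sub_le (A : Matrix ι ι ℂ) : ∃ C > 0, ∃ ε > 0, ∀ τ : ℝ, |τ| < ε →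
    ‖NormedSpace.exp ((-Complex.I) • ((τ : ℂ) • A)) - 1‖ ≤ C * |τ| ∧
    ‖NormedSpace.exp ((-Complex.I) • ((τ : ℂ) • A)) - 1 - (-Complex.I) • ((τ : ℂ) • A)‖ ≤
      C * |τ| ^ 2 := by
  have h := (NormedSpace.exp_hasFPowerSeriesAt_zero (𝕂 := ℂ)
    (𝔸 := Matrix ι ι ℂ)).isBigO_sub_partialSum_pow 2
  have hs : ∀ X : Matrix ι ι ℂ, (NormedSpace.expSeries ℂ (Matrix ι ι ℂ)).partialSum 2 X = 1 + X := by
    intro X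
    simp [FormalMultilinearSeries.partialSum, Finset.sum_range_succ, NormedSpace.expSeries_apply_eq]
  simp only [zero_add] at h
  obtain ⟨C, hC, hb⟩ := h.exists_pos
  have hb' := hb.bound
  obtain ⟨r, hr, hball⟩ := Metric.eventually_nhds_iff.mp hb'
  set M := ‖A‖ + 1 with hM
  have hMpos : 0 < M := by positivity
  have hnorm : ∀ τ : ℝ, ‖(-Complex.I) • ((τ : ℂ) • A)‖ ≤ |τ| * M := by
    intro τ
    rw [norm_smul, norm_smul, norm_neg, Complex.norm_I, one_mul, Complex.norm_real, Real.norm_eq_abs]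
    gcongr; linarith
  refine ⟨C * M ^ 2 + M, by positivity, min (r / M) 1, by positivity, fun τ hτ => ?_⟩
  have hτ1 : |τ| ≤ 1 := (hτ.trans_le (min_le_right _ _)).le
  have hτr : |τ| * M < r := by
    rw [← lt_div_iff₀ hMpos]; exact hτ.trans_le (min_le_left _ _)
  have key := hball (y := (-Complex.I) • ((τ : ℂ) • A)) (by
    rw [dist_zero_right]; exact (hnorm τ).trans_lt hτr)
  rw [Real.norm_of_nonneg (by positivity)] at key
  replace key : ‖NormedSpace.exp ((-Complex.I) • ((τ : ℂ) • A)) -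
      (1 + (-Complex.I) • ((τ : ℂ) • A))‖ ≤ C * ‖(-Complex.I) • ((τ : ℂ) • A)‖ ^ 2 := by
    rw [← hs]; exact key
  rw [← sub_sub] at key
  have k2 : ‖NormedSpace.exp ((-Complex.I) • ((τ : ℂ) • A)) - 1 - (-Complex.I) • ((τ : ℂ) • A)‖ ≤
      C * M ^ 2 * |τ| ^ 2 := by
    refine key.trans ?_
    calc C * ‖(-Complex.I) • ((τ : ℂ) • A)‖ ^ 2 ≤ C * (|τ| * M) ^ 2 := by
          gcongr; exact hnorm τ
      _ = C * M ^ 2 * |τ| ^ 2 := by ring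
  constructor
  · have e : NormedSpace.exp ((-Complex.I) • ((τ : ℂ) • A)) - 1 =
        (NormedSpace.exp ((-Complex.I) • ((τ : ℂ) • A)) - 1 - (-Complex.I) • ((τ : ℂ) • A)) +
          (-Complex.I) • ((τ : ℂ) • A) := by abel
    rw [e]
    refine (norm_add_le _ _).trans ?_
    have : C * M ^ 2 * |τ| ^ 2 ≤ C * M ^ 2 * |τ| := by
      gcongr
      nlinarith [abs_nonneg τ]
    linarith [hnorm τ]
  · refine k2.trans ?_
    gcongr
    linarith

end MatrixNorm

/-! ### Smoothness and unitarity of the evolution matrix, for a general hopping family. -/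

section Evolution

variable {ι : Type*} [Fintype ι] [DecidableEq ι]

/-- The diagonal phases of the cost evolution. -/
noncomputable def phaseDiag (E : ι → ℝ) (Δs s : ℝ) : Matrix ι ι ℂ :=
  diagonal fun z => Complex.exp (-Complex.I * (Δs + s) * E z)

/-- The evolution matrix with hopping matrix `A τ`. -/
noncomputable def evol (A : ℝ → Matrix ι ι ℂ) (E : ι → ℝ) (Δs : ℝ) (τ δ : ℝ) : Matrix ι ι ℂ :=
  NormedSpace.exp ((-Complex.I) • A τ) * phaseDiag E Δs (δ - τ)

variable {A : ℝ → Matrix ι ι ℂ} {E : ι → ℝ} {Δs : ℝ}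

theorem contDiff_phaseDiag (E : ι → ℝ) (Δs : ℝ) : ContDiff ℝ 1 (phaseDiag E Δs) := by
  refine contDiff_matrix fun i j => ?_
  by_cases h : i = j
  · subst h
    simp only [phaseDiag, diagonal_apply_eq]
    have : ContDiff ℝ 1 fun s : ℝ => (s : ℂ) := Complex.ofRealCLM.contDiff
    fun_prop
  · simp only [phaseDiag, diagonal_apply_ne _ h]
    exact contDiff_const

theorem contDiff_evol (hA : ContDiff ℝ 1 A) :
    ContDiff ℝ 1 fun p : ℝ × ℝ => evol A E Δs p.1 p.2 := by
  have hexp : ContDiff ℝ 1 (NormedSpace.exp : Matrix ι ι ℂ → Matrix ι ι ℂ) :=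
    contDiff_iff_contDiffAt.mpr fun x => (NormedSpace.exp_analytic (𝕂 := ℝ) x).contDiffAt
  have h1 : ContDiff ℝ 1 fun p : ℝ × ℝ => NormedSpace.exp ((-Complex.I) • A p.1) :=
    hexp.comp ((hA.comp contDiff_fst).const_smul (-Complex.I))
  have h2 : ContDiff ℝ 1 fun p : ℝ × ℝ => phaseDiag E Δs (p.2 - p.1) :=
    (contDiff_phaseDiag E Δs).comp (contDiff_snd.sub contDiff_fst)
  exact h1.mul h2

theorem contDiff_reducedDenom (hA : ContDiff ℝ 1 A) (q : Matrix ι ι ℂ) :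
    ContDiff ℝ 1 fun p : ℝ × ℝ × ℂ => reducedDenom q (evol A E Δs p.1 p.2.1) p.2.2 := by
  have h : ContDiff ℝ 1 fun p : ℝ × ℝ × ℂ => evol A E Δs p.1 p.2.1 :=
    (contDiff_evol hA).comp (contDiff_fst.prodMk (contDiff_fst.comp contDiff_snd))
  exact (contDiff_snd.snd.smul contDiff_const).sub ((contDiff_const.mul h).mul contDiff_const)

theorem contDiffAt_feshbach (hA : ContDiff ℝ 1 A) (q : Matrix ι ι ℂ) {p : ℝ × ℝ × ℂ}
    (hN : IsUnit (reducedDenom q (evol A E Δs p.1 p.2.1) p.2.2)) :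
    ContDiffAt ℝ 1 (fun p : ℝ × ℝ × ℂ => feshbach q (evol A E Δs p.1 p.2.1) p.2.2) p := by
  have h : ContDiffAt ℝ 1 (fun p : ℝ × ℝ × ℂ => evol A E Δs p.1 p.2.1) p :=
    ((contDiff_evol hA).comp (contDiff_fst.prodMk (contDiff_fst.comp contDiff_snd))).contDiffAt
  obtain ⟨u, hu⟩ := hN
  have hinv : ContDiffAt ℝ 1 (fun p : ℝ × ℝ × ℂ =>
      Ring.inverse (reducedDenom q (evol A E Δs p.1 p.2.1) p.2.2)) p := by
    refine ContDiffAt.comp (g := Ring.inverse) p ?_ (contDiff_reducedDenom hA q).contDiffAt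
    rw [← hu]
    exact contDiffAt_ringInverse ℝ u
  exact h.add (((h.mul hinv).mul contDiffAt_const).mul h)

theorem phaseDiag_unitary (E : ι → ℝ) (Δs s : ℝ) :
    (phaseDiag E Δs s)ᴴ * phaseDiag E Δs s = 1 := by
  rw [phaseDiag, diagonal_conjTranspose, diagonal_mul_diagonal, ← diagonal_one]
  congr 1; funext z
  rw [Pi.star_apply, Complex.star_def, ← Complex.exp_conj, ← Complex.exp_add]
  simp only [map_mul, map_neg, Complex.conj_I, map_add, Complex.conj_ofReal]
  rw [show - -Complex.I * (↑Δs + ↑s) * ↑(E z) + -Complex.I * (↑Δs + ↑s) * ↑(E z) = 0 by ring,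
    Complex.exp_zero]

theorem evol_unitary {τ : ℝ} (hA : (A τ)ᴴ = A τ) (δ : ℝ) :
    (evol A E Δs τ δ)ᴴ * evol A E Δs τ δ = 1 := by
  have h : (NormedSpace.exp ((-Complex.I) • A τ))ᴴ * NormedSpace.exp ((-Complex.I) • A τ) = 1 := by
    rw [← Matrix.exp_conjTranspose, conjTranspose_smul, hA]
    rw [← Matrix.exp_add_of_commute _ _ (((Commute.refl _).smul_left _).smul_right _), ← add_smul]
    simp
  rw [evol, conjTranspose_mul, mul_assoc, ← mul_assoc (_ᴴ) (NormedSpace.exp _), h, one_mul,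
    phaseDiag_unitary]

end Evolution

theorem exists_forall_of_eventually {l₀ : ℂ} {P : ℝ → ℝ → ℂ → Prop}
    (h : ∀ᶠ p : ℝ × ℝ × ℂ in 𝓝 (0, 0, l₀), P p.1 p.2.1 p.2.2) :
    ∃ ε > 0, ∀ (τ δ : ℝ) (l : ℂ), |τ| < ε → |δ| < ε → ‖l - l₀‖ < ε → P τ δ l := by
  obtain ⟨ε, hε, hb⟩ := Metric.eventually_nhds_iff.mp h
  refine ⟨ε, hε, fun τ δ l h1 h2 h3 => hb (y := (τ, δ, l)) ?_⟩
  rw [Prod.dist_eq, Prod.dist_eq, Real.dist_0_eq_abs, Real.dist_0_eq_abs, dist_eq_norm]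
  exact max_lt h1 (max_lt h2 h3)

theorem norm_exp_neg_I_mul_mul (s e : ℝ) : ‖Complex.exp (-Complex.I * s * e)‖ = 1 := by
  rw [show -Complex.I * (s : ℂ) * (e : ℂ) = ((-(s * e) : ℝ) : ℂ) * Complex.I by push_cast; ring]
  exact Complex.norm_exp_ofReal_mul_I _

/-- Multiplies the first-order expansions of the mixer entry `X` and of the cost phase `w`; every
cross term is quadratic in `(τ, δ)`. -/
theorem norm_mul_phase_sub_le {X w l₀ h : ℂ} {τ δ e C₁ C₂ : ℝ} (hC₁ : 0 ≤ C₁) (hC₂ : 0 ≤ C₂)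
    (hl₀ : ‖l₀‖ = 1) (hw : ‖w‖ = 1) (hτ : |τ| ≤ 1) (hX : ‖X - 1 + Complex.I * τ * h‖ ≤ C₁ * τ ^ 2)
    (hwl : ‖w - l₀ * (1 - Complex.I * (δ - τ : ℝ) * e)‖ ≤ C₂ * (δ - τ) ^ 2) :
    ‖X * w - l₀ * (1 - Complex.I * (δ * e + τ * (h - e)))‖ ≤
      (C₁ + 3 * (1 + ‖h‖) * C₂ + 3 * ‖h‖ * |e|) * (τ ^ 2 + δ ^ 2) := by
  have hs2 : (δ - τ) ^ 2 ≤ 3 * (τ ^ 2 + δ ^ 2) := by nlinarith [sq_nonneg (δ + τ)]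
  have heq : X * w - l₀ * (1 - Complex.I * (δ * e + τ * (h - e))) =
      (X - 1 + Complex.I * τ * h) * w + (1 - Complex.I * τ * h) *
        (w - l₀ * (1 - Complex.I * (δ - τ : ℝ) * e)) - l₀ * ((τ * (δ - τ) : ℝ) : ℂ) * h * e := by
    push_cast
    linear_combination (l₀ * τ * (δ - τ) * h * e) * Complex.I_sq
  have t1 : ‖(X - 1 + Complex.I * τ * h) * w‖ ≤ C₁ * (τ ^ 2 + δ ^ 2) := by
    rw [norm_mul, hw, mul_one]
    refine hX.trans ?_
    gcongr
    linarith [sq_nonneg δ]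
  have t2 : ‖(1 - Complex.I * τ * h) * (w - l₀ * (1 - Complex.I * (δ - τ : ℝ) * e))‖ ≤
      (1 + ‖h‖) * (C₂ * (3 * (τ ^ 2 + δ ^ 2))) := by
    rw [norm_mul]
    have hb : ‖1 - Complex.I * τ * h‖ ≤ 1 + ‖h‖ := by
      refine (norm_sub_le _ _).trans ?_
      rw [norm_one, norm_mul, norm_mul, Complex.norm_I, Complex.norm_real, Real.norm_eq_abs,
        one_mul]
      have := mul_le_mul_of_nonneg_right hτ (norm_nonneg h)
      linarith
    refine mul_le_mul hb (hwl.trans ?_) (norm_nonneg _) (by positivity)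
    gcongr
  have t3 : ‖l₀ * ((τ * (δ - τ) : ℝ) : ℂ) * h * e‖ ≤ (3 * (τ ^ 2 + δ ^ 2)) * ‖h‖ * |e| := by
    rw [norm_mul, norm_mul, norm_mul, hl₀, one_mul, Complex.norm_real, Complex.norm_real,
      Real.norm_eq_abs, Real.norm_eq_abs]
    gcongr
    rw [abs_le]
    constructor <;> nlinarith [sq_nonneg (δ + τ), sq_nonneg (δ - τ), sq_nonneg τ, sq_nonneg δ]
  rw [heq]
  refine (norm_sub_le _ _).trans ((add_le_add_left (norm_add_le _ _) _).trans ?_)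
  linarith

/-! ### Bounds on the effective matrix. -/

section Effective

theorem phaseDiag_zero {ι : Type*} [DecidableEq ι] (E : ι → ℝ) (Δs : ℝ) :
    phaseDiag E Δs (0 - 0) = diagonal fun z => Complex.exp (-Complex.I * Δs * E z) := by
  simp [phaseDiag]

variable {ι : Type*} [Fintype ι]

theorem contDiff_ofReal_smul (H : Matrix ι ι ℂ) : ContDiff ℝ 1 fun τ : ℝ => (τ : ℂ) • H :=
  (Complex.ofRealCLM.contDiff (n := 1)).smul contDiff_const

variable [DecidableEq ι]

/-- The effective matrix of the evolution `e^{-iτH} e^{-i(Δs + δ - τ)E}` on the pair `x, y`. -/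
noncomputable def effMatrix (H : Matrix ι ι ℂ) (E : ι → ℝ) (Δs : ℝ) (x y : ι) (τ δ : ℝ) (l : ℂ) :
    Matrix ι ι ℂ :=
  feshbach (coProj x y) (evol (fun τ : ℝ => (τ : ℂ) • H) E Δs τ δ) l

variable {H : Matrix ι ι ℂ} {E : ι → ℝ} {Δs : ℝ} {x y : ι} {l₀ l : ℂ} {τ δ : ℝ}

theorem isUnit_reducedDenom_base (hl₀ : l₀ = Complex.exp (-Complex.I * Δs * E x))
    (hother : ∀ z, z ≠ x → z ≠ y → Complex.exp (-Complex.I * Δs * E z) ≠ l₀) :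
    IsUnit (reducedDenom (coProj x y) (evol (fun τ : ℝ => (τ : ℂ) • H) E Δs 0 0) l₀) := by
  -- At `τ = 0` there is no hopping, so the zero matrix with the trivial grading serves.
  have h := isUnit_reducedDenom_of_grading (K := (0 : Matrix ι ι ℂ)) (e := fun _ => 0) (k := 0)
    (x := x) (y := y) (w := fun z => Complex.exp (-Complex.I * Δs * E z)) (l := l₀)
    (by simp) (by simp) (by rw [hl₀]; exact Complex.exp_ne_zero _) hother
  rw [evol, phaseDiag_zero]
  simpa using h

/-- The off-diagonal blocks of the evolution matrix are of first order in `τ`. -/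
theorem exists_norm_block_evol_le (H : Matrix ι ι ℂ) (E : ι → ℝ) (Δs : ℝ) {P R : Matrix ι ι ℂ}
    (hPR : ∀ s, P * phaseDiag E Δs s * R = 0) :
    ∃ C > 0, ∃ ε > 0, ∀ τ δ : ℝ, |τ| < ε → |δ| < ε →
      ‖P * evol (fun τ : ℝ => (τ : ℂ) • H) E Δs τ δ * R‖ ≤ C * |τ| := by
  obtain ⟨C₁, hC₁, ε₂, hε₂, hexp⟩ := exists_norm_exp_smul_sub_le H
  have h := (contDiff_phaseDiag E Δs).continuous.continuousAt (x := (0 : ℝ)).norm.eventually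
    (Iic_mem_nhds (lt_add_one _))
  obtain ⟨r, hr, hph⟩ := Metric.eventually_nhds_iff.mp h
  refine ⟨‖P‖ * (C₁ * (‖phaseDiag E Δs 0‖ + 1)) * ‖R‖ + 1, by positivity, min ε₂ (r / 2),
    by positivity, fun τ δ hτ hδ => ?_⟩
  simp only [lt_min_iff] at hτ hδ
  have hs : ‖phaseDiag E Δs (δ - τ)‖ ≤ ‖phaseDiag E Δs 0‖ + 1 := hph (by
    rw [Real.dist_0_eq_abs]
    linarith [abs_sub δ τ, hτ.2, hδ.2])
  have hbd := (hexp τ hτ.1).1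
  rw [evol]
  specialize hPR (δ - τ)
  generalize NormedSpace.exp ((-Complex.I) • ((τ : ℂ) • H)) = X at *
  generalize phaseDiag E Δs (δ - τ) = Y at *
  -- The identity part of the exponential leaves the diagonal phase, which has no component in this
  -- block; what remains is `X - 1 = O(τ)`.
  have hdec : P * (X * Y) * R = P * ((X - 1) * Y) * R := by
    rw [sub_mul, one_mul, mul_sub, sub_mul, hPR, sub_zero]
  rw [hdec]
  calc ‖P * ((X - 1) * Y) * R‖ ≤ ‖P‖ * (‖X - 1‖ * ‖Y‖) * ‖R‖ :=
        (norm_mul_le _ _).trans (mul_le_mul_of_nonneg_right ((norm_mul_le _ _).trans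
          (mul_le_mul_of_nonneg_left (norm_mul_le _ _) (norm_nonneg _))) (norm_nonneg _))
    _ ≤ ‖P‖ * (C₁ * |τ| * (‖phaseDiag E Δs 0‖ + 1)) * ‖R‖ := by gcongr
    _ ≤ (‖P‖ * (C₁ * (‖phaseDiag E Δs 0‖ + 1)) * ‖R‖ + 1) * |τ| := by
        nlinarith [abs_nonneg τ]

theorem coProj_mul_phaseDiag_mul (s : ℝ) :
    coProj x y * phaseDiag E Δs s * (1 - coProj x y) = 0 := by
  rw [one_sub_coProj, coProj, phaseDiag, diagonal_mul_diagonal, diagonal_mul_diagonal,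
    ← diagonal_zero]
  congr 1; ext z; split_ifs <;> simp

theorem one_sub_coProj_mul_phaseDiag_mul (s : ℝ) :
    (1 - coProj x y) * phaseDiag E Δs s * coProj x y = 0 := by
  rw [one_sub_coProj, coProj, phaseDiag, diagonal_mul_diagonal, diagonal_mul_diagonal,
    ← diagonal_zero]
  congr 1; ext z; split_ifs <;> simp

theorem exists_inverse_reducedDenom_bounds (hl₀ : l₀ = Complex.exp (-Complex.I * Δs * E x))
    (hother : ∀ z, z ≠ x → z ≠ y → Complex.exp (-Complex.I * Δs * E z) ≠ l₀) :
    ∃ C > 0, ∃ ε > 0, ∀ (τ δ : ℝ) (l : ℂ), |τ| < ε → |δ| < ε → ‖l - l₀‖ < ε →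
      IsUnit (reducedDenom (coProj x y) (evol (fun τ : ℝ => (τ : ℂ) • H) E Δs τ δ) l) ∧
      ‖Ring.inverse (reducedDenom (coProj x y) (evol (fun τ : ℝ => (τ : ℂ) • H) E Δs τ δ) l)‖ ≤ C ∧
      ‖evol (fun τ : ℝ => (τ : ℂ) • H) E Δs τ δ‖ ≤ C := by
  have hN0 := isUnit_reducedDenom_base (H := H) hl₀ hother
  have hcN := (contDiff_reducedDenom (E := E) (Δs := Δs) (contDiff_ofReal_smul H)
    (coProj x y)).continuous
  have hcU := (contDiff_evol (E := E) (Δs := Δs) (contDiff_ofReal_smul H)).continuous.comp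
      (continuous_fst.prodMk (continuous_fst.comp continuous_snd) :
        Continuous fun p : ℝ × ℝ × ℂ => (p.1, p.2.1))
  generalize evol (fun τ : ℝ => (τ : ℂ) • H) E Δs = U at *
  generalize coProj x y = q at *
  have e1 : ∀ᶠ p : ℝ × ℝ × ℂ in 𝓝 (0, 0, l₀), IsUnit (reducedDenom q (U p.1 p.2.1) p.2.2) :=
    hcN.continuousAt.eventually (Units.isOpen.mem_nhds hN0)
  have hcR : ContinuousAt (fun p : ℝ × ℝ × ℂ => Ring.inverse (reducedDenom q (U p.1 p.2.1) p.2.2))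
      (0, 0, l₀) := by
    obtain ⟨u, hu⟩ := hN0
    refine ContinuousAt.comp (g := Ring.inverse) ?_ hcN.continuousAt
    rw [← hu]
    exact NormedRing.inverse_continuousAt u
  have e2 := hcR.norm.eventually (Iic_mem_nhds (lt_add_one _))
  have e3 := hcU.continuousAt (x := ((0 : ℝ), (0 : ℝ), l₀)).norm.eventually
    (Iic_mem_nhds (lt_add_one _))
  obtain ⟨ε₁, hε₁, hb⟩ := exists_forall_of_eventually (P := fun τ δ l =>
    IsUnit (reducedDenom q (U τ δ) l) ∧
    ‖Ring.inverse (reducedDenom q (U τ δ) l)‖ ≤ ‖Ring.inverse (reducedDenom q (U 0 0) l₀)‖ + 1 ∧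
    ‖U τ δ‖ ≤ ‖U 0 0‖ + 1) (e1.and (e2.and e3))
  refine ⟨‖Ring.inverse (reducedDenom q (U 0 0) l₀)‖ + 1 + (‖U 0 0‖ + 1), by positivity, ε₁, hε₁,
    fun τ δ l hτ hδ hl => ?_⟩
  obtain ⟨b1, b2, b3⟩ := hb τ δ l hτ hδ hl
  exact ⟨b1, by linarith [norm_nonneg (U 0 0)],
    by linarith [norm_nonneg (Ring.inverse (reducedDenom q (U 0 0) l₀))]⟩

theorem exists_reducedDenom_bounds (hl₀ : l₀ = Complex.exp (-Complex.I * Δs * E x))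
    (hother : ∀ z, z ≠ x → z ≠ y → Complex.exp (-Complex.I * Δs * E z) ≠ l₀) :
    ∃ C > 0, ∃ ε > 0, ∀ (τ δ : ℝ) (l : ℂ), |τ| < ε → |δ| < ε → ‖l - l₀‖ < ε →
      IsUnit (reducedDenom (coProj x y) (evol (fun τ : ℝ => (τ : ℂ) • H) E Δs τ δ) l) ∧
      ‖Ring.inverse (reducedDenom (coProj x y) (evol (fun τ : ℝ => (τ : ℂ) • H) E Δs τ δ) l)‖ ≤ C ∧
      ‖evol (fun τ : ℝ => (τ : ℂ) • H) E Δs τ δ‖ ≤ C ∧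
      ‖coProj x y * evol (fun τ : ℝ => (τ : ℂ) • H) E Δs τ δ * (1 - coProj x y)‖ ≤ C * |τ| ∧
      ‖(1 - coProj x y) * evol (fun τ : ℝ => (τ : ℂ) • H) E Δs τ δ * coProj x y‖ ≤ C * |τ| := by
  obtain ⟨C₁, hC₁, ε₁, hε₁, h₁⟩ := exists_inverse_reducedDenom_bounds (H := H) hl₀ hother
  obtain ⟨C₂, hC₂, ε₂, hε₂, h₂⟩ := exists_norm_block_evol_le H E Δs
    (coProj_mul_phaseDiag_mul (x := x) (y := y))
  obtain ⟨C₃, hC₃, ε₃, hε₃, h₃⟩ := exists_norm_block_evol_le H E Δs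
    (one_sub_coProj_mul_phaseDiag_mul (x := x) (y := y))
  refine ⟨C₁ + C₂ + C₃, by positivity, min ε₁ (min ε₂ ε₃), by positivity,
    fun τ δ l hτ hδ hl => ?_⟩
  simp only [lt_min_iff] at hτ hδ hl
  obtain ⟨b1, b2, b3⟩ := h₁ τ δ l hτ.1 hδ.1 hl.1
  refine ⟨b1, by linarith, by linarith, (h₂ τ δ hτ.2.1 hδ.2.1).trans ?_,
    (h₃ τ δ hτ.2.2 hδ.2.2).trans ?_⟩
  · gcongr; linarith
  · gcongr; linarith

theorem norm_apply_le_norm_compression (A : Matrix ι ι ℂ) {a c : ι} (ha : a = x ∨ a = y)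
    (hc : c = x ∨ c = y) : ‖A a c‖ ≤ ‖(1 - coProj x y) * A * (1 - coProj x y)‖ := by
  have h := norm_apply_le_norm ((1 - coProj x y) * A * (1 - coProj x y)) a c
  rwa [one_sub_coProj_mul_mul_apply A ha hc] at h

/-- The effective matrix depends weakly on the spectral parameter. -/
theorem exists_effMatrix_sub_le (hl₀ : l₀ = Complex.exp (-Complex.I * Δs * E x))
    (hother : ∀ z, z ≠ x → z ≠ y → Complex.exp (-Complex.I * Δs * E z) ≠ l₀) :
    ∃ C > 0, ∃ ε > 0, ∀ (τ δ : ℝ) (l l' : ℂ), |τ| < ε → |δ| < ε → ‖l - l₀‖ < ε → ‖l' - l₀‖ < ε →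
      ∀ a c, (a = x ∨ a = y) → (c = x ∨ c = y) →
        ‖effMatrix H E Δs x y τ δ l a c - effMatrix H E Δs x y τ δ l' a c‖ ≤
          C * |τ| * ‖l - l'‖ := by
  obtain ⟨C, hC, ε, hε, hb⟩ := exists_reducedDenom_bounds (H := H) hl₀ hother
  refine ⟨‖1 - coProj x y‖ * (C * (C * C)) * C + 1, by positivity, ε, hε, ?_⟩
  intro τ δ l l' hτ hδ hl hl' a c ha hc
  obtain ⟨u1, r1, n1, o1, -⟩ := hb τ δ l hτ hδ hl
  obtain ⟨u2, r2, -, -, -⟩ := hb τ δ l' hτ hδ hl'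
  rw [← Matrix.sub_apply, effMatrix, effMatrix, feshbach_sub_feshbach u1 u2, Matrix.smul_apply,
    norm_smul, norm_sub_rev l' l, mul_comm]
  gcongr
  refine (norm_apply_le_norm_compression _ ha hc).trans ?_
  generalize evol (fun τ : ℝ => (τ : ℂ) • H) E Δs τ δ = U at *
  generalize Ring.inverse (reducedDenom (coProj x y) U l) = R at *
  generalize Ring.inverse (reducedDenom (coProj x y) U l') = R' at *
  -- Isolates one off-diagonal block of `U`, which supplies the single factor `|τ|` that is needed.
  have e : (1 - coProj x y) * (U * (R * R') * coProj x y * U) * (1 - coProj x y) =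
      (1 - coProj x y) * (U * (R * R')) * (coProj x y * U * (1 - coProj x y)) := by
    simp only [mul_assoc]
  rw [e]
  calc ‖(1 - coProj x y) * (U * (R * R')) * (coProj x y * U * (1 - coProj x y))‖
      ≤ ‖1 - coProj x y‖ * (C * (C * C)) * (C * |τ|) := by
        refine (norm_mul_le _ _).trans ?_
        gcongr
        refine (norm_mul_le _ _).trans ?_
        gcongr
        refine (norm_mul_le _ _).trans ?_
        gcongr
        refine (norm_mul_le _ _).trans ?_
        gcongr
    _ ≤ (‖1 - coProj x y‖ * (C * (C * C)) * C + 1) * |τ| := by nlinarith [abs_nonneg τ]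

/-- Separates direct evolution from excursions through the other states. Inserting a second
projection places the reduced resolvent between two off-diagonal blocks, each `O(τ)`, so the
excursions are of second order. -/
theorem effMatrix_apply_self (hN : IsUnit (reducedDenom (coProj x y)
      (evol (fun τ : ℝ => (τ : ℂ) • H) E Δs τ δ) l)) {a : ι} (ha : a = x ∨ a = y) :
    effMatrix H E Δs x y τ δ l a a =
      NormedSpace.exp ((-Complex.I) • ((τ : ℂ) • H)) a a *
        Complex.exp (-Complex.I * (Δs + (δ - τ : ℝ)) * E a) +
      ((1 - coProj x y) * evol (fun τ : ℝ => (τ : ℂ) • H) E Δs τ δ * coProj x y *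
        Ring.inverse (reducedDenom (coProj x y) (evol (fun τ : ℝ => (τ : ℂ) • H) E Δs τ δ) l) *
        (coProj x y * evol (fun τ : ℝ => (τ : ℂ) • H) E Δs τ δ * (1 - coProj x y))) a a := by
  rw [effMatrix, feshbach, Matrix.add_apply]
  congr 1
  · rw [evol, phaseDiag, mul_diagonal]
  · refine (one_sub_coProj_mul_mul_apply (x := x) (y := y) _ ha ha).symm.trans
      (congrFun (congrFun ?_ a) a)
    have hc := mul_inverse_reducedDenom (coProj_mul_self x y) hN
    simp only [mul_assoc]
    rw [← mul_assoc (coProj x y) (Ring.inverse _), hc, mul_assoc (Ring.inverse _),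
      ← mul_assoc (coProj x y) (coProj x y), coProj_mul_self]

/-- First-order expansion of the diagonal elements of the effective matrix. -/
theorem exists_effMatrix_diag_sub_le (hl₀ : l₀ = Complex.exp (-Complex.I * Δs * E x))
    (hother : ∀ z, z ≠ x → z ≠ y → Complex.exp (-Complex.I * Δs * E z) ≠ l₀) {a : ι}
    (ha : a = x ∨ a = y) (hla : l₀ = Complex.exp (-Complex.I * Δs * E a)) :
    ∃ C > 0, ∃ ε > 0, ∀ (τ δ : ℝ) (l : ℂ), |τ| < ε → |δ| < ε → ‖l - l₀‖ < ε →
      ‖effMatrix H E Δs x y τ δ l a a -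
        l₀ * (1 - Complex.I * (δ * E a + τ * (H a a - E a)))‖ ≤ C * (τ ^ 2 + δ ^ 2) := by
  obtain ⟨C, hC, ε, hε, hb⟩ := exists_reducedDenom_bounds (H := H) hl₀ hother
  obtain ⟨C₁, hC₁, ε₁, hε₁, hexp⟩ := exists_norm_exp_smul_sub_le H
  obtain ⟨C₂, hC₂, ε₂, hε₂, hph⟩ := exists_norm_exp_phase_sub_le Δs (E a)
  refine ⟨(C₁ + 3 * (1 + ‖H a a‖) * C₂ + 3 * ‖H a a‖ * |E a|) + C * C * C, by positivity,
    min ε (min ε₁ (min (ε₂ / 2) 1)), by positivity, ?_⟩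
  intro τ δ l hτ hδ hl
  simp only [lt_min_iff] at hτ hδ hl
  obtain ⟨u1, r1, -, o1, o2⟩ := hb τ δ l hτ.1 hδ.1 hl.1
  have hs : |δ - τ| < ε₂ := by linarith [abs_sub δ τ, hτ.2.2.1, hδ.2.2.1]
  have x1 := (hexp τ hτ.2.1).2
  have x2 := hph _ hs
  rw [← hla] at x2
  have hw : ‖Complex.exp (-Complex.I * (Δs + (δ - τ : ℝ)) * E a)‖ = 1 := by
    have := norm_exp_neg_I_mul_mul (Δs + (δ - τ)) (E a)
    rwa [Complex.ofReal_add] at this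
  have hl₀n : ‖l₀‖ = 1 := by rw [hl₀]; exact norm_exp_neg_I_mul_mul _ _
  rw [effMatrix_apply_self u1 ha]
  generalize Ring.inverse (reducedDenom (coProj x y)
    (evol (fun τ : ℝ => (τ : ℂ) • H) E Δs τ δ) l) = R at *
  generalize evol (fun τ : ℝ => (τ : ℂ) • H) E Δs τ δ = U at *
  have hr1 : ‖NormedSpace.exp ((-Complex.I) • ((τ : ℂ) • H)) a a - 1 + Complex.I * τ * H a a‖ ≤
      C₁ * τ ^ 2 := by
    refine le_trans (le_of_eq ?_) ((norm_apply_le_norm _ a a).trans (x1.trans_eq (by rw [sq_abs])))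
    congr 1
    simp only [Matrix.sub_apply, Matrix.one_apply_eq, Matrix.smul_apply, smul_eq_mul]
    ring
  have hfirst := norm_mul_phase_sub_le hC₁.le hC₂.le hl₀n hw hτ.2.2.2.le hr1 x2
  have hsecond : ‖((1 - coProj x y) * U * coProj x y * R *
      (coProj x y * U * (1 - coProj x y))) a a‖ ≤ C * C * C * (τ ^ 2 + δ ^ 2) := by
    refine (norm_apply_le_norm _ _ _).trans ?_
    calc _ ≤ (C * |τ|) * C * (C * |τ|) :=
          (norm_mul_le _ _).trans (mul_le_mul ((norm_mul_le _ _).trans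
            (mul_le_mul o2 r1 (norm_nonneg _) (by positivity))) o1 (norm_nonneg _) (by positivity))
      _ = C * C * C * τ ^ 2 := by rw [← sq_abs τ]; ring
      _ ≤ _ := by gcongr; linarith [sq_nonneg δ]
  rw [add_sub_right_comm]
  refine (norm_add_le _ _).trans ?_
  rw [add_mul]
  exact add_le_add hfirst hsecond

end Effective

/-! ### The off-diagonal entry, to leading order in `τ`. -/

section OffDiagonal

variable {ι : Type*} [Fintype ι] [DecidableEq ι]
variable {H : Matrix ι ι ℂ} {E : ι → ℝ} {Δs : ℝ} {x y : ι} {l₀ : ℂ} {e : ι → ℕ} {k : ℕ}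

theorem contDiff_gaugedHop (H : Matrix ι ι ℂ) (e : ι → ℕ) : ContDiff ℝ 1 (gaugedHop H e) := by
  refine contDiff_matrix fun i j => ?_
  simp only [gaugedHop, Matrix.of_apply]
  exact ((Complex.ofRealCLM.contDiff (n := 1)).pow _).mul contDiff_const

/-- The gauge relation passes through the exponential, and the gauge commutes with the diagonal
phases. -/
theorem diagonal_mul_evol (he : ∀ z z', H z z' ≠ 0 → e z ≤ e z' + 1) (hle : ∀ z, e z ≤ k)
    (τ δ : ℝ) :
    diagonal (fun z => (τ : ℂ) ^ (k - e z)) * evol (fun τ : ℝ => (τ : ℂ) • H) E Δs τ δ =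
      evol (gaugedHop H e) E Δs τ δ * diagonal (fun z => (τ : ℂ) ^ (k - e z)) := by
  have h1 : SemiconjBy (diagonal (fun z => (τ : ℂ) ^ (k - e z))) ((-Complex.I) • ((τ : ℂ) • H))
      ((-Complex.I) • gaugedHop H e τ) := by
    rw [SemiconjBy, mul_smul_comm, smul_mul_assoc, diagonal_mul_smul_eq_gaugedHop_mul he hle]
  have h2 : diagonal (fun z => (τ : ℂ) ^ (k - e z)) *
      NormedSpace.exp ((-Complex.I) • ((τ : ℂ) • H)) =
      NormedSpace.exp ((-Complex.I) • gaugedHop H e τ) *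
        diagonal (fun z => (τ : ℂ) ^ (k - e z)) := h1.exp_right
  rw [evol, evol, ← mul_assoc, h2, mul_assoc, mul_assoc, phaseDiag, diagonal_mul_diagonal,
    diagonal_mul_diagonal]
  simp only [mul_comm]

theorem isUnit_reducedDenom_gauged_base (hl₀ : l₀ = Complex.exp (-Complex.I * Δs * E x))
    (hother : ∀ z, z ≠ x → z ≠ y → Complex.exp (-Complex.I * Δs * E z) ≠ l₀)
    (he : ∀ z z', H z z' ≠ 0 → e z ≤ e z' + 1) (hle : ∀ z, e z ≤ k) :
    IsUnit (reducedDenom (coProj x y) (evol (gaugedHop H e) E Δs 0 0) l₀) := by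
  rw [evol, phaseDiag_zero]
  exact isUnit_reducedDenom_of_grading (gaugedHop_zero_grading he) hle
    (by rw [hl₀]; exact Complex.exp_ne_zero _) hother

/-- The off-diagonal element of the effective matrix is of order `τ ^ k`. -/
theorem exists_effMatrix_apply_eq (hl₀ : l₀ = Complex.exp (-Complex.I * Δs * E x))
    (hother : ∀ z, z ≠ x → z ≠ y → Complex.exp (-Complex.I * Δs * E z) ≠ l₀)
    (he : ∀ z z', H z z' ≠ 0 → e z ≤ e z' + 1) (hle : ∀ z, e z ≤ k) (hx : e x = k) (hy : e y = 0) :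
    ∃ C > 0, ∃ ε > 0, ∀ (τ δ : ℝ) (l : ℂ), |τ| < ε → |δ| < ε → ‖l - l₀‖ < ε →
      ∃ h : ℂ, effMatrix H E Δs x y τ δ l x y = (τ : ℂ) ^ k * h ∧
        ‖h - feshbach (coProj x y) (evol (gaugedHop H e) E Δs 0 0) l₀ x y‖ ≤
          C * (|τ| + |δ| + ‖l - l₀‖) := by
  obtain ⟨C₁, hC₁, ε₁, hε₁, h₁⟩ := exists_inverse_reducedDenom_bounds (H := H) hl₀ hother
  have hN0 := isUnit_reducedDenom_gauged_base (H := H) hl₀ hother he hle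
  have hcN := (contDiff_reducedDenom (E := E) (Δs := Δs) (contDiff_gaugedHop H e)
    (coProj x y)).continuous
  have e1 : ∀ᶠ p : ℝ × ℝ × ℂ in 𝓝 (0, 0, l₀), IsUnit (reducedDenom (coProj x y)
      (evol (gaugedHop H e) E Δs p.1 p.2.1) p.2.2) :=
    hcN.continuousAt.eventually (Units.isOpen.mem_nhds hN0)
  have hd := (contDiffAt_matrix_apply (contDiffAt_feshbach (contDiff_gaugedHop H e) (coProj x y)
    (p := ((0 : ℝ), (0 : ℝ), l₀)) hN0) x y).differentiableAt one_ne_zero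
  obtain ⟨C, hC, hO⟩ := hd.isBigO_sub.exists_pos
  obtain ⟨ε, hε, hb⟩ := exists_forall_of_eventually (P := fun τ δ l =>
    IsUnit (reducedDenom (coProj x y) (evol (gaugedHop H e) E Δs τ δ) l) ∧
    ‖feshbach (coProj x y) (evol (gaugedHop H e) E Δs τ δ) l x y -
      feshbach (coProj x y) (evol (gaugedHop H e) E Δs 0 0) l₀ x y‖ ≤
        C * ‖((τ, δ, l) : ℝ × ℝ × ℂ) - (0, 0, l₀)‖) (e1.and hO.bound)
  refine ⟨C, hC, min ε ε₁, by positivity, fun τ δ l hτ hδ hl => ?_⟩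
  simp only [lt_min_iff] at hτ hδ hl
  obtain ⟨u', hbd⟩ := hb τ δ l hτ.1 hδ.1 hl.1
  obtain ⟨u, -, -⟩ := h₁ τ δ l hτ.2 hδ.2 hl.2
  refine ⟨feshbach (coProj x y) (evol (gaugedHop H e) E Δs τ δ) l x y, ?_, hbd.trans ?_⟩
  · have hTq : diagonal (fun z => (τ : ℂ) ^ (k - e z)) * coProj x y =
        coProj x y * diagonal (fun z => (τ : ℂ) ^ (k - e z)) := by
      rw [coProj, diagonal_mul_diagonal, diagonal_mul_diagonal]
      simp only [mul_comm]
    -- The gauge factor is `τ ^ 0` at `x` and `τ ^ k` at `y`; comparing the `x y` entries extracts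
    -- `τ ^ k`. Since no inverse of the gauge is used, `τ = 0` is included.
    have h := mul_feshbach_of_intertwine (diagonal_mul_evol he hle τ δ) hTq u u'
    have h' := congrFun (congrFun h x) y
    rw [diagonal_mul, mul_diagonal, hx, hy, Nat.sub_self, pow_zero, one_mul, Nat.sub_zero] at h'
    rw [effMatrix, h', mul_comm]
  · gcongr
    rw [Prod.norm_def, Prod.norm_def]
    simp only [Prod.fst_sub, Prod.snd_sub, sub_zero, Real.norm_eq_abs]
    refine max_le ?_ (max_le ?_ ?_) <;> linarith [abs_nonneg τ, abs_nonneg δ, norm_nonneg (l - l₀)]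

end OffDiagonal

/-! ### From the effective matrix to the gap of the two eigenvalues. -/

section Crossing

variable {ι : Type*}

/-- The linear phase of the state `a`. -/
noncomputable def linPhase (H : Matrix ι ι ℂ) (E : ι → ℝ) (τ δ : ℝ) (a : ι) : ℝ :=
  δ * E a + τ * ((H a a).re - E a)

theorem linPhase_abs_le (H : Matrix ι ι ℂ) (E : ι → ℝ) (a : ι) (τ δ : ℝ) :
    |linPhase H E τ δ a| ≤ (|E a| + |(H a a).re - E a|) * (|τ| + |δ|) := by
  rw [linPhase]
  refine (abs_add_le _ _).trans ?_
  rw [abs_mul, abs_mul]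
  nlinarith [mul_nonneg (abs_nonneg τ) (abs_nonneg (E a)),
    mul_nonneg (abs_nonneg δ) (abs_nonneg ((H a a).re - E a))]

variable [Fintype ι] [DecidableEq ι]

/-- The data of a pair of resonant states `x, y` with a grading `e` of the states by their distance
from `y`. -/
structure Resonant (H : Matrix ι ι ℂ) (E : ι → ℝ) (Δs : ℝ) (x y : ι) (l₀ : ℂ) (e : ι → ℕ) (k : ℕ) :
    Prop where
  herm : Hᴴ = H
  ne : x ≠ y
  phase_x : l₀ = Complex.exp (-Complex.I * Δs * E x)
  phase_y : l₀ = Complex.exp (-Complex.I * Δs * E y)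
  phase_ne : ∀ z, z ≠ x → z ≠ y → Complex.exp (-Complex.I * Δs * E z) ≠ l₀
  grade : ∀ z z', H z z' ≠ 0 → e z ≤ e z' + 1
  grade_le : ∀ z, e z ≤ k
  grade_x : e x = k
  grade_y : e y = 0
  pos : 0 < k

/-- The leading coefficient of the off-diagonal element of the effective matrix. -/
noncomputable def offCoeff (H : Matrix ι ι ℂ) (E : ι → ℝ) (Δs : ℝ) (x y : ι) (l₀ : ℂ) (e : ι → ℕ) :
    ℂ :=
  feshbach (coProj x y) (evol (gaugedHop H e) E Δs 0 0) l₀ x y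

/-- The bounds on the effective matrix at the parameters `τ, δ`. -/
structure EffBounds (H : Matrix ι ι ℂ) (E : ι → ℝ) (Δs : ℝ) (x y : ι) (l₀ : ℂ) (e : ι → ℕ) (k : ℕ)
    (C ε τ δ : ℝ) : Prop where
  isUnit : ∀ l, ‖l - l₀‖ < ε →
    IsUnit (reducedDenom (coProj x y) (evol (fun τ : ℝ => (τ : ℂ) • H) E Δs τ δ) l)
  diag : ∀ l, ‖l - l₀‖ < ε → ∀ a, (a = x ∨ a = y) →
    ‖effMatrix H E Δs x y τ δ l a a - l₀ * (1 - Complex.I * linPhase H E τ δ a)‖ ≤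
      C * (τ ^ 2 + δ ^ 2)
  lip : ∀ l l', ‖l - l₀‖ < ε → ‖l' - l₀‖ < ε → ∀ a c, (a = x ∨ a = y) → (c = x ∨ c = y) →
    ‖effMatrix H E Δs x y τ δ l a c - effMatrix H E Δs x y τ δ l' a c‖ ≤ C * |τ| * ‖l - l'‖
  off : ∀ l, ‖l - l₀‖ < ε → ∃ h : ℂ, effMatrix H E Δs x y τ δ l x y = (τ : ℂ) ^ k * h ∧
    ‖h - offCoeff H E Δs x y l₀ e‖ ≤ C * (|τ| + |δ| + ‖l - l₀‖)

variable {H : Matrix ι ι ℂ} {E : ι → ℝ} {Δs : ℝ} {x y : ι} {l₀ : ℂ} {e : ι → ℕ} {k : ℕ}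

theorem Resonant.exists_effBounds (R : Resonant H E Δs x y l₀ e k) :
    ∃ C > 0, ∃ ε > 0, ∀ τ δ : ℝ, |τ| < ε → |δ| < ε →
      EffBounds H E Δs x y l₀ e k C ε τ δ := by
  obtain ⟨C₁, -, ε₁, hε₁, h₁⟩ := exists_inverse_reducedDenom_bounds (H := H) R.phase_x R.phase_ne
  obtain ⟨C₂, hC₂, ε₂, hε₂, h₂⟩ := exists_effMatrix_diag_sub_le (H := H) R.phase_x R.phase_ne
    (Or.inl rfl) R.phase_x
  obtain ⟨C₃, hC₃, ε₃, hε₃, h₃⟩ := exists_effMatrix_diag_sub_le (H := H) R.phase_x R.phase_ne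
    (Or.inr rfl) R.phase_y
  obtain ⟨C₄, hC₄, ε₄, hε₄, h₄⟩ := exists_effMatrix_sub_le (H := H) R.phase_x R.phase_ne
  obtain ⟨C₅, hC₅, ε₅, hε₅, h₅⟩ := exists_effMatrix_apply_eq R.phase_x R.phase_ne R.grade R.grade_le
    R.grade_x R.grade_y
  have hreal : ∀ a, H a a = ((H a a).re : ℂ) := fun a => by
    have := congrFun (congrFun R.herm a) a
    rw [conjTranspose_apply, Complex.star_def] at this
    exact (Complex.conj_eq_iff_re.mp this).symm
  refine ⟨C₂ + C₃ + C₄ + C₅, by positivity, min ε₁ (min ε₂ (min ε₃ (min ε₄ ε₅))), by positivity,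
    fun τ δ hτ hδ => ?_⟩
  simp only [lt_min_iff] at hτ hδ
  refine ⟨fun l hl => ?_, fun l hl a ha => ?_, fun l l' hl hl' a c ha hc => ?_, fun l hl => ?_⟩
  · simp only [lt_min_iff] at hl
    exact (h₁ τ δ l hτ.1 hδ.1 hl.1).1
  · simp only [lt_min_iff] at hl
    have hlin : (linPhase H E τ δ a : ℂ) = δ * E a + τ * (H a a - E a) := by
      conv_rhs => rw [hreal a]
      rw [linPhase]; push_cast; rfl
    rw [hlin]
    rcases ha with rfl | rfl
    · refine (h₂ τ δ l hτ.2.1 hδ.2.1 hl.2.1).trans ?_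
      gcongr; linarith
    · refine (h₃ τ δ l hτ.2.2.1 hδ.2.2.1 hl.2.2.1).trans ?_
      gcongr; linarith
  · simp only [lt_min_iff] at hl hl'
    refine (h₄ τ δ l l' hτ.2.2.2.1 hδ.2.2.2.1 hl.2.2.2.1 hl'.2.2.2.1 a c ha hc).trans ?_
    gcongr; linarith
  · simp only [lt_min_iff] at hl
    obtain ⟨h, e1, e2⟩ := h₅ τ δ l hτ.2.2.2.2 hδ.2.2.2.2 hl.2.2.2.2
    refine ⟨h, e1, e2.trans ?_⟩
    gcongr; linarith

/-- Near the resonance exactly two eigenvalues lie in a small disc about `l₀`. -/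
theorem Resonant.exists_eigenpair (R : Resonant H E Δs x y l₀ e k) {ρ : ℝ} (hρ : 0 < ρ)
    (hw : ∀ z, z ≠ x → z ≠ y → 2 * ρ ≤ ‖Complex.exp (-Complex.I * Δs * E z) - l₀‖) :
    ∃ ε > 0, ∀ τ δ : ℝ, |τ| < ε → |δ| < ε →
      ∃ (d₁ d₂ : ℂ) (v₁ v₂ : ι → ℂ),
        (evol (fun τ : ℝ => (τ : ℂ) • H) E Δs τ δ).charpoly.roots.filter (fun d => ‖d - l₀‖ < ρ) =
          {d₁, d₂} ∧
        evol (fun τ : ℝ => (τ : ℂ) • H) E Δs τ δ *ᵥ v₁ = d₁ • v₁ ∧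
        evol (fun τ : ℝ => (τ : ℂ) • H) E Δs τ δ *ᵥ v₂ = d₂ • v₂ ∧
        ‖d₁ - l₀‖ < ρ ∧ ‖d₂ - l₀‖ < ρ ∧
        (∀ z, ‖v₁ z‖ ≤ 1) ∧ (∀ z, ‖v₂ z‖ ≤ 1) ∧ 1 / 2 ≤ ‖v₁ x * v₂ y - v₁ y * v₂ x‖ := by
  set n : ℝ := (Fintype.card ι : ℝ) with hn
  have hn0 : 0 ≤ n := Nat.cast_nonneg _
  -- With this choice `n² (κ / ρ)² ≤ 1/16`, which is below the threshold `1/8` of the counting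
  -- argument.
  set κ := ρ / (4 * (n + 1)) with hκ
  have hκpos : 0 < κ := by positivity
  have hc := (contDiff_evol (E := E) (Δs := Δs) (contDiff_ofReal_smul H)).continuous.continuousAt
    (x := ((0 : ℝ), (0 : ℝ)))
  obtain ⟨ε, hε, hb⟩ := Metric.continuousAt_iff.mp hc κ hκpos
  refine ⟨ε, hε, fun τ δ hτ hδ => ?_⟩
  have hd := hb (x := (τ, δ)) (by
    rw [Prod.dist_eq, Real.dist_0_eq_abs, Real.dist_0_eq_abs]; exact max_lt hτ hδ)
  have hzero : evol (fun τ : ℝ => (τ : ℂ) • H) E Δs 0 0 =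
      diagonal fun z => Complex.exp (-Complex.I * Δs * E z) := by
    rw [evol, phaseDiag_zero]; simp
  rw [dist_eq_norm] at hd
  simp only [hzero] at hd
  have hherm : ((τ : ℂ) • H)ᴴ = (τ : ℂ) • H := by
    rw [conjTranspose_smul, R.herm, Complex.star_def, Complex.conj_ofReal]
  refine exists_eigenpair_of_close (evol_unitary hherm δ) R.ne R.phase_x.symm R.phase_y.symm hρ hw
    (κ := κ) (fun v hv z => (norm_mulVec_apply_le _ hv z).trans hd.le) ?_
  have h1 : κ / ρ = 1 / (4 * (n + 1)) := by rw [hκ]; field_simp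
  rw [h1, ← hn, div_pow, mul_pow, ← mul_div_assoc, div_le_div_iff₀ (by positivity) (by norm_num)]
  nlinarith

open scoped ComplexOrder in
theorem norm_eq_one_of_mulVec_eq {U : Matrix ι ι ℂ} (hU : Uᴴ * U = 1) {l : ℂ} {v : ι → ℂ}
    (hv : U *ᵥ v = l • v) (hne : v ≠ 0) : ‖l‖ = 1 := by
  have h1 : star (U *ᵥ v) ⬝ᵥ (U *ᵥ v) = star v ⬝ᵥ v := by
    rw [star_mulVec, dotProduct_mulVec, vecMul_vecMul, hU, vecMul_one]
  rw [hv, star_smul, smul_dotProduct, dotProduct_smul, smul_smul] at h1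
  have h2 : star v ⬝ᵥ v ≠ 0 := by
    rw [Ne, dotProduct_star_self_eq_zero]; exact hne
  have h3 : star l * l = 1 := mul_right_cancel₀ h2 (by rw [one_mul]; exact h1)
  rw [Complex.star_def, Complex.conj_mul'] at h3
  have h4 : ‖l‖ ^ 2 = 1 := by exact_mod_cast h3
  nlinarith [norm_nonneg l]

theorem evol_smul_unitary (hH : Hᴴ = H) (τ δ : ℝ) :
    (evol (fun τ : ℝ => (τ : ℂ) • H) E Δs τ δ)ᴴ * evol (fun τ : ℝ => (τ : ℂ) • H) E Δs τ δ = 1 :=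
  evol_unitary (A := fun τ : ℝ => (τ : ℂ) • H) (by
    rw [conjTranspose_smul, hH, Complex.star_def, Complex.conj_ofReal]) δ

theorem effMatrix_mulVec {τ δ : ℝ} {l : ℂ} (hxy : x ≠ y)
    (hN : IsUnit (reducedDenom (coProj x y) (evol (fun τ : ℝ => (τ : ℂ) • H) E Δs τ δ) l))
    {v : ι → ℂ} (hv : evol (fun τ : ℝ => (τ : ℂ) • H) E Δs τ δ *ᵥ v = l • v) (a : ι) :
    effMatrix H E Δs x y τ δ l a x * v x + effMatrix H E Δs x y τ δ l a y * v y = l * v a := by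
  rw [← mulVec_one_sub_coProj_mulVec hxy, effMatrix,
    feshbach_mulVec_of_eigenvector (coProj_mul_self x y) hN hv]
  rfl

/-- The relations of a unitary 2×2 matrix for the effective matrix. -/
theorem effMatrix_unitary (hH : Hᴴ = H) (hxy : x ≠ y) {τ δ : ℝ} {l : ℂ} (hl : ‖l‖ = 1)
    (hN : IsUnit (reducedDenom (coProj x y) (evol (fun τ : ℝ => (τ : ℂ) • H) E Δs τ δ) l)) :
    ‖effMatrix H E Δs x y τ δ l x x‖ ^ 2 + ‖effMatrix H E Δs x y τ δ l y x‖ ^ 2 = 1 ∧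
    ‖effMatrix H E Δs x y τ δ l x y‖ ^ 2 + ‖effMatrix H E Δs x y τ δ l y y‖ ^ 2 = 1 ∧
    starRingEnd ℂ (effMatrix H E Δs x y τ δ l x x) * effMatrix H E Δs x y τ δ l x y +
      starRingEnd ℂ (effMatrix H E Δs x y τ δ l y x) * effMatrix H E Δs x y τ δ l y y = 0 := by
  have hU := evol_smul_unitary (E := E) (Δs := Δs) hH τ δ
  refine ⟨feshbach_norm_sq_add hxy hU hl hN (Or.inl rfl),
    feshbach_norm_sq_add hxy hU hl hN (Or.inr rfl), ?_⟩
  have := feshbach_gram hxy hU hl hN (Or.inl rfl) (Or.inr rfl)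
  rwa [Matrix.one_apply_ne hxy] at this

end Crossing

/-- The bounds on the gap `g` near a crossing: `α` and `β` stand for the diagonal difference and
the off-diagonal element of an effective 2×2 matrix. -/
def GapBound (C e D c : ℝ) (k : ℕ) (τ δ g α : ℝ) : Prop :=
  0 ≤ g ∧ 0 ≤ α ∧ |α - (|e * δ + D * τ|)| ≤ C * (τ ^ 2 + δ ^ 2) ∧
    ∃ β, 0 ≤ β ∧ |β - c * |τ| ^ k| ≤ C * |τ| ^ k * (|τ| + |δ|) ∧
      |√(α ^ 2 + 4 * β ^ 2) - g| ≤ C * |τ| * g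

theorem Resonant.norm_phase {ι : Type*} {H : Matrix ι ι ℂ} {E : ι → ℝ} {Δs : ℝ} {x y : ι} {l₀ : ℂ}
    {e : ι → ℕ} {k : ℕ} (R : Resonant H E Δs x y l₀ e k) : ‖l₀‖ = 1 := by
  rw [R.phase_x]; exact norm_exp_neg_I_mul_mul _ _

section Crossing

variable {ι : Type*} [Fintype ι] [DecidableEq ι]
variable {H : Matrix ι ι ℂ} {E : ι → ℝ} {Δs : ℝ} {x y : ι} {l₀ : ℂ} {e : ι → ℕ} {k : ℕ}

/-- The sum of the sizes of the first-order coefficients. -/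
noncomputable def slope (H : Matrix ι ι ℂ) (E : ι → ℝ) (x y : ι) : ℝ :=
  |E x| + |(H x x).re - E x| + (|E y| + |(H y y).re - E y|)

variable {C ε τ δ : ℝ}

theorem EffBounds.norm_diag_sub_le (hC : 0 ≤ C) (B : EffBounds H E Δs x y l₀ e k C ε τ δ)
    (hl₀ : ‖l₀‖ = 1) (hτ : |τ| ≤ 1) (hδ : |δ| ≤ 1) {l : ℂ} (hl : ‖l - l₀‖ < ε) {a : ι}
    (ha : a = x ∨ a = y) :
    ‖effMatrix H E Δs x y τ δ l a a - l₀‖ ≤ (C + slope H E x y) * (|τ| + |δ|) := by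
  have h1 := B.diag l hl a ha
  have h2 := linPhase_abs_le H E a τ δ
  have h3 : |E a| + |(H a a).re - E a| ≤ slope H E x y := by
    rw [slope]
    rcases ha with rfl | rfl
    · linarith [abs_nonneg (E y), abs_nonneg ((H y y).re - E y)]
    · linarith [abs_nonneg (E x), abs_nonneg ((H x x).re - E x)]
  have h4 : τ ^ 2 + δ ^ 2 ≤ |τ| + |δ| := by
    rw [← sq_abs τ, ← sq_abs δ]
    nlinarith [abs_nonneg τ, abs_nonneg δ]
  have heq : effMatrix H E Δs x y τ δ l a a - l₀ =
      (effMatrix H E Δs x y τ δ l a a - l₀ * (1 - Complex.I * linPhase H E τ δ a)) -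
        l₀ * Complex.I * linPhase H E τ δ a := by ring
  rw [heq]
  refine (norm_sub_le _ _).trans ?_
  rw [norm_mul, norm_mul, hl₀, Complex.norm_I, Complex.norm_real, Real.norm_eq_abs, one_mul, one_mul,
    add_mul]
  have h0 : 0 ≤ |τ| + |δ| := by positivity
  exact add_le_add (h1.trans (by gcongr)) (h2.trans (by gcongr))

theorem EffBounds.norm_off_le (hC : 0 ≤ C) (B : EffBounds H E Δs x y l₀ e k C ε τ δ) (hε : ε ≤ 1)
    (hτ : |τ| ≤ 1) (hδ : |δ| ≤ 1) {l : ℂ} (hl : ‖l - l₀‖ < ε) :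
    ‖effMatrix H E Δs x y τ δ l x y‖ ≤ (‖offCoeff H E Δs x y l₀ e‖ + 3 * C) * |τ| ^ k := by
  obtain ⟨h, h1, h2⟩ := B.off l hl
  rw [h1, norm_mul, norm_pow, Complex.norm_real, Real.norm_eq_abs, mul_comm]
  gcongr
  have h3 : ‖h‖ ≤ ‖offCoeff H E Δs x y l₀ e‖ + ‖h - offCoeff H E Δs x y l₀ e‖ := by
    have := norm_add_le (offCoeff H E Δs x y l₀ e) (h - offCoeff H E Δs x y l₀ e)
    rwa [add_sub_cancel] at this
  have h4 : C * (|τ| + |δ| + ‖l - l₀‖) ≤ C * 3 := by gcongr; linarith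
  linarith

/-- The gauge by distance to `y` controls only the `x y` entry; unitarity carries the bound over to
the `y x` entry. -/
theorem norm_effMatrix_yx (hH : Hᴴ = H) (hxy : x ≠ y) {l : ℂ} (hl : ‖l‖ = 1)
    (hN : IsUnit (reducedDenom (coProj x y) (evol (fun τ : ℝ => (τ : ℂ) • H) E Δs τ δ) l)) :
    ‖effMatrix H E Δs x y τ δ l y x‖ = ‖effMatrix H E Δs x y τ δ l x y‖ := by
  obtain ⟨u1, u2, u3⟩ := effMatrix_unitary hH hxy hl hN
  obtain ⟨D, hD, -, h⟩ := exists_norm_one_of_unitary u1 u2 u3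
  rw [h, norm_neg, norm_mul, hD, mul_one, RCLike.norm_conj]

/-- Eigenvalues near `l₀` depend in a Lipschitz way on the parameters. -/
theorem EffBounds.norm_eigenvalue_sub_le (R : Resonant H E Δs x y l₀ e k) (hC : 0 ≤ C)
    (B : EffBounds H E Δs x y l₀ e k C ε τ δ) (hε : ε ≤ 1)
    (hτ : |τ| ≤ 1) (hδ : |δ| ≤ 1) {l : ℂ} (hl : ‖l - l₀‖ < ε) {v : ι → ℂ}
    (hv : evol (fun τ : ℝ => (τ : ℂ) • H) E Δs τ δ *ᵥ v = l • v) (hne : v x ≠ 0 ∨ v y ≠ 0) :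
    ‖l - l₀‖ ≤ 2 * ((C + slope H E x y + (‖offCoeff H E Δs x y l₀ e‖ + 3 * C)) * (|τ| + |δ|)) := by
  have hv0 : v ≠ 0 := by rintro rfl; simp at hne
  have hl1 : ‖l‖ = 1 := norm_eq_one_of_mulVec_eq (evol_smul_unitary R.herm τ δ) hv hv0
  have hN := B.isUnit l hl
  have e1 := effMatrix_mulVec R.ne hN hv x
  have e2 := effMatrix_mulVec R.ne hN hv y
  have hs : 0 ≤ slope H E x y := by rw [slope]; positivity
  have hoff := B.norm_off_le hC hε hτ hδ hl
  have hk : |τ| ^ k ≤ |τ| + |δ| := by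
    have : |τ| ^ k ≤ |τ| ^ 1 := pow_le_pow_of_le_one (abs_nonneg τ) hτ R.pos
    rw [pow_one] at this
    linarith [abs_nonneg δ]
  have h0 : 0 ≤ |τ| + |δ| := by positivity
  have hoff' : ‖effMatrix H E Δs x y τ δ l x y‖ ≤
      (C + slope H E x y + (‖offCoeff H E Δs x y l₀ e‖ + 3 * C)) * (|τ| + |δ|) := by
    refine hoff.trans ?_
    have : (‖offCoeff H E Δs x y l₀ e‖ + 3 * C) * |τ| ^ k ≤
      (‖offCoeff H E Δs x y l₀ e‖ + 3 * C) * (|τ| + |δ|) := by gcongr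
    nlinarith [mul_nonneg (add_nonneg hC hs) h0]
  have hdiag : ∀ a, (a = x ∨ a = y) → ‖effMatrix H E Δs x y τ δ l a a - l₀‖ ≤
      (C + slope H E x y + (‖offCoeff H E Δs x y l₀ e‖ + 3 * C)) * (|τ| + |δ|) := fun a ha => by
    refine (B.norm_diag_sub_le hC R.norm_phase hτ hδ hl ha).trans ?_
    refine mul_le_mul_of_nonneg_right ?_ h0
    linarith [norm_nonneg (offCoeff H E Δs x y l₀ e)]
  refine norm_le_of_two_by_two (p₁ := v x) (p₂ := v y) hne
    (α := effMatrix H E Δs x y τ δ l x x - l₀) (β := effMatrix H E Δs x y τ δ l x y)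
    (γ := effMatrix H E Δs x y τ δ l y x) (ζ := effMatrix H E Δs x y τ δ l y y - l₀)
    (by linear_combination -e1) (by linear_combination -e2) (hdiag x (Or.inl rfl)) hoff' ?_
    (hdiag y (Or.inr rfl))
  rw [norm_effMatrix_yx R.herm R.ne hl1 hN]
  exact hoff'

/-- The gap between two eigenvalues near `l₀` obeys the bounds of an effective 2×2 matrix. -/
theorem EffBounds.gapBound (R : Resonant H E Δs x y l₀ e k) (hC : 0 ≤ C)
    (B : EffBounds H E Δs x y l₀ e k C ε τ δ) (hε : ε ≤ 1)
    (hτ : |τ| ≤ 1) (hδ : |δ| ≤ 1) {l₁ l₂ : ℂ} (hl₁ : ‖l₁ - l₀‖ < ε) (hl₂ : ‖l₂ - l₀‖ < ε)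
    {v₁ v₂ : ι → ℂ} (hv₁ : evol (fun τ : ℝ => (τ : ℂ) • H) E Δs τ δ *ᵥ v₁ = l₁ • v₁)
    (hv₂ : evol (fun τ : ℝ => (τ : ℂ) • H) E Δs τ δ *ᵥ v₂ = l₂ • v₂)
    (hle₁ : ∀ z, ‖v₁ z‖ ≤ 1) (hle₂ : ∀ z, ‖v₂ z‖ ≤ 1)
    (hw : 1 / 2 ≤ ‖v₁ x * v₂ y - v₁ y * v₂ x‖) :
    GapBound (8 * C + C * (1 + 2 * (C + slope H E x y + (‖offCoeff H E Δs x y l₀ e‖ + 3 * C))))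
      (E x - E y) ((H x x).re - (H y y).re - (E x - E y)) ‖offCoeff H E Δs x y l₀ e‖ k τ δ
      ‖l₁ - l₂‖ ‖effMatrix H E Δs x y τ δ l₁ x x - effMatrix H E Δs x y τ δ l₁ y y‖ := by
  set K := C + slope H E x y + (‖offCoeff H E Δs x y l₀ e‖ + 3 * C) with hK
  have hs : 0 ≤ slope H E x y := by rw [slope]; positivity
  have hK0 : 0 ≤ K := by positivity
  have hl₀ := R.norm_phase
  have hne : v₁ x ≠ 0 ∨ v₁ y ≠ 0 := by
    by_contra! h
    rw [h.1, h.2] at hw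
    norm_num at hw
  have hv0 : v₁ ≠ 0 := by rintro rfl; simp at hne
  have hl1 : ‖l₁‖ = 1 := norm_eq_one_of_mulVec_eq (evol_smul_unitary R.herm τ δ) hv₁ hv0
  have hN₁ := B.isUnit l₁ hl₁
  have hN₂ := B.isUnit l₂ hl₂
  obtain ⟨u1, u2, u3⟩ := effMatrix_unitary R.herm R.ne hl1 hN₁
  have a1 := effMatrix_mulVec R.ne hN₁ hv₁ x
  have a2 := effMatrix_mulVec R.ne hN₁ hv₁ y
  have b1 := effMatrix_mulVec R.ne hN₂ hv₂ x
  have b2 := effMatrix_mulVec R.ne hN₂ hv₂ y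
  have hC' : C ≤ 8 * C + C * (1 + 2 * K) := by nlinarith [mul_nonneg hC hK0]
  refine ⟨norm_nonneg _, norm_nonneg _, ?_, ‖effMatrix H E Δs x y τ δ l₁ x y‖, norm_nonneg _,
    ?_, ?_⟩
  · have hlin : l₀ * (1 - Complex.I * linPhase H E τ δ x) - l₀ * (1 - Complex.I * linPhase H E τ δ y)
        = -(l₀ * Complex.I * (((E x - E y) * δ + ((H x x).re - (H y y).re - (E x - E y)) * τ : ℝ))) := by
      rw [linPhase, linPhase]; push_cast; ring
    have hn : ‖l₀ * (1 - Complex.I * linPhase H E τ δ x) -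
        l₀ * (1 - Complex.I * linPhase H E τ δ y)‖ =
        |(E x - E y) * δ + ((H x x).re - (H y y).re - (E x - E y)) * τ| := by
      rw [hlin, norm_neg, norm_mul, norm_mul, hl₀, Complex.norm_I, Complex.norm_real,
        Real.norm_eq_abs, one_mul, one_mul]
    rw [← hn]
    refine (abs_norm_sub_norm_le _ _).trans ?_
    rw [sub_sub_sub_comm]
    refine (norm_sub_le _ _).trans ?_
    have h1 := B.diag l₁ hl₁ x (Or.inl rfl)
    have h2 := B.diag l₁ hl₁ y (Or.inr rfl)
    have : 0 ≤ C * (τ ^ 2 + δ ^ 2) := by positivity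
    have h3 : 2 * C ≤ 8 * C + C * (1 + 2 * K) := by nlinarith [mul_nonneg hC hK0]
    calc _ ≤ 2 * C * (τ ^ 2 + δ ^ 2) := by linarith
      _ ≤ _ := by gcongr
  · obtain ⟨h, h1, h2⟩ := B.off l₁ hl₁
    -- The bound on `h` still contains `‖l₁ - l₀‖`; the Lipschitz estimate for eigenvalues replaces
    -- it by a multiple of `|τ| + |δ|`.
    have hl := B.norm_eigenvalue_sub_le R hC hε hτ hδ hl₁ hv₁ hne
    rw [← hK] at hl
    rw [h1, norm_mul, norm_pow, Complex.norm_real, Real.norm_eq_abs,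
      show |τ| ^ k * ‖h‖ - ‖offCoeff H E Δs x y l₀ e‖ * |τ| ^ k =
        |τ| ^ k * (‖h‖ - ‖offCoeff H E Δs x y l₀ e‖) by ring, abs_mul,
      abs_of_nonneg (by positivity : (0 : ℝ) ≤ |τ| ^ k)]
    have h3 : |‖h‖ - ‖offCoeff H E Δs x y l₀ e‖| ≤ C * (1 + 2 * K) * (|τ| + |δ|) := by
      refine (abs_norm_sub_norm_le _ _).trans (h2.trans ?_)
      calc C * (|τ| + |δ| + ‖l₁ - l₀‖) ≤ C * (|τ| + |δ| + 2 * (K * (|τ| + |δ|))) := by gcongr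
        _ = _ := by ring
    calc |τ| ^ k * |‖h‖ - ‖offCoeff H E Δs x y l₀ e‖|
        ≤ |τ| ^ k * (C * (1 + 2 * K) * (|τ| + |δ|)) := by gcongr
      _ = C * (1 + 2 * K) * |τ| ^ k * (|τ| + |δ|) := by ring
      _ ≤ _ := by gcongr; linarith
  · have hlip : ∀ a, (a = x ∨ a = y) →
        ‖(effMatrix H E Δs x y τ δ l₁ a x - effMatrix H E Δs x y τ δ l₂ a x) * v₂ x +
          (effMatrix H E Δs x y τ δ l₁ a y - effMatrix H E Δs x y τ δ l₂ a y) * v₂ y‖ ≤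
        2 * (C * |τ| * ‖l₁ - l₂‖) := by
      intro a ha
      refine (norm_add_le _ _).trans ?_
      rw [norm_mul, norm_mul]
      have t1 := mul_le_mul (B.lip l₁ l₂ hl₁ hl₂ a x ha (Or.inl rfl)) (hle₂ x) (norm_nonneg _)
        (by positivity)
      have t2 := mul_le_mul (B.lip l₁ l₂ hl₁ hl₂ a y ha (Or.inr rfl)) (hle₂ y) (norm_nonneg _)
        (by positivity)
      linarith
    have key := abs_sqrt_discrim_sub_norm_le u1 u2 u3 a1 a2
      (l₂ := l₂) (r₁ := v₂ x) (r₂ := v₂ y)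
      (e₁ := (effMatrix H E Δs x y τ δ l₁ x x - effMatrix H E Δs x y τ δ l₂ x x) * v₂ x +
          (effMatrix H E Δs x y τ δ l₁ x y - effMatrix H E Δs x y τ δ l₂ x y) * v₂ y)
      (e₂ := (effMatrix H E Δs x y τ δ l₁ y x - effMatrix H E Δs x y τ δ l₂ y x) * v₂ x +
          (effMatrix H E Δs x y τ δ l₁ y y - effMatrix H E Δs x y τ δ l₂ y y) * v₂ y)
      (by linear_combination b1) (by linear_combination b2) (hle₁ x) (hle₁ y) hw
      (hlip x (Or.inl rfl)) (hlip y (Or.inr rfl))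
    refine key.trans ?_
    have : 0 ≤ C * (1 + 2 * K) * |τ| * ‖l₁ - l₂‖ := by positivity
    linarith

/-- If the effective matrix at some spectral parameter `z` on the circle has both diagonal entries
equal to a positive multiple of `z`, the eigenvalues are `|τ|^k`-close to `z`. -/
theorem EffBounds.norm_diag_sub_diag_le (R : Resonant H E Δs x y l₀ e k) (hC : 0 ≤ C)
    (B : EffBounds H E Δs x y l₀ e k C ε τ δ) (hε : ε ≤ 1)
    (hτ : |τ| ≤ 1) (hδ : |δ| ≤ 1) (hCτ : 4 * (C * |τ|) ≤ 1) {l z : ℂ} (hl : ‖l - l₀‖ < ε)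
    (hz : ‖z - l₀‖ < ε) (hz1 : ‖z‖ = 1) {v : ι → ℂ}
    (hv : evol (fun τ : ℝ => (τ : ℂ) • H) E Δs τ δ *ᵥ v = l • v) (hne : v x ≠ 0 ∨ v y ≠ 0)
    (hx : effMatrix H E Δs x y τ δ z x x = ‖effMatrix H E Δs x y τ δ z x x‖ * z)
    (heq : effMatrix H E Δs x y τ δ z x x = effMatrix H E Δs x y τ δ z y y) :
    ‖effMatrix H E Δs x y τ δ l x x - effMatrix H E Δs x y τ δ l y y‖ ≤
      8 * C * (‖offCoeff H E Δs x y l₀ e‖ + 3 * C) * |τ| ^ (k + 1) := by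
  set b := (‖offCoeff H E Δs x y l₀ e‖ + 3 * C) * |τ| ^ k with hb
  have hb0 : 0 ≤ b := by positivity
  have hNz := B.isUnit z hz
  have hN := B.isUnit l hl
  have hoff := B.norm_off_le hC hε hτ hδ hz
  rw [← hb] at hoff
  have hyx := norm_effMatrix_yx R.herm R.ne hz1 hNz
  obtain ⟨u1, -, -⟩ := effMatrix_unitary R.herm R.ne hz1 hNz
  have e1 := effMatrix_mulVec R.ne hN hv x
  have e2 := effMatrix_mulVec R.ne hN hv y
  -- A column of a unitary matrix has norm one, so its diagonal modulus differs from 1 by at most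
  -- the off-diagonal modulus.
  have hd : ‖effMatrix H E Δs x y τ δ z x x - z‖ ≤ b := by
    have h1 : effMatrix H E Δs x y τ δ z x x - z =
        ((‖effMatrix H E Δs x y τ δ z x x‖ - 1 : ℝ) : ℂ) * z := by
      rw [sub_eq_iff_eq_add]
      conv_lhs => rw [hx]
      push_cast; ring
    rw [h1, norm_mul, hz1, mul_one, Complex.norm_real, Real.norm_eq_abs]
    rw [hyx] at u1
    refine le_trans ?_ hoff
    have p1 := norm_nonneg (effMatrix H E Δs x y τ δ z x x)
    have p2 := norm_nonneg (effMatrix H E Δs x y τ δ z x y)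
    rw [abs_le]
    constructor <;> nlinarith
  have hlip : ∀ a c, (a = x ∨ a = y) → (c = x ∨ c = y) →
      ‖effMatrix H E Δs x y τ δ l a c - effMatrix H E Δs x y τ δ z a c‖ ≤ C * |τ| * ‖l - z‖ :=
    fun a c ha hc => B.lip l z hl hz a c ha hc
  have hentry : ∀ a c, (a = x ∨ a = y) → (c = x ∨ c = y) → ∀ w : ℂ,
      ‖effMatrix H E Δs x y τ δ z a c - w‖ ≤ b →
      ‖effMatrix H E Δs x y τ δ l a c - w‖ ≤ b + C * |τ| * ‖l - z‖ := by
    intro a c ha hc w h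
    have := norm_add_le (effMatrix H E Δs x y τ δ l a c - effMatrix H E Δs x y τ δ z a c)
      (effMatrix H E Δs x y τ δ z a c - w)
    rw [sub_add_sub_cancel] at this
    linarith [hlip a c ha hc]
  -- All entries of `F(l) - z` are bounded by the off-diagonal size plus the Lipschitz error. As `4
  -- C |τ| ≤ 1`, the error is absorbed on the left and `‖l - z‖ ≤ 4 b` follows.
  have hlz : ‖l - z‖ ≤ 2 * (b + C * |τ| * ‖l - z‖) := by
    refine norm_le_of_two_by_two (p₁ := v x) (p₂ := v y) hne
      (α := effMatrix H E Δs x y τ δ l x x - z) (β := effMatrix H E Δs x y τ δ l x y)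
      (γ := effMatrix H E Δs x y τ δ l y x) (ζ := effMatrix H E Δs x y τ δ l y y - z)
      (by linear_combination -e1) (by linear_combination -e2)
      (hentry x x (Or.inl rfl) (Or.inl rfl) z hd) ?_ ?_
      (hentry y y (Or.inr rfl) (Or.inr rfl) z (by rw [← heq]; exact hd))
    · have := hentry x y (Or.inl rfl) (Or.inr rfl) 0 (by rwa [sub_zero])
      rwa [sub_zero] at this
    · have := hentry y x (Or.inr rfl) (Or.inl rfl) 0 (by rwa [sub_zero, hyx])
      rwa [sub_zero] at this
  have hlz' : ‖l - z‖ ≤ 4 * b := by nlinarith [norm_nonneg (l - z)]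
  have hfin : effMatrix H E Δs x y τ δ l x x - effMatrix H E Δs x y τ δ l y y =
      (effMatrix H E Δs x y τ δ l x x - effMatrix H E Δs x y τ δ z x x) -
        (effMatrix H E Δs x y τ δ l y y - effMatrix H E Δs x y τ δ z y y) := by
    rw [heq]; ring
  rw [hfin]
  refine (norm_sub_le _ _).trans ?_
  have h1 := hlip x x (Or.inl rfl) (Or.inl rfl)
  have h2 := hlip y y (Or.inr rfl) (Or.inr rfl)
  have h3 : C * |τ| * ‖l - z‖ ≤ C * |τ| * (4 * b) := by gcongr
  calc _ ≤ 2 * (C * |τ| * (4 * b)) := by linarith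
    _ = _ := by rw [hb]; ring

end Crossing

/-- Two complex numbers close to a common point of the unit circle with `a * conj b` real are
positive multiples of each other. -/
theorem norm_mul_eq_norm_mul_of_im_eq_zero {a b l : ℂ} (hl : ‖l‖ = 1) (ha : ‖a - l‖ < 1 / 4)
    (hb : ‖b - l‖ < 1 / 4) (h : (a * starRingEnd ℂ b).im = 0) : (‖b‖ : ℂ) * a = ‖a‖ * b := by
  have ha' : 3 / 4 < ‖a‖ := by
    have := norm_sub_norm_le l a
    rw [norm_sub_rev] at this
    linarith
  have hb' : 3 / 4 < ‖b‖ := by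
    have := norm_sub_norm_le l b
    rw [norm_sub_rev] at this
    linarith
  have hab : ‖a - b‖ < 1 / 2 := by
    have := norm_sub_le (a - l) (b - l)
    rw [sub_sub_sub_cancel_right] at this
    linarith
  have hre : 0 < (a * starRingEnd ℂ b).re := by
    have := Complex.normSq_sub a b
    simp only [Complex.normSq_eq_norm_sq] at this
    nlinarith [norm_nonneg (a - b)]
  have hr : a * starRingEnd ℂ b = ((a * starRingEnd ℂ b).re : ℂ) :=
    Complex.ext (by simp) (by rw [h, Complex.ofReal_im])
  have hn : (a * starRingEnd ℂ b).re = ‖a‖ * ‖b‖ := by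
    have := congrArg norm hr
    rw [norm_mul, RCLike.norm_conj, Complex.norm_real, Real.norm_eq_abs, abs_of_pos hre] at this
    exact this.symm
  rw [hn] at hr
  have hb0 : (‖b‖ : ℂ) ≠ 0 := by
    rw [Ne, Complex.ofReal_eq_zero]; linarith
  apply mul_left_cancel₀ hb0
  have hbb := Complex.conj_mul' b
  push_cast at hr
  linear_combination b * hr - a * hbb

/-! ### Locating the zero of the diagonal difference. -/

section OpenMapping

variable {ι : Type*} [Fintype ι] [DecidableEq ι]
variable {H : Matrix ι ι ℂ} {E : ι → ℝ} {Δs : ℝ} {x y : ι} {l₀ : ℂ} {e : ι → ℕ} {k : ℕ}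

/-- The linear phase as a continuous linear functional of `(τ, δ, θ)`. -/
noncomputable def linPhaseCLM (H : Matrix ι ι ℂ) (E : ι → ℝ) (a : ι) : ℝ × ℝ × ℝ →L[ℝ] ℝ :=
  E a • (ContinuousLinearMap.fst ℝ ℝ ℝ).comp (ContinuousLinearMap.snd ℝ ℝ (ℝ × ℝ)) +
    ((H a a).re - E a) • ContinuousLinearMap.fst ℝ ℝ (ℝ × ℝ)

/-- The diagonal element of the effective matrix at the spectral parameter `l₀ e^{iθ}`. -/
noncomputable def diagEntry (H : Matrix ι ι ℂ) (E : ι → ℝ) (Δs : ℝ) (x y : ι) (l₀ : ℂ) (a : ι)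
    (p : ℝ × ℝ × ℝ) : ℂ :=
  effMatrix H E Δs x y p.1 p.2.1 (l₀ * Complex.exp (Complex.I * p.2.2)) a a

theorem hasStrictFDerivAt_circle (l₀ : ℂ) :
    HasStrictFDerivAt (fun p : ℝ × ℝ × ℝ => l₀ * Complex.exp (Complex.I * p.2.2))
      ((l₀ * Complex.I) • Complex.ofRealCLM.comp
        ((ContinuousLinearMap.snd ℝ ℝ ℝ).comp (ContinuousLinearMap.snd ℝ ℝ (ℝ × ℝ)))) 0 := by
  have h0 : HasStrictDerivAt (fun t : ℂ => l₀ * Complex.exp (Complex.I * t)) (l₀ * Complex.I)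
      (((ContinuousLinearMap.snd ℝ ℝ ℝ).comp (ContinuousLinearMap.snd ℝ ℝ (ℝ × ℝ)) 0 : ℝ) : ℂ) := by
    have h1 : HasStrictDerivAt (fun t : ℂ => Complex.I * t) (Complex.I * 1)
        (((ContinuousLinearMap.snd ℝ ℝ ℝ).comp (ContinuousLinearMap.snd ℝ ℝ (ℝ × ℝ)) 0 : ℝ) : ℂ) :=
      (hasStrictDerivAt_id _).const_mul _
    have h2 := h1.cexp.const_mul l₀
    simpa using h2
  have h3 := (h0.hasStrictFDerivAt.restrictScalars ℝ).comp (0 : ℝ × ℝ × ℝ)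
    ((Complex.ofRealCLM.comp ((ContinuousLinearMap.snd ℝ ℝ ℝ).comp
      (ContinuousLinearMap.snd ℝ ℝ (ℝ × ℝ)))).hasStrictFDerivAt (x := 0))
  refine h3.congr_fderiv ?_
  ext <;> simp

theorem Resonant.hasStrictFDerivAt_diagEntry (R : Resonant H E Δs x y l₀ e k) {a : ι}
    (ha : a = x ∨ a = y) :
    HasStrictFDerivAt (diagEntry H E Δs x y l₀ a)
      ((-(l₀ * Complex.I)) • Complex.ofRealCLM.comp (linPhaseCLM H E a)) 0 ∧
    diagEntry H E Δs x y l₀ a 0 = l₀ := by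
  obtain ⟨C, hC, ε, hε, hB⟩ := R.exists_effBounds
  have hz := hasStrictFDerivAt_circle l₀
  have hzc := hz.continuousAt
  have hz0 : l₀ * Complex.exp (Complex.I * ((0 : ℝ × ℝ × ℝ).2.2 : ℝ)) = l₀ := by simp
  have hN0 := isUnit_reducedDenom_base (H := H) R.phase_x R.phase_ne
  have hcd : ContDiffAt ℝ 1 (diagEntry H E Δs x y l₀ a) 0 := by
    have h1 := contDiffAt_matrix_apply (contDiffAt_feshbach (Δs := Δs) (E := E)
      (contDiff_ofReal_smul H) (coProj x y) (p := ((0 : ℝ), (0 : ℝ), l₀)) hN0) a a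
    have h2 : ContDiff ℝ 1 (fun p : ℝ × ℝ × ℝ => ((p.1, p.2.1,
        l₀ * Complex.exp (Complex.I * p.2.2)) : ℝ × ℝ × ℂ)) := by
      have : ContDiff ℝ 1 fun p : ℝ × ℝ × ℝ => (p.2.2 : ℂ) :=
        Complex.ofRealCLM.contDiff.comp contDiff_snd.snd
      fun_prop
    rw [show ((0 : ℝ), (0 : ℝ), l₀) = (fun p : ℝ × ℝ × ℝ => ((p.1, p.2.1,
        l₀ * Complex.exp (Complex.I * p.2.2)) : ℝ × ℝ × ℂ)) 0 by simp] at h1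
    exact h1.comp 0 h2.contDiffAt
  have hbase : diagEntry H E Δs x y l₀ a 0 = l₀ := by
    have h := (hB 0 0 (by simpa) (by simpa)).diag l₀ (by simpa) a ha
    have h' : ‖diagEntry H E Δs x y l₀ a 0 - l₀‖ ≤ 0 := by
      simpa [diagEntry, linPhase] using h
    exact sub_eq_zero.mp (norm_le_zero_iff.mp h')
  -- Continuous differentiability gives strictness; the derivative itself is identified by the
  -- quadratic error bound on the diagonal entries.
  refine ⟨hcd.hasStrictFDerivAt' ?_ one_ne_zero, hbase⟩
  rw [hasFDerivAt_iff_isLittleO_nhds_zero]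
  have hev : ∀ᶠ p : ℝ × ℝ × ℝ in 𝓝 0, |p.1| < ε ∧ |p.2.1| < ε ∧
      ‖l₀ * Complex.exp (Complex.I * p.2.2) - l₀‖ < ε := by
    refine (((continuous_fst.abs.tendsto' (0 : ℝ × ℝ × ℝ) 0 (by simp)).eventually_lt_const hε).and
      ((((continuous_fst.comp continuous_snd).abs.tendsto' (0 : ℝ × ℝ × ℝ) 0
        (by simp)).eventually_lt_const hε).and ?_))
    have := hzc.tendsto
    rw [hz0] at this
    have := (this.sub_const l₀).norm
    rw [sub_self, norm_zero] at this
    exact this.eventually_lt_const hε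
  have hO : (fun p : ℝ × ℝ × ℝ => diagEntry H E Δs x y l₀ a (0 + p) - diagEntry H E Δs x y l₀ a 0 -
      ((-(l₀ * Complex.I)) • Complex.ofRealCLM.comp (linPhaseCLM H E a)) p) =O[𝓝 0]
      fun p => ‖p‖ ^ 2 := by
    refine IsBigO.of_bound (2 * C) ?_
    filter_upwards [hev] with p ⟨h1, h2, h3⟩
    have h := (hB p.1 p.2.1 h1 h2).diag _ h3 a ha
    have heq : diagEntry H E Δs x y l₀ a (0 + p) - diagEntry H E Δs x y l₀ a 0 -
        ((-(l₀ * Complex.I)) • Complex.ofRealCLM.comp (linPhaseCLM H E a)) p =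
        effMatrix H E Δs x y p.1 p.2.1 (l₀ * Complex.exp (Complex.I * p.2.2)) a a -
          l₀ * (1 - Complex.I * linPhase H E p.1 p.2.1 a) := by
      rw [hbase, zero_add, diagEntry]
      simp [linPhaseCLM, linPhase]
      ring
    rw [heq, norm_pow, norm_norm]
    have e1 : p.1 ^ 2 ≤ ‖p‖ ^ 2 := by
      rw [← sq_abs]; gcongr; exact norm_fst_le p
    have e2 : p.2.1 ^ 2 ≤ ‖p‖ ^ 2 := by
      rw [← sq_abs]; gcongr; exact (norm_fst_le p.2).trans (norm_snd_le p)
    nlinarith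
  exact hO.trans_isLittleO ((isLittleO_norm_pow_id one_lt_two))

/-- For each small `δ` there are a small `τ` and a spectral parameter `z` near `l₀` such that both
diagonal elements of the effective matrix at `z` are the same positive multiple of `z`. -/
theorem Resonant.eventually_exists_diag_eq (R : Resonant H E Δs x y l₀ e k)
    (hD : (H x x).re - (H y y).re - (E x - E y) ≠ 0) {κ : ℝ} (hκ : 0 < κ) :
    ∀ᶠ δ in 𝓝 (0 : ℝ), ∃ (τ : ℝ) (z : ℂ), |τ| < κ ∧ ‖z - l₀‖ < κ ∧ ‖z‖ = 1 ∧
      effMatrix H E Δs x y τ δ z x x = ‖effMatrix H E Δs x y τ δ z x x‖ * z ∧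
      effMatrix H E Δs x y τ δ z x x = effMatrix H E Δs x y τ δ z y y := by
  obtain ⟨C, hC, ε, hε, hB⟩ := R.exists_effBounds
  obtain ⟨hx, hx0⟩ := R.hasStrictFDerivAt_diagEntry (Or.inl rfl)
  obtain ⟨hy, hy0⟩ := R.hasStrictFDerivAt_diagEntry (Or.inr rfl)
  have hz := hasStrictFDerivAt_circle l₀
  have hz0 : l₀ * Complex.exp (Complex.I * ((0 : ℝ × ℝ × ℝ).2.2 : ℝ)) = l₀ := by simp
  have hl := R.norm_phase
  have hll : l₀ * starRingEnd ℂ l₀ = 1 := by rw [Complex.mul_conj', hl]; simp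
  have hconj : ∀ {f : ℝ × ℝ × ℝ → ℂ} {f' : ℝ × ℝ × ℝ →L[ℝ] ℂ}, HasStrictFDerivAt f f' 0 →
      HasStrictFDerivAt (fun p => starRingEnd ℂ (f p))
        ((Complex.conjCLE : ℂ →L[ℝ] ℂ).comp f') 0 := fun hf =>
    (Complex.conjCLE : ℂ →L[ℝ] ℂ).hasStrictFDerivAt.comp 0 hf
  have h1 := Complex.imCLM.hasStrictFDerivAt.comp (0 : ℝ × ℝ × ℝ) (hx.mul (hconj hy))
  have h2 := Complex.imCLM.hasStrictFDerivAt.comp (0 : ℝ × ℝ × ℝ) (hx.mul (hconj hz))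
  have h3 := ((ContinuousLinearMap.fst ℝ ℝ ℝ).comp
    (ContinuousLinearMap.snd ℝ ℝ (ℝ × ℝ))).hasStrictFDerivAt (x := (0 : ℝ × ℝ × ℝ))
  have hΨ := h3.prodMk (h1.prodMk h2)
  -- The map sends `(τ, δ, θ)` to `δ`, `Im (F_xx conj F_yy)` and `Im (F_xx conj z)` with `z = l₀
  -- e^{iθ}`. Its derivative is `(δ, -(eδ + Dτ), -φ_x - θ)`, where `φ_x` is the linear phase of `x`;
  -- it is onto because `D ≠ 0`. Treating `z` as an unknown avoids any differentiability of the
  -- eigenvalues, which may fail at the crossing.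
  have hmap := hΨ.map_nhds_eq_of_surj (by
    rw [LinearMap.range_eq_top]
    rintro ⟨a, b, c⟩
    obtain ⟨τ, hτ⟩ : ∃ τ, ((H x x).re - (H y y).re - (E x - E y)) * τ = -(b + (E x - E y) * a) :=
      ⟨_, mul_div_cancel₀ _ hD⟩
    refine ⟨(τ, a, -c - linPhase H E τ a x), ?_⟩
    have hn : l₀.re * l₀.re + l₀.im * l₀.im = 1 := by
      have := congrArg Complex.re hll
      simpa using this
    refine Prod.ext ?_ (Prod.ext ?_ ?_)
    · simp
    · simp [linPhaseCLM, hx0, hy0]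
      linear_combination
        (a * E y + τ * ((H y y).re - E y) - (a * E x + τ * ((H x x).re - E x))) * hn - hτ
    · simp [linPhaseCLM, hx0, linPhase]
      linear_combination c * hn)
  have hcx := hx.continuousAt.tendsto
  have hcy := hy.continuousAt.tendsto
  have hcz := hz.continuousAt.tendsto
  rw [hx0] at hcx
  rw [hy0] at hcy
  rw [hz0] at hcz
  have hnear : ∀ {f : ℝ × ℝ × ℝ → ℂ}, Tendsto f (𝓝 0) (𝓝 l₀) → ∀ {r : ℝ}, 0 < r →
      ∀ᶠ p in 𝓝 0, ‖f p - l₀‖ < r := fun {f} hf {r} hr => by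
    have := (hf.sub_const l₀).norm
    rw [sub_self, norm_zero] at this
    exact this.eventually_lt_const hr
  have hS : ∀ᶠ p : ℝ × ℝ × ℝ in 𝓝 0, |p.1| < min ε κ ∧ |p.2.1| < ε ∧
      ‖l₀ * Complex.exp (Complex.I * p.2.2) - l₀‖ < min (min ε κ) (1 / 4) ∧
      ‖diagEntry H E Δs x y l₀ x p - l₀‖ < 1 / 4 ∧ ‖diagEntry H E Δs x y l₀ y p - l₀‖ < 1 / 4 :=
    ((continuous_fst.abs.tendsto' (0 : ℝ × ℝ × ℝ) 0 (by simp)).eventually_lt_const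
      (by positivity)).and
    (((continuous_fst.comp continuous_snd).abs.tendsto' (0 : ℝ × ℝ × ℝ) 0
        (by simp)).eventually_lt_const hε |>.and
    ((hnear hcz (by positivity)).and ((hnear hcx (by norm_num)).and (hnear hcy (by norm_num)))))
  have himg := image_mem_map hS (m := fun p : ℝ × ℝ × ℝ => (p.2.1,
    (diagEntry H E Δs x y l₀ x p * starRingEnd ℂ (diagEntry H E Δs x y l₀ y p)).im,
    (diagEntry H E Δs x y l₀ x p *
      starRingEnd ℂ (l₀ * Complex.exp (Complex.I * p.2.2))).im))
  have hmap₀ : map (fun p : ℝ × ℝ × ℝ => (p.2.1,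
    (diagEntry H E Δs x y l₀ x p * starRingEnd ℂ (diagEntry H E Δs x y l₀ y p)).im,
    (diagEntry H E Δs x y l₀ x p *
      starRingEnd ℂ (l₀ * Complex.exp (Complex.I * p.2.2))).im)) (𝓝 0) = 𝓝 (0, 0, 0) := by
    refine hmap.trans (congrArg 𝓝 (Prod.ext ?_ (Prod.ext ?_ ?_)))
    · simp
    · simp only [Pi.mul_apply, hx0, hy0, hll]; simp
    · simp only [Pi.mul_apply, hx0, hz0, hll]; simp
  rw [hmap₀] at himg
  -- Since `δ` is one of the output coordinates, the targets `(δ, 0, 0)` have preimages with the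
  -- prescribed `δ`.
  have hcurve : Tendsto (fun δ : ℝ => (δ, (0 : ℝ), (0 : ℝ))) (𝓝 0) (𝓝 (0, 0, 0)) :=
    Continuous.tendsto (f := fun δ : ℝ => (δ, (0 : ℝ), (0 : ℝ))) (by fun_prop) 0
  filter_upwards [hcurve.eventually_mem himg] with δ ⟨p, ⟨g1, g2, g3, g4, g5⟩, hp⟩
  obtain ⟨rfl, p2, p3⟩ : p.2.1 = δ ∧ _ = (0 : ℝ) ∧ _ = (0 : ℝ) := by
    simpa only [Prod.mk.injEq] using hp
  simp only [lt_min_iff] at g1 g3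
  set z := l₀ * Complex.exp (Complex.I * p.2.2) with hzdef
  have hz1 : ‖z‖ = 1 := by
    rw [hzdef, norm_mul, hl, mul_comm Complex.I, Complex.norm_exp_ofReal_mul_I, one_mul]
  have B := hB p.1 p.2.1 g1.1 g2
  have hN := B.isUnit z g3.1.1
  obtain ⟨u1, u2, -⟩ := effMatrix_unitary R.herm R.ne hz1 hN
  rw [norm_effMatrix_yx R.herm R.ne hz1 hN] at u1
  -- The vanishing imaginary parts align the phases; equality of the moduli comes from unitarity and
  -- the equal off-diagonal moduli.
  have hdn : ‖diagEntry H E Δs x y l₀ x p‖ = ‖diagEntry H E Δs x y l₀ y p‖ := by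
    refine (sq_eq_sq₀ (norm_nonneg _) (norm_nonneg _)).mp ?_
    rw [diagEntry, diagEntry, ← hzdef]
    linarith
  have hne : (‖diagEntry H E Δs x y l₀ y p‖ : ℂ) ≠ 0 := by
    have := norm_sub_norm_le l₀ (diagEntry H E Δs x y l₀ y p)
    rw [norm_sub_rev] at this
    rw [Ne, Complex.ofReal_eq_zero]
    linarith
  have r1 := norm_mul_eq_norm_mul_of_im_eq_zero hl g4 g5 p2
  have r2 := norm_mul_eq_norm_mul_of_im_eq_zero hl g4 g3.2 p3
  rw [hz1, Complex.ofReal_one, one_mul] at r2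
  rw [hdn] at r1
  exact ⟨p.1, z, g1.2, g3.1.2, hz1, r2, mul_left_cancel₀ hne r1⟩

end OpenMapping

theorem GapBound.mono {C C' e D c τ δ g α : ℝ} {k : ℕ} (hC : C ≤ C')
    (h : GapBound C e D c k τ δ g α) : GapBound C' e D c k τ δ g α := by
  obtain ⟨hg, hα, h1, β, hβ, h2, h3⟩ := h
  refine ⟨hg, hα, h1.trans (by gcongr), β, hβ, h2.trans (by gcongr), h3.trans (by gcongr)⟩

/-! ### Gap bounds for all small parameters, and sharper ones at the diagonal crossing. -/

section Crossing

variable {ι : Type*} [Fintype ι] [DecidableEq ι]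
variable {H : Matrix ι ι ℂ} {E : ι → ℝ} {Δs : ℝ} {x y : ι} {l₀ : ℂ} {e : ι → ℕ} {k : ℕ}

theorem EffBounds.mono {C ε ε' τ δ : ℝ} (hε : ε' ≤ ε) (B : EffBounds H E Δs x y l₀ e k C ε τ δ) :
    EffBounds H E Δs x y l₀ e k C ε' τ δ :=
  ⟨fun l hl => B.isUnit l (hl.trans_le hε), fun l hl => B.diag l (hl.trans_le hε),
    fun l l' hl hl' => B.lip l l' (hl.trans_le hε) (hl'.trans_le hε),
    fun l hl => B.off l (hl.trans_le hε)⟩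

/-- The two eigenvalues near `l₀` exist and their gap is controlled; moreover for each `δ` there is
a small `τ` at which the diagonal difference nearly vanishes. -/
theorem Resonant.exists_gapBound (R : Resonant H E Δs x y l₀ e k) :
    ∀ᶠ ρ in 𝓝[>] (0 : ℝ), ∃ C > 0, ∃ ε > 0,
      (∀ τ δ : ℝ, |τ| < ε → |δ| < ε → ∃ (l₁ l₂ : ℂ) (α : ℝ),
        (evol (fun τ : ℝ => (τ : ℂ) • H) E Δs τ δ).charpoly.roots.filter (fun d => ‖d - l₀‖ < ρ) =
          {l₁, l₂} ∧
        GapBound C (E x - E y) ((H x x).re - (H y y).re - (E x - E y))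
          ‖offCoeff H E Δs x y l₀ e‖ k τ δ ‖l₁ - l₂‖ α) ∧
      ((H x x).re - (H y y).re - (E x - E y) ≠ 0 → ∀ κ > 0, ∀ᶠ δ in 𝓝 (0 : ℝ),
        ∃ (τ : ℝ) (l₁ l₂ : ℂ) (α : ℝ), |τ| < κ ∧
        (evol (fun τ : ℝ => (τ : ℂ) • H) E Δs τ δ).charpoly.roots.filter (fun d => ‖d - l₀‖ < ρ) =
          {l₁, l₂} ∧
        GapBound C (E x - E y) ((H x x).re - (H y y).re - (E x - E y))
          ‖offCoeff H E Δs x y l₀ e‖ k τ δ ‖l₁ - l₂‖ α ∧ α ≤ C * |τ| ^ (k + 1)) := by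
  obtain ⟨C, hC, ε, hε, hB⟩ := R.exists_effBounds
  have hs : 0 ≤ slope H E x y := by rw [slope]; positivity
  set C₁ := 8 * C + C * (1 + 2 * (C + slope H E x y + (‖offCoeff H E Δs x y l₀ e‖ + 3 * C)))
    with hC₁
  set C₂ := 8 * C * (‖offCoeff H E Δs x y l₀ e‖ + 3 * C) with hC₂
  have hC₁0 : 0 ≤ C₁ := by positivity
  have hC₂0 : 0 ≤ C₂ := by positivity
  have hdist : ∀ᶠ ρ in 𝓝[>] (0 : ℝ), ∀ z, z ≠ x → z ≠ y →
      2 * ρ ≤ ‖Complex.exp (-Complex.I * Δs * E z) - l₀‖ := by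
    refine eventually_all.mpr fun z => ?_
    by_cases h : z ≠ x ∧ z ≠ y
    · have hpos : 0 < ‖Complex.exp (-Complex.I * Δs * E z) - l₀‖ :=
        norm_pos_iff.mpr (sub_ne_zero.mpr (R.phase_ne z h.1 h.2))
      filter_upwards [Ioo_mem_nhdsGT (half_pos hpos)] with ρ hρ _ _
      linarith [hρ.2]
    · exact Eventually.of_forall fun ρ h1 h2 => absurd ⟨h1, h2⟩ h
  filter_upwards [hdist, Ioo_mem_nhdsGT (lt_min hε one_pos)] with ρ hw hρ
  obtain ⟨ε₂, hε₂, hpair⟩ := R.exists_eigenpair hρ.1 hw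
  have hρε := hρ.2
  refine ⟨C₁ + C₂ + 1, by positivity, min (min ε 1) ε₂, by positivity, fun τ δ hτ hδ => ?_,
    fun hD κ hκ => ?_⟩
  · simp only [lt_min_iff] at hτ hδ
    obtain ⟨d₁, d₂, v₁, v₂, hf, hv₁, hv₂, hd₁, hd₂, hle₁, hle₂, hwedge⟩ := hpair τ δ hτ.2 hδ.2
    refine ⟨d₁, d₂, _, hf, GapBound.mono ?_ (((hB τ δ hτ.1.1 hδ.1.1).mono (min_le_left ε 1)).gapBound
      R hC.le (min_le_right _ _) hτ.1.2.le hδ.1.2.le (hd₁.trans hρε) (hd₂.trans hρε) hv₁ hv₂ hle₁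
      hle₂ hwedge)⟩
    rw [← hC₁]; linarith
  · have hκ' : 0 < min (min κ (1 / (4 * C))) (min (min ε 1) ε₂) := by positivity
    have hδ : ∀ᶠ δ in 𝓝 (0 : ℝ), |δ| < min (min ε 1) ε₂ :=
      (continuous_abs.tendsto' (0 : ℝ) 0 abs_zero).eventually_lt_const (by positivity)
    filter_upwards [R.eventually_exists_diag_eq hD hκ', hδ] with δ ⟨τ, z, hτ, hz, hz1, hzx, hzy⟩ hδ
    simp only [lt_min_iff] at hτ hδ hz
    obtain ⟨d₁, d₂, v₁, v₂, hf, hv₁, hv₂, hd₁, hd₂, hle₁, hle₂, hwedge⟩ := hpair τ δ hτ.2.2 hδ.2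
    have B := (hB τ δ hτ.2.1.1 hδ.1.1).mono (min_le_left ε 1)
    have hne : v₁ x ≠ 0 ∨ v₁ y ≠ 0 := by
      by_contra! h
      rw [h.1, h.2] at hwedge
      norm_num at hwedge
    have h4 : 4 * (C * |τ|) ≤ 1 := by
      have := (lt_div_iff₀ (by positivity)).mp hτ.1.2
      linarith
    refine ⟨τ, d₁, d₂, _, hτ.1.1, hf, GapBound.mono ?_ (B.gapBound
      R hC.le (min_le_right _ _) hτ.2.1.2.le hδ.1.2.le (hd₁.trans hρε) (hd₂.trans hρε) hv₁ hv₂ hle₁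
      hle₂ hwedge), (B.norm_diag_sub_diag_le R hC.le (min_le_right _ _) hτ.2.1.2.le hδ.1.2.le h4
      (hd₁.trans hρε) (lt_min hz.2.1.1 hz.2.1.2) hz1 hv₁ hne hzx hzy).trans ?_⟩
    · rw [← hC₁]; linarith
    · rw [← hC₂]; gcongr; linarith

end Crossing

/-! ### Asymptotic analysis of the gap bounds. -/

/-- The parts of `GapBound`, as eventual statements for functions of `p = (τ, δ)`. -/
structure GapFamily (C e D c : ℝ) (k : ℕ) (F : Filter (ℝ × ℝ)) (G α β : ℝ × ℝ → ℝ) : Prop where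
  gap_nonneg : ∀ᶠ p in F, 0 ≤ G p
  diag_nonneg : ∀ᶠ p in F, 0 ≤ α p
  off_nonneg : ∀ᶠ p in F, 0 ≤ β p
  diag : ∀ᶠ p in F, |α p - (|e * p.2 + D * p.1|)| ≤ C * (p.1 ^ 2 + p.2 ^ 2)
  off : ∀ᶠ p in F, |β p - c * |p.1| ^ k| ≤ C * |p.1| ^ k * (|p.1| + |p.2|)
  gap : ∀ᶠ p in F, |√(α p ^ 2 + 4 * β p ^ 2) - G p| ≤ C * |p.1| * G p

/-- Choice turns the pointwise bounds into functions, to which the calculus of `IsBigO` applies. The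
value 0 off the good set is irrelevant for eventual statements. -/
theorem exists_gapFamily {C e D c : ℝ} {k : ℕ} {F : Filter (ℝ × ℝ)} {G : ℝ × ℝ → ℝ}
    {P : ℝ × ℝ → ℝ → Prop} (h : ∀ᶠ p in F, ∃ α, GapBound C e D c k p.1 p.2 (G p) α ∧ P p α) :
    ∃ α β, GapFamily C e D c k F G α β ∧ ∀ᶠ p in F, P p (α p) := by
  classical
  have h' : ∀ p : ℝ × ℝ, ∃ α β : ℝ, (∃ α, GapBound C e D c k p.1 p.2 (G p) α ∧ P p α) →
      0 ≤ G p ∧ 0 ≤ α ∧ 0 ≤ β ∧ |α - (|e * p.2 + D * p.1|)| ≤ C * (p.1 ^ 2 + p.2 ^ 2) ∧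
      |β - c * |p.1| ^ k| ≤ C * |p.1| ^ k * (|p.1| + |p.2|) ∧
      |√(α ^ 2 + 4 * β ^ 2) - G p| ≤ C * |p.1| * G p ∧ P p α := by
    intro p
    by_cases hp : ∃ α, GapBound C e D c k p.1 p.2 (G p) α ∧ P p α
    · obtain ⟨α, ⟨hg, hα, h1, β, hβ, h2, h3⟩, h4⟩ := hp
      exact ⟨α, β, fun _ => ⟨hg, hα, hβ, h1, h2, h3, h4⟩⟩
    · exact ⟨0, 0, fun h => absurd h hp⟩
  choose α β hαβ using h'
  have h'' := h.mono fun p hp => hαβ p hp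
  exact ⟨α, β, ⟨h''.mono fun p hp => hp.1, h''.mono fun p hp => hp.2.1,
    h''.mono fun p hp => hp.2.2.1, h''.mono fun p hp => hp.2.2.2.1,
    h''.mono fun p hp => hp.2.2.2.2.1, h''.mono fun p hp => hp.2.2.2.2.2.1⟩,
    h''.mono fun p hp => hp.2.2.2.2.2.2⟩

section Asymptotics

variable {C e D c : ℝ} {k : ℕ} {F : Filter (ℝ × ℝ)} {G α β : ℝ × ℝ → ℝ}

theorem eventually_abs_fst_lt (hF : F ≤ 𝓝 0) {r : ℝ} (hr : 0 < r) : ∀ᶠ p in F, |p.1| < r :=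
  hF ((continuous_fst.abs.tendsto' (0 : ℝ × ℝ) 0 (by simp)).eventually_lt_const hr)

theorem eventually_abs_snd_lt (hF : F ≤ 𝓝 0) {r : ℝ} (hr : 0 < r) : ∀ᶠ p in F, |p.2| < r :=
  hF ((continuous_snd.abs.tendsto' (0 : ℝ × ℝ) 0 (by simp)).eventually_lt_const hr)

theorem eventually_mul_abs_fst_lt (hF : F ≤ 𝓝 0) (C : ℝ) {r : ℝ} (hr : 0 < r) :
    ∀ᶠ p in F, C * |p.1| < r :=
  hF (((continuous_const.mul continuous_fst.abs).tendsto' (0 : ℝ × ℝ) 0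
    (by simp)).eventually_lt_const hr)

theorem isBigO_pow_snd (hF : F ≤ 𝓝 0) {m n : ℕ} (h : m ≤ n) :
    (fun p : ℝ × ℝ => p.2 ^ n) =O[F] fun p => p.2 ^ m := by
  refine IsBigO.of_bound 1 ?_
  filter_upwards [eventually_abs_snd_lt hF one_pos] with p hp
  rw [one_mul, norm_pow, norm_pow, Real.norm_eq_abs]
  exact pow_le_pow_of_le_one (abs_nonneg _) hp.le h

theorem isBigO_pow_sub_pow {a b d : ℝ × ℝ → ℝ} (ha : a =O[F] d) (hb : b =O[F] d)
    (hab : (fun p => a p - b p) =O[F] fun p => d p ^ 2) (k : ℕ) :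
    (fun p => a p ^ k - b p ^ k) =O[F] fun p => d p ^ (k + 1) := by
  induction k with
  | zero => simpa using isBigO_zero _ _
  | succ n ih =>
    have h1 := (ha.pow n).mul hab
    have h2 := hb.mul ih
    refine ((h1.trans_eventuallyEq ?_).add (h2.trans_eventuallyEq ?_)).congr_left fun p => ?_
    · exact Eventually.of_forall fun p => by ring
    · exact Eventually.of_forall fun p => by ring
    · ring

theorem abs_sqrt_sub_sqrt_le (a b a' b' : ℝ) :
    |√(a ^ 2 + b ^ 2) - √(a' ^ 2 + b' ^ 2)| ≤ |a - a'| + |b - b'| := by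
  have key : ∀ a b a' b' : ℝ, √(a ^ 2 + b ^ 2) ≤ √(a' ^ 2 + b' ^ 2) + (|a - a'| + |b - b'|) := by
    intro a b a' b'
    have h := norm_add_le (⟨a', b'⟩ : ℂ) ⟨a - a', b - b'⟩
    have h2 := Complex.norm_le_abs_re_add_abs_im ⟨a - a', b - b'⟩
    have h3 : (⟨a', b'⟩ : ℂ) + ⟨a - a', b - b'⟩ = ⟨a, b⟩ := by
      apply Complex.ext <;> simp
    have hn : ∀ u v : ℝ, ‖(⟨u, v⟩ : ℂ)‖ = √(u ^ 2 + v ^ 2) := fun u v => by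
      rw [Complex.norm_eq_sqrt_sq_add_sq]
    rw [h3, hn, hn] at h
    simp only at h2
    linarith
  rw [abs_le]
  constructor
  · have := key a' b' a b
    rw [abs_sub_comm a', abs_sub_comm b'] at this
    linarith
  · linarith [key a b a' b']

/-- The error is relative to the gap with a factor tending to zero, so gap and square root are
comparable, here and in the converse estimate. -/
theorem GapFamily.sqrt_isBigO (h : GapFamily C e D c k F G α β) (hF : F ≤ 𝓝 0) :
    (fun p => √(α p ^ 2 + 4 * β p ^ 2)) =O[F] G := by
  refine IsBigO.of_bound 2 ?_
  filter_upwards [h.gap, h.gap_nonneg, eventually_mul_abs_fst_lt hF C one_pos] with p h1 h2 h3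
  rw [Real.norm_of_nonneg (Real.sqrt_nonneg _), Real.norm_of_nonneg h2]
  have := (abs_le.mp h1).2
  nlinarith

theorem GapFamily.isBigO_sqrt (h : GapFamily C e D c k F G α β) (hF : F ≤ 𝓝 0) :
    G =O[F] (fun p => √(α p ^ 2 + 4 * β p ^ 2)) := by
  refine IsBigO.of_bound 2 ?_
  filter_upwards [h.gap, h.gap_nonneg, eventually_mul_abs_fst_lt hF C (half_pos one_pos)] with
    p h1 h2 h3
  rw [Real.norm_of_nonneg (Real.sqrt_nonneg _), Real.norm_of_nonneg h2]
  have := (abs_le.mp h1).1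
  nlinarith

theorem isBigO_sqrt_left (F : Filter (ℝ × ℝ)) (α β : ℝ × ℝ → ℝ) :
    α =O[F] fun p => √(α p ^ 2 + 4 * β p ^ 2) :=
  IsBigO.of_bound 1 (Eventually.of_forall fun p => by
    rw [one_mul, Real.norm_of_nonneg (Real.sqrt_nonneg _)]
    exact Real.abs_le_sqrt (by nlinarith [sq_nonneg (β p)]))

theorem isBigO_sqrt_right (F : Filter (ℝ × ℝ)) (α β : ℝ × ℝ → ℝ) :
    β =O[F] fun p => √(α p ^ 2 + 4 * β p ^ 2) :=
  IsBigO.of_bound 1 (Eventually.of_forall fun p => by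
    rw [one_mul, Real.norm_of_nonneg (Real.sqrt_nonneg _)]
    exact Real.abs_le_sqrt (by nlinarith [sq_nonneg (β p), sq_nonneg (α p)]))

theorem sqrt_isBigO_of_isBigO {α β d : ℝ × ℝ → ℝ} (hα : α =O[F] d) (hβ : β =O[F] d) :
    (fun p => √(α p ^ 2 + 4 * β p ^ 2)) =O[F] d := by
  refine IsBigO.trans (IsBigO.of_bound 1 (Eventually.of_forall fun p => ?_))
    (hα.norm_left.add (hβ.norm_left.const_mul_left 2))
  have h := abs_sqrt_sub_sqrt_le (α p) (2 * β p) 0 0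
  simp only [ne_eq, OfNat.ofNat_ne_zero, not_false_eq_true, zero_pow, add_zero, Real.sqrt_zero,
    sub_zero, abs_mul, abs_two, mul_pow] at h
  rw [one_mul, Real.norm_eq_abs, Real.norm_of_nonneg (by positivity), Real.norm_eq_abs,
    Real.norm_eq_abs]
  convert h using 4
  norm_num

/-- If the diagonal difference is quadratically small then `τ` is close to `-e δ / D`. -/
theorem GapFamily.fst_isBigO (h : GapFamily C e D c k F G α β) (hF : F ≤ 𝓝 0) (hD : D ≠ 0)
    (hα : α =O[F] fun p => |p.1| ^ 2 + |p.2| ^ 2) :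
    (fun p : ℝ × ℝ => p.1) =O[F] (fun p => p.2) ∧
      (fun p : ℝ × ℝ => e * p.2 + D * p.1) =O[F] fun p => p.2 ^ 2 := by
  have h1 : (fun p : ℝ × ℝ => e * p.2 + D * p.1) =O[F] fun p => |p.1| ^ 2 + |p.2| ^ 2 := by
    have h2 : (fun p : ℝ × ℝ => α p - (|e * p.2 + D * p.1|)) =O[F]
        fun p => |p.1| ^ 2 + |p.2| ^ 2 := by
      refine IsBigO.of_bound C ?_
      filter_upwards [h.diag] with p hp
      rw [Real.norm_eq_abs, Real.norm_of_nonneg (by positivity), sq_abs, sq_abs]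
      exact hp
    exact ((hα.sub h2).congr_left fun p => by
      rw [sub_sub_cancel, Real.norm_eq_abs]).of_norm_left
  obtain ⟨M, hM, hb⟩ := h1.exists_pos
  -- Near the origin the term `M τ²` is at most half of `|D| |τ|` and is absorbed on the left.
  have hτ : (fun p : ℝ × ℝ => p.1) =O[F] (fun p => p.2) := by
    refine IsBigO.of_bound ((|e| + M) * 2 / |D|) ?_
    filter_upwards [hb.bound, eventually_abs_snd_lt hF one_pos,
      eventually_mul_abs_fst_lt hF M (half_pos (abs_pos.mpr hD))] with p hp h1 h2
    rw [Real.norm_eq_abs, Real.norm_of_nonneg (by positivity)] at hp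
    rw [Real.norm_eq_abs, Real.norm_eq_abs, div_mul_eq_mul_div, le_div_iff₀ (abs_pos.mpr hD)]
    have h3 : |D| * |p.1| ≤ |e| * |p.2| + |e * p.2 + D * p.1| := by
      rw [← abs_mul, ← abs_mul]
      have := abs_sub (e * p.2 + D * p.1) (e * p.2)
      rw [add_sub_cancel_left] at this
      linarith
    have h4 : M * |p.1| * |p.1| ≤ |D| / 2 * |p.1| := by gcongr
    have h5 : |p.2| * |p.2| ≤ 1 * |p.2| := by gcongr
    have h6 : M * (|p.2| * |p.2|) ≤ M * (1 * |p.2|) := by gcongr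
    nlinarith
  refine ⟨hτ, h1.trans ?_⟩
  refine ((hτ.pow 2).add (isBigO_refl (fun p : ℝ × ℝ => p.2 ^ 2) F)).congr_left fun p => ?_
  simp only [sq_abs]

theorem GapFamily.off_isBigO (h : GapFamily C e D c k F G α β)
    (hτ : (fun p : ℝ × ℝ => p.1) =O[F] (fun p => p.2)) :
    (fun p => β p - c * |p.1| ^ k) =O[F] fun p => p.2 ^ (k + 1) := by
  have h1 : (fun p => β p - c * |p.1| ^ k) =O[F] fun p => |p.1| ^ k * (|p.1| + |p.2|) := by
    refine IsBigO.of_bound C ?_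
    filter_upwards [h.off] with p hp
    rw [Real.norm_eq_abs, Real.norm_of_nonneg (by positivity), ← mul_assoc]
    exact hp
  refine h1.trans ?_
  have h2 := (hτ.norm_left.pow k).mul (hτ.norm_left.add (isBigO_refl (fun p : ℝ × ℝ => p.2) F).norm_left)
  exact h2.congr_right fun p => by ring

theorem GapFamily.gap_isBigO (h : GapFamily C e D c k F G α β)
    (hτ : (fun p : ℝ × ℝ => p.1) =O[F] (fun p => p.2)) {n : ℕ}
    (hG : G =O[F] fun p => p.2 ^ n) :
    (fun p => √(α p ^ 2 + 4 * β p ^ 2) - G p) =O[F] fun p => p.2 ^ (n + 1) := by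
  have h1 : (fun p => √(α p ^ 2 + 4 * β p ^ 2) - G p) =O[F] fun p => p.1 * G p := by
    refine IsBigO.of_bound C ?_
    filter_upwards [h.gap, h.gap_nonneg] with p hp h0
    rw [norm_mul, Real.norm_of_nonneg h0, ← mul_assoc]
    exact hp
  exact (h1.trans (hτ.mul hG)).congr_right fun p => by ring

/-- The off-diagonal element at `τ` close to `-e δ / D`. -/
theorem GapFamily.off_sub_isBigO (h : GapFamily C e D c k F G α β) (hF : F ≤ 𝓝 0) (hD : D ≠ 0)
    (hα : α =O[F] fun p => |p.1| ^ 2 + |p.2| ^ 2) :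
    (fun p => 2 * β p - 2 * c * |e * p.2 / D| ^ k) =O[F] fun p => p.2 ^ (k + 1) := by
  obtain ⟨hτ, hlin⟩ := h.fst_isBigO hF hD hα
  have h1 := h.off_isBigO hτ
  have hid := isBigO_refl (fun p : ℝ × ℝ => p.2) F
  have ht : (fun p : ℝ × ℝ => |e * p.2 / D|) =O[F] fun p => p.2 :=
    ((hid.const_mul_left (e / D)).congr_left fun p => by ring).norm_left
  have hsub : (fun p : ℝ × ℝ => |p.1| - |e * p.2 / D|) =O[F] fun p => p.2 ^ 2 := by
    refine IsBigO.trans (IsBigO.of_bound 1 (Eventually.of_forall fun p => ?_))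
      (hlin.const_mul_left D⁻¹)
    have h2 := abs_abs_sub_abs_le_abs_sub p.1 (-(e * p.2 / D))
    rw [abs_neg] at h2
    rw [one_mul, Real.norm_eq_abs, Real.norm_eq_abs]
    refine h2.trans_eq (congrArg abs ?_)
    field_simp
    ring
  have h2 := isBigO_pow_sub_pow hτ.norm_left ht hsub k
  refine ((h1.const_mul_left 2).add (h2.const_mul_left (2 * c))).congr_left fun p => ?_
  rw [Real.norm_eq_abs]
  ring

end Asymptotics

/-- A lower bound for `G` up to `O(δ ^ n)` only has to be shown where `G` is below the bound. -/
theorem exists_sub_le_of_isBigO {G R : ℝ × ℝ → ℝ} {m : ℝ → ℝ} {n : ℕ}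
    (hR : R =O[𝓝 0 ⊓ 𝓟 {p | G p < m p.2}] fun p => p.2 ^ n)
    (h : ∀ᶠ p in 𝓝 0 ⊓ 𝓟 {p | G p < m p.2}, m p.2 - G p ≤ |R p|) :
    ∃ M, ∀ᶠ p in 𝓝 (0 : ℝ × ℝ), m p.2 - M * |p.2| ^ n ≤ G p := by
  obtain ⟨M, hM, hb⟩ := hR.exists_pos
  refine ⟨M, ?_⟩
  filter_upwards [eventually_inf_principal.mp (h.and hb.bound)] with p hp
  have h0 : 0 ≤ M * |p.2| ^ n := by positivity
  by_cases hlt : G p < m p.2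
  · obtain ⟨h1, h2⟩ := hp hlt
    rw [norm_pow, Real.norm_eq_abs, Real.norm_eq_abs] at h2
    linarith
  · linarith [not_lt.mp hlt]

section Asymptotics

variable {C e D c : ℝ} {k : ℕ} {G : ℝ × ℝ → ℝ}

/-- Only points where the gap lies below the claimed bound matter. There `α` is `O(δ ^ k)`, which
pins `τ` to `-e δ / D` up to `O(δ²)`; this fixes `β`, and the square root is at least `2 β`. -/
theorem exists_lower_of_two_le (hk : 2 ≤ k) (hD : D ≠ 0)
    (h : ∀ᶠ p in 𝓝 (0 : ℝ × ℝ), ∃ α, GapBound C e D c k p.1 p.2 (G p) α) :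
    ∃ M, ∀ᶠ p in 𝓝 (0 : ℝ × ℝ), 2 * c * |e * p.2 / D| ^ k - M * |p.2| ^ (k + 1) ≤ G p := by
  set F := 𝓝 (0 : ℝ × ℝ) ⊓ 𝓟 {p | G p < 2 * c * |e * p.2 / D| ^ k} with hFdef
  have hF : F ≤ 𝓝 0 := inf_le_left
  obtain ⟨α, β, hfam, -⟩ := exists_gapFamily (P := fun _ _ => True)
    ((h.filter_mono hF).mono fun p ⟨α, hα⟩ => ⟨α, hα, trivial⟩)
  have hlt : ∀ᶠ p in F, G p < 2 * c * |e * p.2 / D| ^ k :=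
    eventually_inf_principal.mpr (Eventually.of_forall fun p hp => hp)
  have hG : G =O[F] fun p => p.2 ^ k := by
    refine IsBigO.of_bound (2 * c * |e / D| ^ k) ?_
    filter_upwards [hlt, hfam.gap_nonneg] with p h1 h2
    rw [Real.norm_of_nonneg h2, norm_pow, Real.norm_eq_abs, mul_assoc, ← mul_pow, ← abs_mul,
      div_mul_eq_mul_div]
    exact h1.le
  have hα : α =O[F] fun p => p.2 ^ k :=
    (isBigO_sqrt_left F α β).trans ((hfam.sqrt_isBigO hF).trans hG)
  -- The place where `k ≥ 2` is used: `O(δ ^ k)` is then within the quadratic error of the diagonal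
  -- expansion.
  have hα2 : α =O[F] fun p => |p.1| ^ 2 + |p.2| ^ 2 := by
    refine (hα.trans (isBigO_pow_snd hF hk)).trans (IsBigO.of_bound 1 ?_)
    refine Eventually.of_forall fun p => ?_
    rw [norm_pow, Real.norm_eq_abs, Real.norm_of_nonneg (by positivity)]
    linarith [sq_nonneg |p.1|]
  have hτ := (hfam.fst_isBigO hF hD hα2).1
  have h1 := hfam.off_sub_isBigO hF hD hα2
  have h2 := hfam.gap_isBigO hτ hG
  refine exists_sub_le_of_isBigO (G := G) (m := fun δ => 2 * c * |e * δ / D| ^ k)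
    (h1.norm_left.add h2.norm_left) ?_
  filter_upwards with p
  rw [Real.norm_eq_abs, Real.norm_eq_abs]
  refine le_trans ?_ (le_abs_self _)
  have h3 : 2 * β p ≤ √(α p ^ 2 + 4 * β p ^ 2) :=
    Real.le_sqrt_of_sq_le (by nlinarith [sq_nonneg (α p)])
  have h4 := neg_abs_le (2 * β p - 2 * c * |e * p.2 / D| ^ k)
  have h5 := le_abs_self (√(α p ^ 2 + 4 * β p ^ 2) - G p)
  linarith

/-- At a near-zero of the diagonal difference the square root is at most `α + 2 β`, and `α = O(τ ^
(k + 1)) = O(δ ^ (k + 1))` goes into the error. -/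
theorem exists_upper_of_pos (hk : 1 ≤ k) (hD : D ≠ 0)
    (h : ∀ κ > 0, ∀ᶠ δ in 𝓝 (0 : ℝ), ∃ τ α : ℝ, |τ| < κ ∧
      GapBound C e D c k τ δ (G (τ, δ)) α ∧ α ≤ C * |τ| ^ (k + 1)) :
    ∃ M, ∀ κ > 0, ∀ᶠ δ in 𝓝 (0 : ℝ), ∃ τ, |τ| < κ ∧
      G (τ, δ) ≤ 2 * c * |e * δ / D| ^ k + M * |δ| ^ (k + 1) := by
  set S : Set (ℝ × ℝ) :=
    {p | ∃ α, GapBound C e D c k p.1 p.2 (G p) α ∧ α ≤ C * |p.1| ^ (k + 1)} with hS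
  set F := 𝓝 (0 : ℝ × ℝ) ⊓ 𝓟 S with hFdef
  have hF : F ≤ 𝓝 0 := inf_le_left
  obtain ⟨α, β, hfam, hαle⟩ := exists_gapFamily (P := fun p α => α ≤ C * |p.1| ^ (k + 1))
    (show ∀ᶠ p in F, _ from eventually_inf_principal.mpr (Eventually.of_forall fun p hp => hp))
  have hα1 : α =O[F] fun p => p.1 ^ (k + 1) := by
    refine IsBigO.of_bound C ?_
    filter_upwards [hαle, hfam.diag_nonneg] with p h1 h2
    rwa [Real.norm_of_nonneg h2, norm_pow, Real.norm_eq_abs]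
  have hα2 : α =O[F] fun p => |p.1| ^ 2 + |p.2| ^ 2 := by
    refine hα1.trans (IsBigO.of_bound 1 ?_)
    filter_upwards [eventually_abs_fst_lt hF one_pos] with p hp
    rw [norm_pow, Real.norm_eq_abs, Real.norm_of_nonneg (by positivity)]
    have := pow_le_pow_of_le_one (abs_nonneg p.1) hp.le (show 2 ≤ k + 1 by omega)
    linarith [sq_nonneg |p.2|]
  have hτ := (hfam.fst_isBigO hF hD hα2).1
  have hα := hα1.trans (hτ.pow (k + 1))
  have hoff := hfam.off_isBigO hτ
  have hβ : β =O[F] fun p => p.2 ^ k := by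
    have h1 := (hoff.trans (isBigO_pow_snd hF k.le_succ)).add
      ((hτ.norm_left.pow k).const_mul_left c)
    refine h1.congr_left fun p => ?_
    rw [Real.norm_eq_abs]; ring
  have hG : G =O[F] fun p => p.2 ^ k :=
    (hfam.isBigO_sqrt hF).trans
      (sqrt_isBigO_of_isBigO (hα.trans (isBigO_pow_snd hF k.le_succ)) hβ)
  have h1 := hfam.off_sub_isBigO hF hD hα2
  have h2 := hfam.gap_isBigO hτ hG
  obtain ⟨M, hM, hb⟩ := (hα.norm_left.add (h1.norm_left.add h2.norm_left)).exists_pos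
  -- Both `M` and the radius are fixed before `κ`, so the constant does not depend on how small `τ`
  -- has to be.
  obtain ⟨r, hr, hball⟩ := Metric.eventually_nhds_iff.mp (eventually_inf_principal.mp
    (hb.bound.and (hfam.diag_nonneg.and hfam.off_nonneg)))
  refine ⟨M, fun κ hκ => ?_⟩
  filter_upwards [h (min κ r) (by positivity),
    (continuous_abs.tendsto' (0 : ℝ) 0 abs_zero).eventually_lt_const hr] with δ ⟨τ, α', hτκ, hα'⟩ hδ
  refine ⟨τ, hτκ.trans_le (min_le_left _ _), ?_⟩
  obtain ⟨hp, h0, h0'⟩ := hball (y := (τ, δ)) (by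
    rw [Prod.dist_eq, Prod.fst_zero, Prod.snd_zero, Real.dist_0_eq_abs, Real.dist_0_eq_abs]
    exact max_lt (hτκ.trans_le (min_le_right _ _)) hδ) ⟨α', hα'⟩
  rw [norm_pow] at hp
  simp only [Real.norm_eq_abs] at hp
  have hp' := (le_abs_self _).trans hp
  have h3 : √(α (τ, δ) ^ 2 + 4 * β (τ, δ) ^ 2) ≤ α (τ, δ) + 2 * β (τ, δ) := by
    rw [Real.sqrt_le_left (by positivity)]
    nlinarith [mul_nonneg h0 h0']
  have h4 := le_abs_self (2 * β (τ, δ) - 2 * c * |e * δ / D| ^ k)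
  have h5 := neg_abs_le (√(α (τ, δ) ^ 2 + 4 * β (τ, δ) ^ 2) - G (τ, δ))
  have h6 := le_abs_self (α (τ, δ))
  linarith

/-- For `k = 1` the gap agrees to second order with that of a linear 2×2 model. -/
theorem GapFamily.gap_sub_model_isBigO {F : Filter (ℝ × ℝ)} {α β : ℝ × ℝ → ℝ}
    (h : GapFamily C e D c 1 F G α β) (hF : F ≤ 𝓝 0)
    (hτ : (fun p : ℝ × ℝ => p.1) =O[F] (fun p => p.2)) :
    (fun p => G p - √((e * p.2 + D * p.1) ^ 2 + (2 * c * p.1) ^ 2)) =O[F] fun p => p.2 ^ 2 := by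
  have hid := isBigO_refl (fun p : ℝ × ℝ => p.2) F
  have hoff : (fun p => β p - c * |p.1|) =O[F] fun p => p.2 ^ 2 := by
    simpa using h.off_isBigO hτ
  have hdiag : (fun p => α p - (|e * p.2 + D * p.1|)) =O[F] fun p => p.2 ^ 2 := by
    have h1 : (fun p => α p - (|e * p.2 + D * p.1|)) =O[F] fun p => p.1 ^ 2 + p.2 ^ 2 := by
      refine IsBigO.of_bound C ?_
      filter_upwards [h.diag] with p hp
      rwa [Real.norm_eq_abs, Real.norm_of_nonneg (by positivity)]
    exact h1.trans ((hτ.pow 2).add (hid.pow 2))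
  have hlin : (fun p : ℝ × ℝ => |e * p.2 + D * p.1|) =O[F] fun p => p.2 :=
    ((hid.const_mul_left e).add (hτ.const_mul_left D)).norm_left
  have hsq : (fun p : ℝ × ℝ => p.2 ^ 2) =O[F] fun p => p.2 := by
    simpa using isBigO_pow_snd hF one_le_two
  have hα : α =O[F] fun p => p.2 :=
    ((hdiag.trans hsq).add hlin).congr_left fun p => by ring
  have hβ : β =O[F] fun p => p.2 :=
    ((hoff.trans hsq).add (hτ.norm_left.const_mul_left c)).congr_left fun p => by
      rw [Real.norm_eq_abs]; ring
  have hG : G =O[F] fun p => p.2 ^ 1 := by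
    simpa using (h.isBigO_sqrt hF).trans (sqrt_isBigO_of_isBigO hα hβ)
  have h2 := h.gap_isBigO hτ hG
  have h3 : (fun p => √(α p ^ 2 + 4 * β p ^ 2) -
      √((e * p.2 + D * p.1) ^ 2 + (2 * c * p.1) ^ 2)) =O[F] fun p => p.2 ^ 2 := by
    refine IsBigO.trans (IsBigO.of_bound 1 (Eventually.of_forall fun p => ?_))
      (hdiag.norm_left.add (hoff.norm_left.const_mul_left 2))
    have h4 := abs_sqrt_sub_sqrt_le (α p) (2 * β p) |e * p.2 + D * p.1| (2 * c * |p.1|)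
    have h5 : (2 * β p) ^ 2 = 4 * β p ^ 2 := by ring
    have h6 : (2 * c * |p.1|) ^ 2 = (2 * c * p.1) ^ 2 := by rw [mul_pow, sq_abs, ← mul_pow]
    have h7 : |2 * β p - 2 * c * (|p.1|)| = 2 * |β p - c * (|p.1|)| := by
      rw [mul_assoc, ← mul_sub, abs_mul, abs_two]
    rw [h5, h6, h7, sq_abs] at h4
    rw [one_mul, Real.norm_of_nonneg (by positivity : (0 : ℝ) ≤ _ + _)]
    exact h4
  refine ((h3.sub (by simpa using h2))).congr_left fun p => by ring

/-- The linear 2×2 model is bounded below by its gap at the avoided crossing. -/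
theorem le_model (e D c τ δ : ℝ) (hc : 0 < c) :
    2 * c * |e * δ| / √(D ^ 2 + (2 * c) ^ 2) ≤ √((e * δ + D * τ) ^ 2 + (2 * c * τ) ^ 2) := by
  rw [div_le_iff₀ (by positivity), ← Real.sqrt_mul (by positivity)]
  refine Real.le_sqrt_of_sq_le ?_
  rw [mul_pow, sq_abs]
  -- After clearing the denominator the two squared sides differ by exactly this square; its zero in
  -- `τ` is the minimiser.
  nlinarith [sq_nonneg (D * (e * δ) + (D ^ 2 + (2 * c) ^ 2) * τ)]

theorem model_eq (e D c δ : ℝ) (hc : 0 < c) :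
    √((e * δ + D * (-(D * e / (D ^ 2 + (2 * c) ^ 2)) * δ)) ^ 2 +
      (2 * c * (-(D * e / (D ^ 2 + (2 * c) ^ 2)) * δ)) ^ 2) =
      2 * c * |e * δ| / √(D ^ 2 + (2 * c) ^ 2) := by
  have hq : 0 < D ^ 2 + (2 * c) ^ 2 := by positivity
  rw [Real.sqrt_eq_iff_eq_sq (by positivity) (by positivity), div_pow, Real.sq_sqrt hq.le,
    mul_pow _ (|e * δ|), sq_abs]
  field_simp
  ring

/-- Where the gap lies below the claimed bound, `β = O(δ)`. Since `β` is comparable to `c |τ|`, this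
forces `τ = O(δ)` without any condition on `D`, and the linear model applies. -/
theorem exists_lower_of_eq_one (hc : 0 < c)
    (h : ∀ᶠ p in 𝓝 (0 : ℝ × ℝ), ∃ α, GapBound C e D c 1 p.1 p.2 (G p) α) :
    ∃ M, ∀ᶠ p in 𝓝 (0 : ℝ × ℝ),
      2 * c * |e * p.2| / √(D ^ 2 + (2 * c) ^ 2) - M * |p.2| ^ 2 ≤ G p := by
  set F := 𝓝 (0 : ℝ × ℝ) ⊓ 𝓟 {p | G p < 2 * c * |e * p.2| / √(D ^ 2 + (2 * c) ^ 2)} with hFdef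
  have hF : F ≤ 𝓝 0 := inf_le_left
  obtain ⟨α, β, hfam, -⟩ := exists_gapFamily (P := fun _ _ => True)
    ((h.filter_mono hF).mono fun p ⟨α, hα⟩ => ⟨α, hα, trivial⟩)
  have hlt : ∀ᶠ p in F, G p < 2 * c * |e * p.2| / √(D ^ 2 + (2 * c) ^ 2) :=
    eventually_inf_principal.mpr (Eventually.of_forall fun p hp => hp)
  have hG : G =O[F] fun p => p.2 := by
    refine IsBigO.of_bound (2 * c * |e| / √(D ^ 2 + (2 * c) ^ 2)) ?_
    filter_upwards [hlt, hfam.gap_nonneg] with p h1 h2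
    rw [Real.norm_of_nonneg h2, Real.norm_eq_abs, div_mul_eq_mul_div, mul_assoc _ (|e|), ← abs_mul]
    exact h1.le
  have hβ : β =O[F] fun p => p.2 :=
    (isBigO_sqrt_right F α β).trans ((hfam.sqrt_isBigO hF).trans hG)
  have hτ : (fun p : ℝ × ℝ => p.1) =O[F] (fun p => p.2) := by
    refine IsBigO.trans (IsBigO.of_bound (2 / c) ?_) hβ
    filter_upwards [hfam.off, hfam.off_nonneg, hF ((continuous_const.mul
      (continuous_fst.abs.add continuous_snd.abs) |>.tendsto' (0 : ℝ × ℝ) 0 (by simp)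
      : Tendsto (fun p : ℝ × ℝ => C * (|p.1| + |p.2|)) _ _).eventually_lt_const (half_pos hc))]
      with p h1 h2 h3
    rw [Real.norm_eq_abs, Real.norm_of_nonneg h2, div_mul_eq_mul_div, le_div_iff₀ hc]
    have h4 := (abs_le.mp h1).1
    have h5 : C * (|p.1| + |p.2|) < c / 2 := h3
    rw [pow_one] at h4
    nlinarith [abs_nonneg p.1]
  refine exists_sub_le_of_isBigO (G := G) (m := fun δ => 2 * c * |e * δ| / √(D ^ 2 + (2 * c) ^ 2))
    (hfam.gap_sub_model_isBigO hF hτ) ?_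
  filter_upwards with p
  have h1 := le_model e D c p.1 p.2 hc
  have h2 := neg_abs_le (G p - √((e * p.2 + D * p.1) ^ 2 + (2 * c * p.1) ^ 2))
  linarith

theorem exists_upper_of_eq_one (hc : 0 < c)
    (h : ∀ᶠ p in 𝓝 (0 : ℝ × ℝ), ∃ α, GapBound C e D c 1 p.1 p.2 (G p) α) :
    ∃ M, ∀ κ > 0, ∀ᶠ δ in 𝓝 (0 : ℝ), ∃ τ, |τ| < κ ∧
      G (τ, δ) ≤ 2 * c * |e * δ| / √(D ^ 2 + (2 * c) ^ 2) + M * |δ| ^ 2 := by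
  -- Slope of the line of minimisers of the linear model; the bounds are evaluated along this line
  -- only.
  set t := -(D * e / (D ^ 2 + (2 * c) ^ 2)) with ht
  set F := map (fun δ : ℝ => (t * δ, δ)) (𝓝 0) with hFdef
  have hF : F ≤ 𝓝 0 :=
    Continuous.tendsto' (f := fun δ : ℝ => (t * δ, δ)) (by fun_prop) 0 0 (by simp)
  obtain ⟨α, β, hfam, -⟩ := exists_gapFamily (P := fun _ _ => True)
    ((h.filter_mono hF).mono fun p ⟨α, hα⟩ => ⟨α, hα, trivial⟩)
  have hτ : (fun p : ℝ × ℝ => p.1) =O[F] (fun p => p.2) := by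
    refine IsBigO.of_bound |t| (eventually_map.mpr (Eventually.of_forall fun δ => ?_))
    rw [norm_mul, Real.norm_eq_abs]
  obtain ⟨M, hM, hb⟩ := (hfam.gap_sub_model_isBigO hF hτ).exists_pos
  refine ⟨M, fun κ hκ => ?_⟩
  have htend : Tendsto (fun δ : ℝ => |t * δ|) (𝓝 0) (𝓝 0) :=
    Continuous.tendsto' (by fun_prop) 0 0 (by simp)
  filter_upwards [eventually_map.mp hb.bound, htend.eventually_lt_const hκ] with δ h1 h2
  refine ⟨t * δ, h2, ?_⟩
  rw [model_eq e D c δ hc, norm_pow, Real.norm_eq_abs, Real.norm_eq_abs] at h1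
  linarith [le_abs_self (G (t * δ, δ) - 2 * c * |e * δ| / √(D ^ 2 + (2 * c) ^ 2))]

theorem GapBound.eq_zero (hk : k ≠ 0) {g α : ℝ} (h : GapBound C e D c k 0 0 g α) : g = 0 := by
  obtain ⟨-, h0, h1, β, -, h2, h3⟩ := h
  simp only [hk, mul_zero, add_zero, abs_zero, sub_zero, ne_eq, OfNat.ofNat_ne_zero,
    not_false_eq_true, zero_pow, zero_mul, abs_nonpos_iff] at h1 h2 h3
  rw [h1, h2] at h3
  simpa using h3

/-- A gap with nonzero leading coefficient vanishes only at the origin. -/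
theorem eventually_gap_ne_zero (he : e ≠ 0) (hc : 0 < c)
    (h : ∀ᶠ p in 𝓝 (0 : ℝ × ℝ), ∃ α, GapBound C e D c k p.1 p.2 (G p) α) :
    ∀ᶠ p in 𝓝[≠] (0 : ℝ × ℝ), G p ≠ 0 := by
  have h1 : ∀ᶠ p in 𝓝 (0 : ℝ × ℝ), C * (|p.1| + |p.2|) < c :=
    (Continuous.tendsto' (by fun_prop) 0 0 (by simp)).eventually_lt_const hc
  have h2 : ∀ᶠ p in 𝓝 (0 : ℝ × ℝ), C * |p.2| < |e| :=
    (Continuous.tendsto' (by fun_prop) 0 0 (by simp)).eventually_lt_const (abs_pos.mpr he)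
  filter_upwards [nhdsWithin_le_nhds h, nhdsWithin_le_nhds h1, nhdsWithin_le_nhds h2,
    self_mem_nhdsWithin] with p ⟨α, hα⟩ h1 h2 hp hG
  obtain ⟨-, h0, h3, β, hβ, h4, h5⟩ := hα
  -- A zero gap makes the relative error zero, so `α = β = 0`. Since the error of `β` is smaller
  -- than `c |τ| ^ k`, it follows that `τ = 0`, and `α = 0` then leaves `|e| |δ| ≤ C δ²`.
  rw [hG, mul_zero, sub_zero, abs_nonpos_iff, Real.sqrt_eq_zero (by positivity)] at h5
  have hα0 : α = 0 := by nlinarith [sq_nonneg α, sq_nonneg β]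
  have hβ0 : β = 0 := by nlinarith [sq_nonneg α, sq_nonneg β]
  have hτ : p.1 = 0 := by
    rw [hβ0, zero_sub, abs_neg, abs_of_nonneg (by positivity)] at h4
    by_contra hne
    have : 0 < |p.1| ^ k := pow_pos (abs_pos.mpr hne) k
    nlinarith
  have hδ : p.2 = 0 := by
    rw [hα0, hτ, zero_sub, abs_neg, abs_abs, mul_zero, add_zero, abs_mul, zero_pow two_ne_zero,
      zero_add, ← sq_abs] at h3
    by_contra hne
    have : 0 < |p.2| := abs_pos.mpr hne
    nlinarith
  exact hp (Prod.ext hτ hδ)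

end Asymptotics

/-- Uniform bounds on a gap function give the asymptotics of its infimum along a segment. -/
theorem sInf_sub_isBigO {G : ℝ × ℝ → ℝ} {m : ℝ → ℝ} {n : ℕ} {Δs : ℝ} (hΔs : Δs ≠ 0)
    (hlow : ∃ M, ∀ᶠ p in 𝓝 (0 : ℝ × ℝ), m p.2 - M * |p.2| ^ n ≤ G p)
    (hup : ∃ M, ∀ κ > 0, ∀ᶠ δ in 𝓝 (0 : ℝ), ∃ τ, |τ| < κ ∧ G (τ, δ) ≤ m δ + M * |δ| ^ n) :
    ∀ᶠ η in 𝓝[>] (0 : ℝ),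
      (fun δ : ℝ => sInf ((fun f : ℝ => G ((Δs + δ) * (1 - f), δ)) '' Set.Icc (1 - η) (1 + η)) -
        m δ) =O[𝓝 0] fun δ : ℝ => δ ^ n := by
  obtain ⟨M₁, h₁⟩ := hlow
  obtain ⟨M₂, h₂⟩ := hup
  obtain ⟨r, hr, hball⟩ := Metric.eventually_nhds_iff.mp h₁
  have hpos := abs_pos.mpr hΔs
  -- For small `δ` one has `|Δs + δ| ≤ 2 |Δs|`, so this bound on `η` keeps every `τ = (Δs + δ)(1 -
  -- f)` of the segment inside the radius `r`.
  filter_upwards [Ioo_mem_nhdsGT (show 0 < r / (2 * |Δs|) by positivity)] with η hη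
  refine IsBigO.of_bound (|M₁| + |M₂|) ?_
  have hsmall : ∀ {s : ℝ}, 0 < s → ∀ᶠ δ in 𝓝 (0 : ℝ), |δ| < s := fun hs =>
    (continuous_abs.tendsto' (0 : ℝ) 0 abs_zero).eventually_lt_const hs
  -- As `|Δs + δ| ≥ |Δs| / 2`, a `τ` below this threshold corresponds to some `f` within `η` of 1.
  filter_upwards [h₂ (η * (|Δs| / 2)) (mul_pos hη.1 (by positivity)), hsmall hr,
    hsmall (half_pos hpos)] with δ ⟨τ, hτ, hle⟩ hδ hδ'
  have hlb : |Δs| / 2 ≤ |Δs + δ| := by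
    have := abs_sub (Δs + δ) δ
    rw [add_sub_cancel_right] at this
    linarith
  have hub : |Δs + δ| ≤ 2 * |Δs| := (abs_add_le _ _).trans (by linarith)
  have hne : Δs + δ ≠ 0 := abs_pos.mp (by linarith)
  have hrη := (lt_div_iff₀ (by positivity)).mp hη.2
  have hlower : ∀ w ∈ (fun f : ℝ => G ((Δs + δ) * (1 - f), δ)) '' Set.Icc (1 - η) (1 + η),
      m δ - M₁ * |δ| ^ n ≤ w := by
    rintro _ ⟨f, hf, rfl⟩
    refine hball (y := ((Δs + δ) * (1 - f), δ)) ?_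
    rw [Prod.dist_eq, Prod.fst_zero, Prod.snd_zero, Real.dist_0_eq_abs, Real.dist_0_eq_abs]
    refine max_lt ?_ hδ
    have hf' : |1 - f| ≤ η := abs_le.mpr ⟨by linarith [hf.2], by linarith [hf.1]⟩
    calc |(Δs + δ) * (1 - f)| = |Δs + δ| * |1 - f| := abs_mul _ _
      _ ≤ 2 * |Δs| * η := by gcongr
      _ < r := by linarith
  have hmem : G (τ, δ) ∈ (fun f : ℝ => G ((Δs + δ) * (1 - f), δ)) '' Set.Icc (1 - η) (1 + η) := by
    refine ⟨1 - τ / (Δs + δ), ?_, ?_⟩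
    · have : |τ / (Δs + δ)| ≤ η := by
        rw [abs_div, div_le_iff₀ (by linarith)]
        exact hτ.le.trans (mul_le_mul_of_nonneg_left hlb hη.1.le)
      have := abs_le.mp this
      constructor <;> linarith
    · simp only [sub_sub_cancel]
      rw [mul_div_cancel₀ _ hne]
  have h3 := le_csInf ⟨_, hmem⟩ hlower
  have h4 := csInf_le ⟨_, hlower⟩ hmem
  rw [norm_pow, Real.norm_eq_abs, Real.norm_eq_abs, abs_le]
  have h5 : M₁ * |δ| ^ n ≤ |M₁| * |δ| ^ n := by gcongr; exact le_abs_self _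
  have h6 : M₂ * |δ| ^ n ≤ |M₂| * |δ| ^ n := by gcongr; exact le_abs_self _
  have h7 : 0 ≤ |M₁| * |δ| ^ n := by positivity
  have h8 : 0 ≤ |M₂| * |δ| ^ n := by positivity
  constructor <;> linarith

/-! ### Passage from operators to matrices. -/

section Representation

variable {V : Type*} [NormedAddCommGroup V] [InnerProductSpace ℂ V]
variable {ι : Type*} [Fintype ι]

theorem matElem_ne_zero_of_isKCoupled_one {b : OrthonormalBasis ι ℂ V} {Hmix : V →L[ℂ] V} {x y : ι}
    (hk : IsKCoupled b Hmix x y 1) :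
    matElem b Hmix x y ≠ 0 := by
  obtain ⟨s, h1, h2, h3⟩ := hk.1
  rw [pathWeight, Fin.prod_univ_one] at h3
  rwa [← h1, ← h2]

theorem matElem_conjTranspose [CompleteSpace V] (b : OrthonormalBasis ι ℂ V) {A : V →L[ℂ] V}
    (hA : IsSelfAdjoint A) : (Matrix.of (matElem b A))ᴴ = Matrix.of (matElem b A) := by
  ext i j
  rw [conjTranspose_apply, Matrix.of_apply, Matrix.of_apply, matElem, matElem, Complex.star_def,
    inner_conj_symm]
  exact hA.isSymmetric (b i) (b j)

/-- The matrix of an operator in an orthonormal basis, as an algebra homomorphism. -/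
noncomputable def matRep [DecidableEq ι] (b : OrthonormalBasis ι ℂ V) :
    (V →L[ℂ] V) →ₐ[ℂ] Matrix ι ι ℂ :=
  AlgHom.ofLinearMap
    ((LinearMap.toMatrix b.toBasis b.toBasis).toLinearMap.comp (ContinuousLinearMap.coeLM ℂ))
    (LinearMap.toMatrix_one b.toBasis) fun A B => LinearMap.toMatrix_mul b.toBasis A B

variable [DecidableEq ι]

theorem matRep_eq (b : OrthonormalBasis ι ℂ V) (A : V →L[ℂ] V) :
    matRep b A = Matrix.of (matElem b A) := by
  ext i j
  rw [Matrix.of_apply, matElem, ← b.repr_apply_apply]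
  exact LinearMap.toMatrix_apply _ _ _ _ _

theorem matRep_cost {b : OrthonormalBasis ι ℂ V} {A : V →L[ℂ] V} {E : ι → ℝ}
    (hE : ∀ i, A (b i) = (E i : ℂ) • b i) : matRep b A = diagonal fun i => (E i : ℂ) := by
  rw [matRep_eq]
  ext i j
  rw [Matrix.of_apply, matElem, hE, inner_smul_right, orthonormal_iff_ite.mp b.orthonormal,
    diagonal_apply]
  split_ifs with h
  · rw [h, mul_one]
  · rw [mul_zero]

variable [FiniteDimensional ℂ V]

theorem matRep_exp (b : OrthonormalBasis ι ℂ V) (A : V →L[ℂ] V) :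
    matRep b (NormedSpace.exp A) = NormedSpace.exp (matRep b A) :=
  haveI : CompleteSpace V := FiniteDimensional.complete ℂ V
  NormedSpace.map_exp_of_mem_ball (𝕂 := ℂ) (matRep b)
    (matRep b).toLinearMap.continuous_of_finiteDimensional A
    ((NormedSpace.expSeries_radius_eq_top ℂ (V →L[ℂ] V)).symm ▸ edist_lt_top _ _)

/-- The change of parameters is `τ = Δ (1 - f)`, `δ = Δ - Δs`, for which `Δ f = Δs + δ - τ`. -/
theorem matRep_unitary {b : OrthonormalBasis ι ℂ V} {Hmix Hcost : V →L[ℂ] V} {E : ι → ℝ}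
    (hE : ∀ i, Hcost (b i) = (E i : ℂ) • b i) (Δs f Δ : ℝ) :
    matRep b (unitary Hmix Hcost f Δ) =
      evol (fun τ : ℝ => (τ : ℂ) • Matrix.of (matElem b Hmix)) E Δs (Δ * (1 - f)) (Δ - Δs) := by
  rw [unitary, map_mul, matRep_exp, matRep_exp, map_smul, map_smul, matRep_eq b Hmix,
    matRep_cost hE, evol, phaseDiag, ← diagonal_smul, Matrix.exp_diagonal, smul_smul]
  congr 1
  · congr 2; push_cast; ring
  · congr 1
    funext z
    rw [Pi.coe_exp, Complex.exp_eq_exp_ℂ, Pi.smul_apply, smul_eq_mul]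
    congr 1; push_cast; ring

theorem eigenvaluesIn_eq (b : OrthonormalBasis ι ℂ V) (U : V →L[ℂ] V) (z : ℂ) (ρ : ℝ) :
    eigenvaluesIn U z ρ = (matRep b U).charpoly.roots.filter fun d => ‖d - z‖ < ρ := by
  rw [eigenvaluesIn, ← LinearMap.charpoly_toMatrix (U : V →ₗ[ℂ] V) b.toBasis]
  simp only [Metric.mem_ball, dist_eq_norm]
  congr 1

end Representation

section Matrix

variable {ι : Type*} [Fintype ι] [DecidableEq ι]

/-- The gap of the matrix evolution at the parameters `(τ, δ)`. -/
noncomputable def matGap (H : Matrix ι ι ℂ) (E : ι → ℝ) (Δs : ℝ) (l₀ : ℂ) (ρ : ℝ) (p : ℝ × ℝ) : ℝ :=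
  Metric.diam {w : ℂ | w ∈ (evol (fun τ : ℝ => (τ : ℂ) • H) E Δs p.1 p.2).charpoly.roots.filter
    fun d => ‖d - l₀‖ < ρ}

theorem matGap_eq {H : Matrix ι ι ℂ} {E : ι → ℝ} {Δs : ℝ} {l₀ : ℂ} {ρ τ δ : ℝ} {l₁ l₂ : ℂ}
    (h : (evol (fun τ : ℝ => (τ : ℂ) • H) E Δs τ δ).charpoly.roots.filter (fun d => ‖d - l₀‖ < ρ) =
      {l₁, l₂}) : matGap H E Δs l₀ ρ (τ, δ) = ‖l₁ - l₂‖ := by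
  have : {w : ℂ | w ∈ ({l₁, l₂} : Multiset ℂ)} = {l₁, l₂} := by
    ext w
    simp
  rw [matGap, h, this, Metric.diam_pair, dist_eq_norm]

end Matrix

/-! ### Translation of the operator hypotheses and quantities. -/

section Operator

variable {V : Type*} [NormedAddCommGroup V] [InnerProductSpace ℂ V]
variable {ι : Type*} [Fintype ι] {b : OrthonormalBasis ι ℂ V} {Hmix Hcost : V →L[ℂ] V}
variable {E : ι → ℝ} {Δs : ℝ} {x y : ι} {k : ℕ}

theorem sin_ne_zero_of_exp_ne {s a c : ℝ}
    (h : Complex.exp (-Complex.I * s * a) ≠ Complex.exp (-Complex.I * s * c)) :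
    Real.sin (s / 2 * (a - c)) ≠ 0 := by
  intro h0
  obtain ⟨n, hn⟩ := Real.sin_eq_zero_iff.mp h0
  refine h (Complex.exp_eq_exp_iff_exists_int.mpr ⟨-n, ?_⟩)
  have hn' : (n : ℂ) * Real.pi = s / 2 * (a - c) := by exact_mod_cast congrArg Complex.ofReal hn
  push_cast
  linear_combination 2 * Complex.I * hn'

theorem exp_eq_exp_two_mul (s a c : ℝ) : Complex.exp (-Complex.I * s * a) =
    Complex.exp (-2 * Complex.I * ((s / 2 * (a - c) : ℝ) : ℂ)) * Complex.exp (-Complex.I * s * c) := by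
  rw [← Complex.exp_add]
  congr 1
  push_cast
  ring

/-- The two coefficients differ by the unimodular factor `l₀ (-i)^k`. -/
theorem norm_offCoeff [DecidableEq ι] (hxy : x ≠ y)
    (hwrap : Complex.exp (-Complex.I * Δs * E x) = Complex.exp (-Complex.I * Δs * E y))
    (hother : ∀ z, z ≠ x → z ≠ y →
      Complex.exp (-Complex.I * Δs * E z) ≠ Complex.exp (-Complex.I * Δs * E x))
    (hk : IsKCoupled b Hmix x y k) :
    ‖offCoeff (Matrix.of (matElem b Hmix)) E Δs x y (Complex.exp (-Complex.I * Δs * E x))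
      (hopDist b Hmix y k)‖ = ‖cEff b Hmix E Δs x y k‖ := by
  have hpos := isKCoupled_pos hk hxy
  obtain ⟨n, hn⟩ : ∃ n, k = n + 1 := ⟨k - 1, by omega⟩
  have h := feshbach_apply_of_grading (x := x) (y := y) (e := hopDist b Hmix y k)
    (K := gaugedHop (Matrix.of (matElem b Hmix)) (hopDist b Hmix y k) 0)
    (w := fun z => Complex.exp (-Complex.I * Δs * E z))
    (gaugedHop_zero_grading fun z z' h => hopDist_le_add_one h) hopDist_le (Complex.exp_ne_zero _)
    hother hwrap.symm hxy (hopDist_eq_zero_iff hpos) (hopDist_of_isKCoupled hk)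
    (fun z => Real.cot (Δs / 2 * (E z - E x))) (fun z hzx hzy => by
      simp only [exp_eq_exp_two_mul Δs (E z) (E x)]
      exact one_add_I_cot_mul _ _ (sin_ne_zero_of_exp_ne (hother z hzx hzy))) hn
  rw [offCoeff, evol, phaseDiag_zero, h, cEff_eq_walkSum hk E Δs hn, norm_mul, norm_mul,
    norm_exp_neg_I_mul_mul, norm_pow, norm_neg, Complex.norm_I, one_pow, one_mul, one_mul]

variable [FiniteDimensional ℂ V]

theorem gapIn_unitary [DecidableEq ι] (hE : ∀ i, Hcost (b i) = (E i : ℂ) • b i) (Δs : ℝ) (l₀ : ℂ)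
    (ρ f Δ : ℝ) : gapIn (unitary Hmix Hcost f Δ) l₀ ρ =
      matGap (Matrix.of (matElem b Hmix)) E Δs l₀ ρ (Δ * (1 - f), Δ - Δs) := by
  rw [gapIn, matGap, eigenvaluesIn_eq b, matRep_unitary hE Δs]

theorem avoidedGap_eq [DecidableEq ι] (hE : ∀ i, Hcost (b i) = (E i : ℂ) • b i) (Δs : ℝ) (l₀ : ℂ)
    (ρ η δ : ℝ) : avoidedGap Hmix Hcost l₀ ρ η (Δs + δ) =
      sInf ((fun f : ℝ => matGap (Matrix.of (matElem b Hmix)) E Δs l₀ ρ ((Δs + δ) * (1 - f), δ)) ''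
        Set.Icc (1 - η) (1 + η)) := by
  rw [avoidedGap]
  simp only [gapIn_unitary hE Δs, add_sub_cancel_left]

theorem resonant_of_isKCoupled (hmix : IsSelfAdjoint Hmix) (hxy : x ≠ y)
    (hwrap : Complex.exp (-Complex.I * Δs * E x) = Complex.exp (-Complex.I * Δs * E y))
    (hother : ∀ z, z ≠ x → z ≠ y →
      Complex.exp (-Complex.I * Δs * E z) ≠ Complex.exp (-Complex.I * Δs * E x))
    (hk : IsKCoupled b Hmix x y k) :
    Resonant (Matrix.of (matElem b Hmix)) E Δs x y (Complex.exp (-Complex.I * Δs * E x))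
      (hopDist b Hmix y k) k where
  herm := matElem_conjTranspose b hmix
  ne := hxy
  phase_x := rfl
  phase_y := hwrap
  phase_ne := hother
  grade _ _ h := hopDist_le_add_one h
  grade_le z := hopDist_le z
  grade_x := hopDist_of_isKCoupled hk
  grade_y := (hopDist_eq_zero_iff (isKCoupled_pos hk hxy) y).mpr rfl
  pos := isKCoupled_pos hk hxy

end Operator

end QAOA

/-! ### Assembly of the theorem. -/

theorem mainTheorem2
    {V : Type*} [NormedAddCommGroup V] [InnerProductSpace ℂ V] [FiniteDimensional ℂ V]
    {ι : Type*} [Fintype ι]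
    (Hmix Hcost : V →L[ℂ] V) (hmix : IsSelfAdjoint Hmix) (hcost : IsSelfAdjoint Hcost)
    (b : OrthonormalBasis ι ℂ V) (E : ι → ℝ)
    (hE : ∀ i, Hcost (b i) = (E i : ℂ) • b i)
    (Δs : ℝ) (hΔs : Δs ≠ 0) (x y : ι)
    (hxy : E x ≠ E y)
    (hwrap : Complex.exp (-Complex.I * Δs * E x) = Complex.exp (-Complex.I * Δs * E y))
    (hother : ∀ z, z ≠ x → z ≠ y →
      Complex.exp (-Complex.I * Δs * E z) ≠ Complex.exp (-Complex.I * Δs * E x))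
    (k : ℕ) (hk : QAOA.IsKCoupled b Hmix x y k) :
    -- for every sufficiently small disc about the degenerate eigenvalue
    ∀ᶠ ρ in 𝓝[>] (0 : ℝ),
      -- near the degeneracy, exactly two eigenvalues lie in the disc
      (∀ᶠ p : ℝ × ℝ in 𝓝 (1, Δs), ∃ l₁ l₂ : ℂ,
        QAOA.eigenvaluesIn (QAOA.unitary Hmix Hcost p.1 p.2)
          (Complex.exp (-Complex.I * Δs * E x)) ρ = {l₁, l₂}) ∧
      -- the gap formula for coupling distance at least two
      (2 ≤ k → QAOA.Gam b Hmix E x y ≠ 1 → ∀ᶠ η in 𝓝[>] (0 : ℝ),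
        (fun δ : ℝ =>
          QAOA.avoidedGap Hmix Hcost (Complex.exp (-Complex.I * Δs * E x)) ρ η (Δs + δ) -
            2 * ‖QAOA.cEff b Hmix E Δs x y k‖ * |δ / (QAOA.Gam b Hmix E x y - 1)| ^ k)
          =O[𝓝 0] fun δ : ℝ => δ ^ (k + 1)) ∧
      -- the closed form for coupling distance one
      (k = 1 → ∀ᶠ η in 𝓝[>] (0 : ℝ),
        (fun δ : ℝ =>
          QAOA.avoidedGap Hmix Hcost (Complex.exp (-Complex.I * Δs * E x)) ρ η (Δs + δ) -
            2 * ‖QAOA.matElem b Hmix x y‖ * |δ| /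
              √((QAOA.Gam b Hmix E x y - 1) ^ 2 +
                (2 * ‖QAOA.matElem b Hmix x y‖ / (E x - E y)) ^ 2))
          =O[𝓝 0] fun δ : ℝ => δ ^ 2) ∧
      -- a nonzero effective coupling makes the degeneracy isolated
      (QAOA.cEff b Hmix E Δs x y k ≠ 0 →
        QAOA.IsIsolatedDegeneracy
          (fun p => QAOA.gapIn (QAOA.unitary Hmix Hcost p.1 p.2)
            (Complex.exp (-Complex.I * Δs * E x)) ρ) (1, Δs)) := by
  classical
  have hne : x ≠ y := fun h => hxy (by rw [h])
  have R := QAOA.resonant_of_isKCoupled (E := E) (Δs := Δs) hmix hne hwrap hother hk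
  have hoff := QAOA.norm_offCoeff (E := E) (Δs := Δs) hne hwrap hother hk
  have hΔ : E x - E y ≠ 0 := sub_ne_zero.mpr hxy
  -- Identifies `D = e (Γ - 1)`, so that `e δ / D` becomes `δ / (Γ - 1)`.
  have hD : (Matrix.of (QAOA.matElem b Hmix) x x).re - (Matrix.of (QAOA.matElem b Hmix) y y).re -
      (E x - E y) = (E x - E y) * (QAOA.Gam b Hmix E x y - 1) := by
    rw [QAOA.Gam, mul_sub, mul_one, mul_div_cancel₀ _ hΔ]
    rfl
  have hpos := QAOA.isKCoupled_pos hk hne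
  filter_upwards [R.exists_gapBound] with ρ ⟨C, hC, ε, hε, hpair, hres⟩
  rw [hoff, hD] at hpair hres
  have hsmall : ∀ᶠ p : ℝ × ℝ in 𝓝 0, |p.1| < ε ∧ |p.2| < ε :=
    (QAOA.eventually_abs_fst_lt le_rfl hε).and (QAOA.eventually_abs_snd_lt le_rfl hε)
  have hbound : ∀ᶠ p : ℝ × ℝ in 𝓝 0, ∃ α, QAOA.GapBound C (E x - E y)
      ((E x - E y) * (QAOA.Gam b Hmix E x y - 1)) ‖QAOA.cEff b Hmix E Δs x y k‖ k p.1 p.2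
      (QAOA.matGap (Matrix.of (QAOA.matElem b Hmix)) E Δs
        (Complex.exp (-Complex.I * Δs * E x)) ρ p) α := by
    filter_upwards [hsmall] with p hp
    obtain ⟨l₁, l₂, α, h1, h2⟩ := hpair p.1 p.2 hp.1 hp.2
    exact ⟨α, by rwa [QAOA.matGap_eq h1]⟩
  have hparam : Tendsto (fun p : ℝ × ℝ => (p.2 * (1 - p.1), p.2 - Δs)) (𝓝 (1, Δs)) (𝓝 0) :=
    Continuous.tendsto' (by fun_prop) _ _ (by simp)
  refine ⟨?_, fun hk2 hΓ => ?_, fun hk1 => ?_, fun hc => ⟨?_, ?_⟩⟩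
  · filter_upwards [hparam.eventually hsmall] with p hp
    obtain ⟨l₁, l₂, α, h1, -⟩ := hpair _ _ hp.1 hp.2
    exact ⟨l₁, l₂, by rw [QAOA.eigenvaluesIn_eq b, QAOA.matRep_unitary hE Δs]; exact h1⟩
  · have hDne : (E x - E y) * (QAOA.Gam b Hmix E x y - 1) ≠ 0 :=
      mul_ne_zero hΔ (sub_ne_zero.mpr hΓ)
    have hup := QAOA.exists_upper_of_pos (k := k) (C := C) (e := E x - E y)
      (c := ‖QAOA.cEff b Hmix E Δs x y k‖) (G := QAOA.matGap (Matrix.of (QAOA.matElem b Hmix)) E Δs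
        (Complex.exp (-Complex.I * Δs * E x)) ρ) hpos hDne fun κ hκ => by
      filter_upwards [hres hDne κ hκ] with δ ⟨τ, l₁, l₂, α, h1, h2, h3, h4⟩
      exact ⟨τ, α, h1, by rwa [QAOA.matGap_eq h2], h4⟩
    filter_upwards [QAOA.sInf_sub_isBigO hΔs (QAOA.exists_lower_of_two_le hk2 hDne hbound) hup]
      with η hη
    refine hη.congr_left fun δ => ?_
    rw [QAOA.avoidedGap_eq hE, mul_div_mul_left _ _ hΔ]
  · subst hk1
    rw [QAOA.cEff_one hk E Δs] at hbound
    have hcpos : 0 < ‖QAOA.matElem b Hmix x y‖ :=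
      norm_pos_iff.mpr (QAOA.matElem_ne_zero_of_isKCoupled_one hk)
    filter_upwards [QAOA.sInf_sub_isBigO hΔs (QAOA.exists_lower_of_eq_one hcpos hbound)
      (QAOA.exists_upper_of_eq_one hcpos hbound)] with η hη
    refine hη.congr_left fun δ => ?_
    -- Factoring out `|E x - E y|` converts the minimum of the linear model into the stated closed
    -- form.
    have hsqrt : √(((E x - E y) * (QAOA.Gam b Hmix E x y - 1)) ^ 2 +
        (2 * ‖QAOA.matElem b Hmix x y‖) ^ 2) =
        |E x - E y| * √((QAOA.Gam b Hmix E x y - 1) ^ 2 +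
          (2 * ‖QAOA.matElem b Hmix x y‖ / (E x - E y)) ^ 2) := by
      rw [← Real.sqrt_sq_eq_abs, ← Real.sqrt_mul (sq_nonneg _), mul_add, ← mul_pow, ← mul_pow,
        mul_div_cancel₀ _ hΔ]
    rw [QAOA.avoidedGap_eq hE, hsqrt, abs_mul, mul_left_comm,
      mul_div_mul_left _ _ (abs_ne_zero.mpr hΔ)]
  · obtain ⟨α, hα⟩ := hbound.self_of_nhds
    simp only [QAOA.gapIn_unitary hE Δs, sub_self, mul_zero]
    exact QAOA.GapBound.eq_zero hpos.ne' hα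
  · have hne0 := QAOA.eventually_gap_ne_zero hΔ (norm_pos_iff.mpr hc) hbound
    -- Since `Δs ≠ 0`, only `(1, Δs)` is sent to the origin, so punctured neighbourhoods correspond.
    have hparam' : Tendsto (fun p : ℝ × ℝ => (p.2 * (1 - p.1), p.2 - Δs)) (𝓝[≠] (1, Δs))
        (𝓝[≠] 0) := by
      refine tendsto_nhdsWithin_of_tendsto_nhds_of_eventually_within _
        (hparam.mono_left nhdsWithin_le_nhds) ?_
      filter_upwards [self_mem_nhdsWithin] with p hp h0
      obtain ⟨h1, h2⟩ : p.2 * (1 - p.1) = 0 ∧ p.2 - Δs = 0 := Prod.mk.inj h0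
      have h3 : p.2 = Δs := by linarith
      rw [h3, mul_eq_zero, or_iff_right hΔs] at h1
      exact hp (Prod.ext (by simp only; linarith) h3)
    filter_upwards [hparam'.eventually hne0] with p hp
    rwa [QAOA.gapIn_unitary hE Δs]
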